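/- Work over $\mathbb C$ and let $n\ge 1$. A *shift matrix* is a matrix $\sigma=(s_{i,j})_{1\le i,j\le n+1}$ of non-negative integers with $s_{i,j}+s_{j,k}=s_{i,k}$ whenever $|i-j|+|j-k|=|i-k|$. A composition $\mu=(\mu_1\,|\,\mu_2,\dots,\mu_{m+1})$ of $(1|n)$ (that is, $\mu_1=1$, $\mu_a\ge 1$, $\mu_2+\dots+\mu_{m+1}=n$) is *admissible* for $\sigma$ if $s_{i,j}=0$ whenever $\mu_1+\dots+\mu_{a-1}<i,j\le\mu_1+\dots+\mu_a$ for some $1\le a\le m+1$, and *minimal admissible* if moreover its length is minimal among the admissible compositions. Put $s^\mu_{a,b}=s_{\mu_1+\dots+\mu_a,\ \mu_1+\dots+\mu_b}$, and $\operatorname{pa}(a)=0$ if $a=1$, $\operatorname{pa}(a)=1$ otherwise. For $\mu$ admissible for $\sigma$, the shifted super Yangian $Y_{1|n}(\sigma)=Y_\mu(\sigma)$ of $\mathfrak{gl}_{1|n}$, in its parabolic presentation, is the superalgebra with generators $D_{a;i,j}^{(r)}$ ($1\le a\le m+1$, $1\le i,j\le\mu_a$, $r\ge0$), $E_{a;i,j}^{(r)}$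 ($1\le a\le m$, $1\le i\le\mu_a$, $1\le j\le\mu_{a+1}$, $r>s^\mu_{a,a+1}$) and $F_{a;i,j}^{(r)}$ ($1\le a\le m$, $1\le i\le\mu_{a+1}$, $1\le j\le\mu_a$, $r>s^\mu_{a+1,a}$), of which exactly the $E_{1;i,j}^{(r)}$ and $F_{1;i,j}^{(r)}$ are odd, subject to the following relations for all admissible indices. Here $[\cdot,\cdot]$ is the supercommutator, $p$ is summed over $1,\dots,\mu_a$ and $q$ over $1,\dots,\mu_{a+1}$; $\epsilon_b=1$ if $b=1$ and $\epsilon_b=-1$ if $b\ne 1$; the elements $D_{a;i,j}^{\prime(r)}$ are determined by $\sum_{t=0}^r D_{a;i,p}^{(t)}D_{a;p,j}^{\prime(r-t)}=\delta_{r0}\delta_{ij}$; terms $E^{(t)}$, $F^{(t)}$ that are not generators cancel in the relations where they seem to occur: - $D_{a;i,j}^{(0)}=\delta_{ij}$; - $[D_{a;i,j}^{(r)},D_{b;h,k}^{(s)}]=\delta_{ab}(-1)^{\operatorname{pa}(a)}\sum_{t=0}^{\min(r,s)-1}\big(D_{a;h,j}^{(t)}D_{a;i,k}^{(r+s-1-t)}-D_{a;h,j}^{(r+s-1-t)}D_{a;i,k}^{(t)}\big)$;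 - $[D_{a;i,j}^{(r)},E_{b;h,k}^{(s)}]=\epsilon_b\,\delta_{a,b}\delta_{h,j}\sum_{t=0}^{r-1}D_{a;i,p}^{(t)}E_{a;p,k}^{(r+s-1-t)}+\delta_{a,b+1}\sum_{t=0}^{r-1}D_{a;i,k}^{(t)}E_{b;h,j}^{(r+s-1-t)}$; - $[D_{a;i,j}^{(r)},F_{b;h,k}^{(s)}]=-\epsilon_b\,\delta_{a,b}\delta_{k,i}\sum_{t=0}^{r-1}F_{b;h,p}^{(r+s-1-t)}D_{a;p,j}^{(t)}-\delta_{a,b+1}\sum_{t=0}^{r-1}F_{b;i,k}^{(r+s-1-t)}D_{a;h,j}^{(t)}$; - $[E_{a;i,j}^{(r)},E_{a;h,k}^{(s)}]=\sum_{t=1}^{r-1}E_{a;i,k}^{(t)}E_{a;h,j}^{(r+s-1-t)}-\sum_{t=1}^{s-1}E_{a;i,k}^{(t)}E_{a;h,j}^{(r+s-1-t)}$; - $[F_{a;i,j}^{(r)},F_{a;h,k}^{(s)}]=\epsilon_a\Big(\sum_{t=1}^{r-1}F_{a;i,k}^{(r+s-1-t)}F_{a;h,j}^{(t)}-\sum_{t=1}^{s-1}F_{a;i,k}^{(r+s-1-t)}F_{a;h,j}^{(t)}\Big)$;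 - $[E_{a;i,j}^{(r)},F_{b;h,k}^{(s)}]=\delta_{a,b}\sum_{t=0}^{r+s-1}D_{a+1;h,j}^{(r+s-1-t)}D_{a;i,k}^{\prime(t)}$; - $[E_{a;i,j}^{(r+1)},E_{a+1;h,k}^{(s)}]-[E_{a;i,j}^{(r)},E_{a+1;h,k}^{(s+1)}]=-\delta_{h,j}E_{a;i,q}^{(r)}E_{a+1;q,k}^{(s)}$; - $[F_{a;i,j}^{(r+1)},F_{a+1;h,k}^{(s)}]-[F_{a;i,j}^{(r)},F_{a+1;h,k}^{(s+1)}]=\delta_{i,k}F_{a+1;h,q}^{(s)}F_{a;q,j}^{(r)}$; - $[E_{a;i,j}^{(r)},E_{b;h,k}^{(s)}]=0$ if $b>a+1$, or if $b=a+1$ and $h\ne j$; - $[F_{a;i,j}^{(r)},F_{b;h,k}^{(s)}]=0$ if $b>a+1$, or if $b=a+1$ and $i\ne k$; - $\big[E_{a;i,j}^{(r)},[E_{a;h,k}^{(s)},E_{b;f,g}^{(l)}]\big]+\big[E_{a;i,j}^{(s)},[E_{a;h,k}^{(r)},E_{b;f,g}^{(l)}]\big]=0$ if $|a-b|\ge1$;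 - $\big[F_{a;i,j}^{(r)},[F_{a;h,k}^{(s)},F_{b;f,g}^{(l)}]\big]+\big[F_{a;i,j}^{(s)},[F_{a;h,k}^{(r)},F_{b;f,g}^{(l)}]\big]=0$ if $|a-b|\ge1$. **Theorem.** Let $\sigma$ be a shift matrix, let $\mu=(\mu_1\,|\,\mu_2,\dots,\mu_{m+1})$ be a minimal admissible shape for $\sigma$, and let $\beta=\mu_{m+1}$. For $1\le i,j\le\beta$ let $\tilde e_{i,j}=e_{i,j}+\delta_{i,j}(n-1-\beta)\in U(\mathfrak{gl}_\beta)$, where $U(\mathfrak{gl}_\beta)$ is regarded as a purely even superalgebra. 1. Suppose $s_{n+1-\beta,n+2-\beta}\ne0$. Let $\dot s_{i,j}=s_{i,j}-1$ if $i\le n+1-\beta<j$ and $\dot s_{i,j}=s_{i,j}$ otherwise. Then $\dot\sigma=(\dot s_{i,j})$ is a shift matrix for which $\mu$ is admissible, and there is a unique algebra homomorphism $\Delta_R:Y_{1|n}(\sigma)\to Y_{1|n}(\dot\sigma)\otimes U(\mathfrak{gl}_\beta)$ with $$D_{a;i,j}^{(r)}\mapsto\dot D_{a;i,j}^{(r)}\otimes1-\delta_{a,m+1}\sum_{k=1}^\beta\dot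 D_{a;i,k}^{(r-1)}\otimes\tilde e_{k,j},\quad E_{a;i,j}^{(r)}\mapsto\dot E_{a;i,j}^{(r)}\otimes1-\delta_{a,m}\sum_{k=1}^\beta\dot E_{a;i,k}^{(r-1)}\otimes\tilde e_{k,j},\quad F_{a;i,j}^{(r)}\mapsto\dot F_{a;i,j}^{(r)}\otimes1;$$ it is a homomorphism of superalgebras. 2. Suppose $s_{n+2-\beta,n+1-\beta}\ne0$. Let $\dot s_{i,j}=s_{i,j}-1$ if $j\le n+1-\beta<i$ and $\dot s_{i,j}=s_{i,j}$ otherwise. Then $\dot\sigma=(\dot s_{i,j})$ is a shift matrix for which $\mu$ is admissible, and there is a unique algebra homomorphism $\Delta_L:Y_{1|n}(\sigma)\to U(\mathfrak{gl}_\beta)\otimes Y_{1|n}(\dot\sigma)$ with $$D_{a;i,j}^{(r)}\mapsto1\otimes\dot D_{a;i,j}^{(r)}-\delta_{a,m+1}\sum_{k=1}^\beta\tilde e_{i,k}\otimes\dot D_{a;k,j}^{(r-1)},\quad E_{a;i,j}^{(r)}\mapsto1\otimes\dot E_{a;i,j}^{(r)},\quad F_{a;i,j}^{(r)}\mapsto1\otimes\dot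 F_{a;i,j}^{(r)}-\delta_{a,m}\sum_{k=1}^\beta\tilde e_{i,k}\otimes\dot F_{a;k,j}^{(r-1)};$$ it is a homomorphism of superalgebras. Here the dotted generators are those of $Y_{1|n}(\dot\sigma)=Y_\mu(\dot\sigma)$ for the same $\mu$, and $\dot D_{a;i,j}^{(-1)}=0$. -/

import Mathlib

open scoped TensorProduct

noncomputable section

namespace SuperYangian

/-! ### Shift matrices and admissible shapes

Matrices of size `n + 1` are written as functions `σ : ℕ → ℕ → ℕ` of the indices `1, …, n + 1`;
the values of `σ` at other indices are never used. -/

/-- `σ` is a shift matrix of size `n + 1`: `s_{i,j} + s_{j,k} = s_{i,k}` whenever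
`|i - j| + |j - k| = |i - k|`. -/
def IsShiftMatrix (n : ℕ) (σ : ℕ → ℕ → ℕ) : Prop :=
  ∀ i j k : ℕ, i ∈ Finset.Icc 1 (n + 1) → j ∈ Finset.Icc 1 (n + 1) → k ∈ Finset.Icc 1 (n + 1) →
    |(i : ℤ) - j| + |(j : ℤ) - k| = |(i : ℤ) - k| → σ i j + σ j k = σ i k

variable {n : ℕ}

/-- The parts `μ_1 = 1`, `μ_{a+1} = ν_a` of the composition `μ = (1 | ν_1, …, ν_m)` of `(1|n)`
attached to a composition `ν` of `n`, where `m = ν.length`. It is `0` outside `1 ≤ a ≤ m + 1`. -/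
def part (ν : Composition n) : ℕ → ℕ
  | 0 => 0
  | a + 1 => (1 :: ν.blocks).getD a 0

/-- The partial sums `μ_1 + ⋯ + μ_a`. -/
def partSum (ν : Composition n) (a : ℕ) : ℕ := ∑ b ∈ Finset.Icc 1 a, part ν b

/-- The last part `β = μ_{m+1}`. -/
def lastPart (ν : Composition n) : ℕ := part ν (ν.length + 1)

/-- `s^μ_{a,b} = s_{μ_1 + ⋯ + μ_a, μ_1 + ⋯ + μ_b}`. -/
def blockShift (ν : Composition n) (σ : ℕ → ℕ → ℕ) (a b : ℕ) : ℕ :=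
  σ (partSum ν a) (partSum ν b)

/-- `μ = (1 | ν)` is admissible for `σ`: the diagonal blocks of `σ` cut out by `μ` vanish. -/
def IsAdmissible (σ : ℕ → ℕ → ℕ) (ν : Composition n) : Prop :=
  ∀ a : ℕ, a ≤ ν.length → ∀ i j : ℕ,
    i ∈ Finset.Icc (partSum ν a + 1) (partSum ν (a + 1)) →
    j ∈ Finset.Icc (partSum ν a + 1) (partSum ν (a + 1)) → σ i j = 0

/-- `μ = (1 | ν)` is an admissible shape for `σ` of minimal length. -/
def IsMinimalAdmissible (σ : ℕ → ℕ → ℕ) (ν : Composition n) : Prop :=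
  IsAdmissible σ ν ∧ ∀ ν' : Composition n, IsAdmissible σ ν' → ν.length ≤ ν'.length

/-! ### Generators -/

/-- Symbols `D_{a;i,j}^{(r)}`, `E_{a;i,j}^{(r)}`, `F_{a;i,j}^{(r)}`, before the restriction of
the indices. -/
inductive Symb : Type
  | D (a i j r : ℕ) : Symb
  | E (a i j r : ℕ) : Symb
  | F (a i j r : ℕ) : Symb

/-- Which symbols are generators of `Y_μ(σ)`. -/
def Symb.Valid (ν : Composition n) (σ : ℕ → ℕ → ℕ) : Symb → Prop
  | .D a i j _ => a ∈ Finset.Icc 1 (ν.length + 1) ∧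
      i ∈ Finset.Icc 1 (part ν a) ∧ j ∈ Finset.Icc 1 (part ν a)
  | .E a i j r => a ∈ Finset.Icc 1 ν.length ∧
      i ∈ Finset.Icc 1 (part ν a) ∧ j ∈ Finset.Icc 1 (part ν (a + 1)) ∧
      blockShift ν σ a (a + 1) < r
  | .F a i j r => a ∈ Finset.Icc 1 ν.length ∧
      i ∈ Finset.Icc 1 (part ν (a + 1)) ∧ j ∈ Finset.Icc 1 (part ν a) ∧
      blockShift ν σ (a + 1) a < r

/-- The set of generators of `Y_μ(σ)`. -/
abbrev Gen (ν : Composition n) (σ : ℕ → ℕ → ℕ) : Type := {g : Symb // g.Valid ν σ}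

/-- The parity of `a ∈ {1, …, m + 1}`: `0` for `a = 1` and `1` otherwise. -/
def pa (a : ℕ) : ℕ := if a = 1 then 0 else 1

/-- The parity of `E_{a;i,j}^{(r)}` and of `F_{a;i,j}^{(r)}`: odd exactly for `a = 1`. -/
def rootParity (a : ℕ) : ZMod 2 := if a = 1 then 1 else 0

/-- The parity of a generator. -/
def Symb.parity : Symb → ZMod 2
  | .D _ _ _ _ => 0
  | .E a _ _ _ => rootParity a
  | .F a _ _ _ => rootParity a

/-- The free algebra on the generators. -/
abbrev Free (ν : Composition n) (σ : ℕ → ℕ → ℕ) : Type := FreeAlgebra ℂ (Gen ν σ)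

open Classical in
/-- A symbol as an element of the free algebra. By convention, a symbol whose indices are out of
range is `0`. -/
def symb (ν : Composition n) (σ : ℕ → ℕ → ℕ) (g : Symb) : Free ν σ :=
  if h : g.Valid ν σ then FreeAlgebra.ι ℂ (⟨g, h⟩ : Gen ν σ) else 0

/-- The supercommutator `[x, y] = x y - (-1)^{|x||y|} y x` of elements of parities `p` and `q`. -/
def sbr {A : Type*} [Ring A] (p q : ZMod 2) (x y : A) : A :=
  x * y - (-1) ^ (p.val * q.val) * (y * x)

/-- Coefficients of the inverse matrix power series: given the coefficients
`X r i j` (`1 ≤ i, j ≤ q`) of a matrix `X(u) = 1 + ∑_{r ≥ 1} X^{(r)} u^{-r}`, these are the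
coefficients `X'^{(r)}_{i,j}` of `X(u)⁻¹`, that is, the solution of
`∑_{t=0}^r ∑_p X^{(t)}_{i,p} X'^{(r-t)}_{p,j} = δ_{r,0} δ_{i,j}`. -/
def invCoeff {A : Type*} [Ring A] (q : ℕ) (X : ℕ → ℕ → ℕ → A) : ℕ → ℕ → ℕ → A
  | 0, i, j => if i = j then 1 else 0
  | r + 1, i, j => -∑ t : Fin (r + 1), ∑ p ∈ Finset.Icc 1 q,
      X (t + 1) i p * invCoeff q X (r - t) p j
  termination_by r => r
  decreasing_by omega

theorem sum_mul_invCoeff {A : Type*} [Ring A] (q : ℕ) (X : ℕ → ℕ → ℕ → A)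
    (hX : ∀ i ∈ Finset.Icc 1 q, ∀ j ∈ Finset.Icc 1 q, X 0 i j = if i = j then 1 else 0)
    (r i j : ℕ) (hi : i ∈ Finset.Icc 1 q) :
    ∑ t ∈ Finset.range (r + 1), ∑ p ∈ Finset.Icc 1 q, X t i p * invCoeff q X (r - t) p j =
      if r = 0 ∧ i = j then 1 else 0 := by
  have h0 : ∀ s, ∑ p ∈ Finset.Icc 1 q, X 0 i p * invCoeff q X s p j = invCoeff q X s i j := by
    intro s
    rw [Finset.sum_congr rfl (fun p hp => by rw [hX i hi p hp])]
    simp only [ite_mul, one_mul, zero_mul, Finset.sum_ite_eq, hi, if_true]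
  rw [Finset.sum_range_succ']
  simp only [Nat.sub_zero, h0]
  cases r with
  | zero => simp [invCoeff]
  | succ r =>
    rw [invCoeff, ← Fin.sum_univ_eq_sum_range
      (fun t => ∑ p ∈ Finset.Icc 1 q, X (t + 1) i p * invCoeff q X (r + 1 - (t + 1)) p j) (r + 1)]
    simp

/-! ### Defining relations of `Y_μ(σ)` -/

section Relations

variable (ν : Composition n) (σ : ℕ → ℕ → ℕ)

/-- `D_{a;i,j}^{(r)}` in the free algebra. -/
def fD (a i j r : ℕ) : Free ν σ := symb ν σ (.D a i j r)

/-- `E_{a;i,j}^{(r)}` in the free algebra. -/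
def fE (a i j r : ℕ) : Free ν σ := symb ν σ (.E a i j r)

/-- `F_{a;i,j}^{(r)}` in the free algebra. -/
def fF (a i j r : ℕ) : Free ν σ := symb ν σ (.F a i j r)

/-- `D'_{a;i,j}^{(r)}`, the coefficients of the inverse of the matrix `D_a(u)`. -/
def fDinv (a i j r : ℕ) : Free ν σ :=
  invCoeff (part ν a) (fun t i' j' => fD ν σ a i' j' t) r i j

/-- The defining relations of `Y_μ(σ)`. In `ee_same` and `ff_same` the lower terms of the two sums
cancel, so that only generators occur. -/
inductive Rel : Free ν σ → Free ν σ → Prop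
  | d_zero (a i j : ℕ) (h₁ : Symb.Valid ν σ (.D a i j 0)) :
      Rel (fD ν σ a i j 0) (if i = j then 1 else 0)
  | dd (a i j r b h k s : ℕ) (h₁ : Symb.Valid ν σ (.D a i j r)) (h₂ : Symb.Valid ν σ (.D b h k s)) :
      Rel (sbr 0 0 (fD ν σ a i j r) (fD ν σ b h k s))
        (if a = b then (-1) ^ pa a * ∑ t ∈ Finset.range (min r s),
          (fD ν σ a h j t * fD ν σ a i k (r + s - 1 - t)
            - fD ν σ a h j (r + s - 1 - t) * fD ν σ a i k t) else 0)
  | de (a i j r b h k s : ℕ) (h₁ : Symb.Valid ν σ (.D a i j r)) (h₂ : Symb.Valid ν σ (.E b h k s)) :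
      Rel (sbr 0 (rootParity b) (fD ν σ a i j r) (fE ν σ b h k s))
        ((if a = b ∧ h = j then (if b = 1 then 1 else -1) *
            ∑ t ∈ Finset.range r, ∑ p ∈ Finset.Icc 1 (part ν a),
              fD ν σ a i p t * fE ν σ a p k (r + s - 1 - t) else 0)
        + (if a = b + 1 then
            ∑ t ∈ Finset.range r, fD ν σ a i k t * fE ν σ b h j (r + s - 1 - t) else 0))
  | df (a i j r b h k s : ℕ) (h₁ : Symb.Valid ν σ (.D a i j r)) (h₂ : Symb.Valid ν σ (.F b h k s)) :
      Rel (sbr 0 (rootParity b) (fD ν σ a i j r) (fF ν σ b h k s))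
        ((if a = b ∧ k = i then (if b = 1 then -1 else 1) *
            ∑ t ∈ Finset.range r, ∑ p ∈ Finset.Icc 1 (part ν a),
              fF ν σ b h p (r + s - 1 - t) * fD ν σ a p j t else 0)
        - (if a = b + 1 then
            ∑ t ∈ Finset.range r, fF ν σ b i k (r + s - 1 - t) * fD ν σ a h j t else 0))
  | ee_same (a i j r h k s : ℕ)
      (h₁ : Symb.Valid ν σ (.E a i j r)) (h₂ : Symb.Valid ν σ (.E a h k s)) :
      Rel (sbr (rootParity a) (rootParity a) (fE ν σ a i j r) (fE ν σ a h k s))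
        (∑ t ∈ Finset.Ico 1 r, fE ν σ a i k t * fE ν σ a h j (r + s - 1 - t)
          - ∑ t ∈ Finset.Ico 1 s, fE ν σ a i k t * fE ν σ a h j (r + s - 1 - t))
  | ff_same (a i j r h k s : ℕ)
      (h₁ : Symb.Valid ν σ (.F a i j r)) (h₂ : Symb.Valid ν σ (.F a h k s)) :
      Rel (sbr (rootParity a) (rootParity a) (fF ν σ a i j r) (fF ν σ a h k s))
        ((if a = 1 then 1 else -1) *
          (∑ t ∈ Finset.Ico 1 r, fF ν σ a i k (r + s - 1 - t) * fF ν σ a h j t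
            - ∑ t ∈ Finset.Ico 1 s, fF ν σ a i k (r + s - 1 - t) * fF ν σ a h j t))
  | ef (a i j r b h k s : ℕ) (h₁ : Symb.Valid ν σ (.E a i j r)) (h₂ : Symb.Valid ν σ (.F b h k s)) :
      Rel (sbr (rootParity a) (rootParity b) (fE ν σ a i j r) (fF ν σ b h k s))
        (if a = b then ∑ t ∈ Finset.range (r + s),
          fD ν σ (a + 1) h j (r + s - 1 - t) * fDinv ν σ a i k t else 0)
  | ee_next (a i j r h k s : ℕ)
      (h₁ : Symb.Valid ν σ (.E a i j r)) (h₂ : Symb.Valid ν σ (.E (a + 1) h k s)) :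
      Rel (sbr (rootParity a) (rootParity (a + 1)) (fE ν σ a i j (r + 1)) (fE ν σ (a + 1) h k s)
          - sbr (rootParity a) (rootParity (a + 1)) (fE ν σ a i j r) (fE ν σ (a + 1) h k (s + 1)))
        (if h = j then
          -∑ q ∈ Finset.Icc 1 (part ν (a + 1)), fE ν σ a i q r * fE ν σ (a + 1) q k s else 0)
  | ff_next (a i j r h k s : ℕ)
      (h₁ : Symb.Valid ν σ (.F a i j r)) (h₂ : Symb.Valid ν σ (.F (a + 1) h k s)) :
      Rel (sbr (rootParity a) (rootParity (a + 1)) (fF ν σ a i j (r + 1)) (fF ν σ (a + 1) h k s)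
          - sbr (rootParity a) (rootParity (a + 1)) (fF ν σ a i j r) (fF ν σ (a + 1) h k (s + 1)))
        (if i = k then
          ∑ q ∈ Finset.Icc 1 (part ν (a + 1)), fF ν σ (a + 1) h q s * fF ν σ a q j r else 0)
  | ee_zero (a i j r b h k s : ℕ)
      (h₁ : Symb.Valid ν σ (.E a i j r)) (h₂ : Symb.Valid ν σ (.E b h k s))
      (hab : a + 1 < b ∨ (b = a + 1 ∧ h ≠ j)) :
      Rel (sbr (rootParity a) (rootParity b) (fE ν σ a i j r) (fE ν σ b h k s)) 0
  | ff_zero (a i j r b h k s : ℕ)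
      (h₁ : Symb.Valid ν σ (.F a i j r)) (h₂ : Symb.Valid ν σ (.F b h k s))
      (hab : a + 1 < b ∨ (b = a + 1 ∧ i ≠ k)) :
      Rel (sbr (rootParity a) (rootParity b) (fF ν σ a i j r) (fF ν σ b h k s)) 0
  | eee (a i j r h k s b f g l : ℕ)
      (h₁ : Symb.Valid ν σ (.E a i j r)) (h₂ : Symb.Valid ν σ (.E a h k s))
      (h₃ : Symb.Valid ν σ (.E b f g l)) (hab : a ≠ b) :
      Rel (sbr (rootParity a) (rootParity a + rootParity b) (fE ν σ a i j r)
            (sbr (rootParity a) (rootParity b) (fE ν σ a h k s) (fE ν σ b f g l))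
          + sbr (rootParity a) (rootParity a + rootParity b) (fE ν σ a i j s)
            (sbr (rootParity a) (rootParity b) (fE ν σ a h k r) (fE ν σ b f g l))) 0
  | fff (a i j r h k s b f g l : ℕ)
      (h₁ : Symb.Valid ν σ (.F a i j r)) (h₂ : Symb.Valid ν σ (.F a h k s))
      (h₃ : Symb.Valid ν σ (.F b f g l)) (hab : a ≠ b) :
      Rel (sbr (rootParity a) (rootParity a + rootParity b) (fF ν σ a i j r)
            (sbr (rootParity a) (rootParity b) (fF ν σ a h k s) (fF ν σ b f g l))
          + sbr (rootParity a) (rootParity a + rootParity b) (fF ν σ a i j s)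
            (sbr (rootParity a) (rootParity b) (fF ν σ a h k r) (fF ν σ b f g l))) 0

/-- The shifted super Yangian `Y_μ(σ)` of `gl_{1|n}`, in its parabolic presentation for the
admissible shape `μ = (1 | ν)`. -/
abbrev Yangian : Type := RingQuot (Rel ν σ)

/-- The generator `D_{a;i,j}^{(r)}` of `Y_μ(σ)`. -/
def yD (a i j r : ℕ) : Yangian ν σ := RingQuot.mkAlgHom ℂ (Rel ν σ) (fD ν σ a i j r)

/-- The generator `E_{a;i,j}^{(r)}` of `Y_μ(σ)`. -/
def yE (a i j r : ℕ) : Yangian ν σ := RingQuot.mkAlgHom ℂ (Rel ν σ) (fE ν σ a i j r)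

/-- The generator `F_{a;i,j}^{(r)}` of `Y_μ(σ)`. -/
def yF (a i j r : ℕ) : Yangian ν σ := RingQuot.mkAlgHom ℂ (Rel ν σ) (fF ν σ a i j r)

/-- The `ℤ/2`-grading of `Y_μ(σ)`: the component of parity `p` is spanned by the monomials in the
generators of total parity `p`. -/
def yParity (p : ZMod 2) : Submodule ℂ (Yangian ν σ) :=
  Submodule.span ℂ {x | ∃ l : List (Gen ν σ), (l.map fun g => g.1.parity).sum = p ∧
    x = (l.map fun g => RingQuot.mkAlgHom ℂ (Rel ν σ) (FreeAlgebra.ι ℂ g)).prod}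

end Relations

section Grading

variable (ν : Composition n) (σ : ℕ → ℕ → ℕ)

/-- The sign automorphism of the free algebra. -/
def freeSign : Free ν σ →ₐ[ℂ] Free ν σ :=
  FreeAlgebra.lift ℂ fun g => (-1 : ℂ) ^ g.1.parity.val • FreeAlgebra.ι ℂ g

theorem freeSign_symb (g : Symb) :
    freeSign ν σ (symb ν σ g) = (-1 : ℂ) ^ g.parity.val • symb ν σ g := by
  unfold symb
  split_ifs with h
  · rw [freeSign, FreeAlgebra.lift_ι_apply]
  · simp

theorem freeSign_D (a i j r : ℕ) : freeSign ν σ (fD ν σ a i j r) = fD ν σ a i j r := by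
  simp [fD, freeSign_symb, Symb.parity]

theorem freeSign_E (a i j r : ℕ) :
    freeSign ν σ (fE ν σ a i j r) = (-1 : ℂ) ^ (rootParity a).val • fE ν σ a i j r := by
  simp [fE, freeSign_symb, Symb.parity]

theorem freeSign_F (a i j r : ℕ) :
    freeSign ν σ (fF ν σ a i j r) = (-1 : ℂ) ^ (rootParity a).val • fF ν σ a i j r := by
  simp [fF, freeSign_symb, Symb.parity]

theorem map_invCoeff {A B : Type*} [Ring A] [Ring B] (f : A →+* B) (q : ℕ) (X : ℕ → ℕ → ℕ → A)
    (r i j : ℕ) : f (invCoeff q X r i j) = invCoeff q (fun t a b => f (X t a b)) r i j := by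
  induction r using Nat.strong_induction_on generalizing i with
  | _ r ih =>
    cases r with
    | zero => rw [invCoeff, invCoeff]; split_ifs <;> simp
    | succ r =>
      rw [invCoeff, invCoeff, map_neg, map_sum]
      congr 1
      refine Finset.sum_congr rfl fun t _ => ?_
      rw [map_sum]
      refine Finset.sum_congr rfl fun p _ => ?_
      rw [map_mul, ih _ (by omega)]

theorem freeSign_Dinv (a i j r : ℕ) : freeSign ν σ (fDinv ν σ a i j r) = fDinv ν σ a i j r := by
  unfold fDinv
  have h := map_invCoeff (freeSign ν σ : Free ν σ →+* Free ν σ) (part ν a)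
    (fun t i' j' => fD ν σ a i' j' t) r i j
  simp only [RingHom.coe_coe, freeSign_D] at h
  exact h

theorem freeSign_sbr {p q : ZMod 2} {x y : Free ν σ} {c d : ℂ}
    (hx : freeSign ν σ x = c • x) (hy : freeSign ν σ y = d • y) :
    freeSign ν σ (sbr p q x y) = (c * d) • sbr p q x y := by
  simp only [sbr, map_sub, map_mul, map_pow, map_neg, map_one, hx, hy, smul_mul_assoc,
    smul_sub, mul_smul_comm, smul_smul, mul_comm d c]

theorem freeSign_rel {x y : Free ν σ} (h : Rel ν σ x y) :
    ∃ c : ℂ, freeSign ν σ x = c • x ∧ freeSign ν σ y = c • y := by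
  have hD : ∀ a i j r, freeSign ν σ (fD ν σ a i j r) = (1 : ℂ) • fD ν σ a i j r := by
    simp [freeSign_D]
  have hE := freeSign_E ν σ
  have hF := freeSign_F ν σ
  have hs : ∀ k : ℕ, (-1 : ℂ) ^ k * (-1) ^ k = 1 := fun k => by rw [← mul_pow]; simp
  cases h
  case d_zero => exact ⟨1, hD _ _ _ _, by split_ifs <;> simp⟩
  case dd =>
    refine ⟨_, freeSign_sbr ν σ (hD _ _ _ _) (hD _ _ _ _), ?_⟩
    split_ifs <;> simp [freeSign_D]
  case de =>
    refine ⟨_, freeSign_sbr ν σ (hD _ _ _ _) (hE _ _ _ _), ?_⟩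
    rw [map_add, smul_add]
    congr 1
    · split_ifs with h1 h2
      all_goals first
        | (obtain ⟨rfl, -⟩ := h1
           simp only [map_mul, map_sum, map_neg, map_one, freeSign_D, hE, mul_smul_comm,
             smul_mul_assoc, Finset.smul_sum, one_mul, neg_mul, smul_neg])
        | simp
    · split_ifs
      · simp only [map_mul, map_sum, freeSign_D, hE, mul_smul_comm, smul_mul_assoc,
          Finset.smul_sum, one_mul]
      · simp
  case df =>
    refine ⟨_, freeSign_sbr ν σ (hD _ _ _ _) (hF _ _ _ _), ?_⟩
    rw [map_sub, smul_sub]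
    congr 1
    · split_ifs with h1 h2
      all_goals first
        | (obtain ⟨rfl, -⟩ := h1
           simp only [map_mul, map_sum, map_neg, map_one, freeSign_D, hF, mul_smul_comm,
             smul_mul_assoc, Finset.smul_sum, one_mul, neg_mul, smul_neg])
        | simp
    · split_ifs
      · simp only [map_mul, map_sum, freeSign_D, hF, mul_smul_comm, smul_mul_assoc,
          Finset.smul_sum, one_mul]
      · simp
  case ee_same =>
    refine ⟨_, freeSign_sbr ν σ (hE _ _ _ _) (hE _ _ _ _), ?_⟩
    simp only [map_sub, map_sum, map_mul, hE, smul_mul_smul_comm, smul_sub, Finset.smul_sum]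
  case ff_same =>
    refine ⟨_, freeSign_sbr ν σ (hF _ _ _ _) (hF _ _ _ _), ?_⟩
    split_ifs <;>
    simp only [map_sub, map_sum, map_mul, hF, smul_mul_smul_comm, smul_sub, Finset.smul_sum,
      map_one, map_neg, one_mul, neg_mul, smul_neg]
  case ef =>
    refine ⟨_, freeSign_sbr ν σ (hE _ _ _ _) (hF _ _ _ _), ?_⟩
    split_ifs with h1
    · subst h1
      simp only [map_sum, map_mul, freeSign_D, freeSign_Dinv, hs, one_smul]
    · simp
  case ee_next =>
    refine ⟨_, by rw [map_sub, freeSign_sbr ν σ (hE _ _ _ _) (hE _ _ _ _),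
      freeSign_sbr ν σ (hE _ _ _ _) (hE _ _ _ _), ← smul_sub], ?_⟩
    split_ifs <;>
    simp only [map_neg, map_sum, map_mul, hE, smul_mul_smul_comm, smul_neg, Finset.smul_sum,
      map_zero, smul_zero]
  case ff_next =>
    refine ⟨_, by rw [map_sub, freeSign_sbr ν σ (hF _ _ _ _) (hF _ _ _ _),
      freeSign_sbr ν σ (hF _ _ _ _) (hF _ _ _ _), ← smul_sub], ?_⟩
    split_ifs <;>
    simp only [map_sum, map_mul, hF, smul_mul_smul_comm, Finset.smul_sum,
      map_zero, smul_zero, mul_comm]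
  case ee_zero => exact ⟨_, freeSign_sbr ν σ (hE _ _ _ _) (hE _ _ _ _), by simp⟩
  case ff_zero => exact ⟨_, freeSign_sbr ν σ (hF _ _ _ _) (hF _ _ _ _), by simp⟩
  case eee =>
    exact ⟨_, by rw [map_add,
      freeSign_sbr ν σ (hE _ _ _ _) (freeSign_sbr ν σ (hE _ _ _ _) (hE _ _ _ _)),
      freeSign_sbr ν σ (hE _ _ _ _) (freeSign_sbr ν σ (hE _ _ _ _) (hE _ _ _ _)), ← smul_add],
      by simp⟩
  case fff =>
    exact ⟨_, by rw [map_add,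
      freeSign_sbr ν σ (hF _ _ _ _) (freeSign_sbr ν σ (hF _ _ _ _) (hF _ _ _ _)),
      freeSign_sbr ν σ (hF _ _ _ _) (freeSign_sbr ν σ (hF _ _ _ _) (hF _ _ _ _)), ← smul_add],
      by simp⟩

/-- The sign automorphism of `Y_μ(σ)`, equal to `(-1)^p` on the component of parity `p`. -/
def ySign : Yangian ν σ →ₐ[ℂ] Yangian ν σ :=
  RingQuot.liftAlgHom ℂ ⟨(RingQuot.mkAlgHom ℂ (Rel ν σ)).comp (freeSign ν σ), fun x y h => by
    obtain ⟨c, hx, hy⟩ := freeSign_rel ν σ h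
    rw [AlgHom.comp_apply, AlgHom.comp_apply, hx, hy, map_smul, map_smul,
      RingQuot.mkAlgHom_rel ℂ h]⟩

theorem ySign_gen (g : Gen ν σ) :
    ySign ν σ (RingQuot.mkAlgHom ℂ (Rel ν σ) (FreeAlgebra.ι ℂ g)) =
      (-1 : ℂ) ^ g.1.parity.val • RingQuot.mkAlgHom ℂ (Rel ν σ) (FreeAlgebra.ι ℂ g) := by
  rw [ySign, RingQuot.liftAlgHom_mkAlgHom_apply, AlgHom.comp_apply, freeSign,
    FreeAlgebra.lift_ι_apply, map_smul]

theorem ySign_of_mem {p : ZMod 2} {x : Yangian ν σ} (hx : x ∈ yParity ν σ p) :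
    ySign ν σ x = (-1 : ℂ) ^ p.val • x := by
  have hadd : ∀ p q : ZMod 2, (-1 : ℂ) ^ p.val * (-1) ^ q.val = (-1) ^ (p + q).val := by
    intro p q
    have h : (-1 : ℤ) ^ p.val * (-1) ^ q.val = (-1) ^ (p + q).val := by revert p q; decide
    exact_mod_cast congrArg (Int.cast : ℤ → ℂ) h
  induction hx using Submodule.span_induction with
  | mem x hx =>
    obtain ⟨l, rfl, rfl⟩ := hx
    induction l with
    | nil => simp
    | cons g l ih =>
      rw [List.map_cons, List.prod_cons, map_mul, ih, ySign_gen, smul_mul_smul_comm, hadd,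
        List.map_cons, List.sum_cons]
  | zero => simp
  | add x y _ _ hx hy => rw [map_add, hx, hy, smul_add]
  | smul c x _ hx => rw [map_smul, hx, smul_comm]

instance yParity_gradedMonoid : SetLike.GradedMonoid (yParity ν σ) where
  one_mem := Submodule.subset_span ⟨[], by simp, by simp⟩
  mul_mem := by
    intro p q x y hx hy
    induction hx using Submodule.span_induction with
    | mem x hx =>
      induction hy using Submodule.span_induction with
      | mem y hy =>
        obtain ⟨l, rfl, rfl⟩ := hx
        obtain ⟨l', rfl, rfl⟩ := hy
        exact Submodule.subset_span ⟨l ++ l', by simp, by simp⟩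
      | zero => simp
      | add y z _ _ hy hz => rw [mul_add]; exact add_mem hy hz
      | smul c y _ hy => rw [mul_smul_comm]; exact Submodule.smul_mem _ c hy
    | zero => simp
    | add x z _ _ hx hz => rw [add_mul]; exact add_mem hx hz
    | smul c x _ hx => rw [smul_mul_assoc]; exact Submodule.smul_mem _ c hx

theorem yParity_isCompl : IsCompl (yParity ν σ 0) (yParity ν σ 1) := by
  constructor
  · rw [Submodule.disjoint_def]
    intro x h0 h1
    have e0 := ySign_of_mem ν σ h0
    rw [ySign_of_mem ν σ h1] at e0
    have e1 : ((1 : ZMod 2).val) = 1 := rfl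
    simp only [e1, ZMod.val_zero, pow_one, pow_zero, one_smul, neg_smul] at e0
    have e2 : (2 : ℂ) • x = 0 := by
      rw [two_smul]; nth_rewrite 1 [← e0]; exact neg_add_cancel x
    exact (smul_eq_zero.mp e2).resolve_left two_ne_zero
  · rw [codisjoint_iff, eq_top_iff]
    rintro x -
    obtain ⟨y, rfl⟩ := RingQuot.mkAlgHom_surjective ℂ (Rel ν σ) x
    have hp : ∀ p, yParity ν σ p ≤ yParity ν σ 0 ⊔ yParity ν σ 1 := by
      intro p
      have : p = 0 ∨ p = 1 := by revert p; decide
      rcases this with rfl | rfl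
      exacts [le_sup_left, le_sup_right]
    induction y using FreeAlgebra.induction with
    | grade0 c =>
      rw [AlgHom.commutes, Algebra.algebraMap_eq_smul_one]
      exact Submodule.smul_mem _ c (hp 0 SetLike.GradedOne.one_mem)
    | grade1 g => exact hp g.1.parity (Submodule.subset_span ⟨[g], by simp, by simp⟩)
    | mul a b ha hb =>
      rw [map_mul]
      obtain ⟨a0, ha0, a1, ha1, ha⟩ := Submodule.mem_sup.mp ha
      obtain ⟨b0, hb0, b1, hb1, hb⟩ := Submodule.mem_sup.mp hb
      rw [← ha, ← hb, add_mul, mul_add, mul_add]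
      exact add_mem
        (add_mem (hp _ (SetLike.GradedMul.mul_mem ha0 hb0))
          (hp _ (SetLike.GradedMul.mul_mem ha0 hb1)))
        (add_mem (hp _ (SetLike.GradedMul.mul_mem ha1 hb0))
          (hp _ (SetLike.GradedMul.mul_mem ha1 hb1)))
    | add a b ha hb => rw [map_add]; exact add_mem ha hb

/-- `Y_μ(σ)` is a superalgebra. -/
instance yParity_gradedAlgebra : GradedAlgebra (yParity ν σ) where
  toGradedMonoid := yParity_gradedMonoid ν σ
  toDecomposition := DirectSum.IsInternal.chooseDecomposition _
    ((DirectSum.isInternal_submodule_iff_isCompl (yParity ν σ) (i := 0) (j := 1) (by decide)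
      (by ext p; simp only [Set.mem_univ, Set.mem_insert_iff, Set.mem_singleton_iff, true_iff]
          revert p; decide)).mpr (yParity_isCompl ν σ))

end Grading

/-! ### The enveloping algebra of `gl_β` and parities on tensor products -/

attribute [local instance] LieRing.ofAssociativeRing

/-- The universal enveloping algebra of `gl_β`. -/
abbrev Ugl (β : ℕ) : Type := UniversalEnvelopingAlgebra ℂ (Matrix (Fin β) (Fin β) ℂ)

/-- The matrix unit `e_{i,j}` of `gl_β`, for `1 ≤ i, j ≤ β`. -/
def matUnit (β i j : ℕ) : Matrix (Fin β) (Fin β) ℂ :=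
  Matrix.of fun p q => if (p : ℕ) + 1 = i ∧ (q : ℕ) + 1 = j then 1 else 0

/-- `ẽ_{i,j} = e_{i,j} + δ_{i,j} (n - 1 - β)` in `U(gl_β)`. -/
def eTilde (n β i j : ℕ) : Ugl β :=
  UniversalEnvelopingAlgebra.ι ℂ (matUnit β i j)
    + algebraMap ℂ (Ugl β) (if i = j then (n : ℂ) - 1 - (β : ℂ) else 0)

/-- The purely even grading: everything has parity `0`. -/
def evenParity (B : Type*) [AddCommMonoid B] [Module ℂ B] (p : ZMod 2) : Submodule ℂ B :=
  if p = 0 then ⊤ else ⊥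

/-- The parity grading of a tensor product of graded spaces. -/
def tensorParity {A B : Type*} [AddCommMonoid A] [Module ℂ A] [AddCommMonoid B] [Module ℂ B]
    (𝒜 : ZMod 2 → Submodule ℂ A) (ℬ : ZMod 2 → Submodule ℂ B) (p : ZMod 2) :
    Submodule ℂ (A ⊗[ℂ] B) :=
  ⨆ q : ZMod 2, Submodule.map₂ (TensorProduct.mk ℂ A B) (𝒜 q) (ℬ (p - q))

/-- An algebra homomorphism is a superalgebra homomorphism when it preserves parities. -/
def PreservesParity {A B : Type*} [Semiring A] [Algebra ℂ A] [Semiring B] [Algebra ℂ B]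
    (𝒜 : ZMod 2 → Submodule ℂ A) (ℬ : ZMod 2 → Submodule ℂ B) (f : A →ₐ[ℂ] B) : Prop :=
  ∀ (p : ZMod 2) (x : A), x ∈ 𝒜 p → f x ∈ ℬ p

/-! ### The two lowered matrices and the formulas for the baby comultiplications -/

/-- Lower `s_{i,j}` by one for `i ≤ n + 1 - β < j`. -/
def lowerR (n β : ℕ) (σ : ℕ → ℕ → ℕ) (i j : ℕ) : ℕ :=
  if i ≤ n + 1 - β ∧ n + 1 - β < j then σ i j - 1 else σ i j

/-- Lower `s_{i,j}` by one for `j ≤ n + 1 - β < i`. -/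
def lowerL (n β : ℕ) (σ : ℕ → ℕ → ℕ) (i j : ℕ) : ℕ :=
  if j ≤ n + 1 - β ∧ n + 1 - β < i then σ i j - 1 else σ i j

/-- The defining formulas of `Δ_R`; here `σ'` is the lowered matrix and `D^{(-1)} = 0`. Since
`U(gl_β)` is purely even, the tensor product of superalgebras is the usual one. -/
structure IsDeltaR (ν : Composition n) (σ σ' : ℕ → ℕ → ℕ)
    (Δ : Yangian ν σ →ₐ[ℂ] Yangian ν σ' ⊗[ℂ] Ugl (lastPart ν)) : Prop where
  map_D : ∀ a i j r : ℕ, Symb.Valid ν σ (.D a i j r) →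
    Δ (yD ν σ a i j r) = yD ν σ' a i j r ⊗ₜ[ℂ] 1
      - if a = ν.length + 1 ∧ 1 ≤ r then ∑ k ∈ Finset.Icc 1 (lastPart ν),
          yD ν σ' a i k (r - 1) ⊗ₜ[ℂ] eTilde n (lastPart ν) k j else 0
  map_E : ∀ a i j r : ℕ, Symb.Valid ν σ (.E a i j r) →
    Δ (yE ν σ a i j r) = yE ν σ' a i j r ⊗ₜ[ℂ] 1
      - if a = ν.length then ∑ k ∈ Finset.Icc 1 (lastPart ν),
          yE ν σ' a i k (r - 1) ⊗ₜ[ℂ] eTilde n (lastPart ν) k j else 0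
  map_F : ∀ a i j r : ℕ, Symb.Valid ν σ (.F a i j r) →
    Δ (yF ν σ a i j r) = yF ν σ' a i j r ⊗ₜ[ℂ] 1

/-- The defining formulas of `Δ_L`. -/
structure IsDeltaL (ν : Composition n) (σ σ' : ℕ → ℕ → ℕ)
    (Δ : Yangian ν σ →ₐ[ℂ] Ugl (lastPart ν) ⊗[ℂ] Yangian ν σ') : Prop where
  map_D : ∀ a i j r : ℕ, Symb.Valid ν σ (.D a i j r) →
    Δ (yD ν σ a i j r) = 1 ⊗ₜ[ℂ] yD ν σ' a i j r
      - if a = ν.length + 1 ∧ 1 ≤ r then ∑ k ∈ Finset.Icc 1 (lastPart ν),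
          eTilde n (lastPart ν) i k ⊗ₜ[ℂ] yD ν σ' a k j (r - 1) else 0
  map_E : ∀ a i j r : ℕ, Symb.Valid ν σ (.E a i j r) →
    Δ (yE ν σ a i j r) = 1 ⊗ₜ[ℂ] yE ν σ' a i j r
  map_F : ∀ a i j r : ℕ, Symb.Valid ν σ (.F a i j r) →
    Δ (yF ν σ a i j r) = 1 ⊗ₜ[ℂ] yF ν σ' a i j r
      - if a = ν.length then ∑ k ∈ Finset.Icc 1 (lastPart ν),
          eTilde n (lastPart ν) i k ⊗ₜ[ℂ] yF ν σ' a k j (r - 1) else 0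

end SuperYangian

end

open scoped TensorProduct

noncomputable section

namespace SuperYangian

/-! ### Supercommutators -/

section Supercommutator

variable {A : Type*} [Ring A]

/-! In generating series, `Δ_R` multiplies the last blocks `D_{m+1}(u)` and `E_m(u)` on the right by
`1 - u⁻¹ẽ` and leaves all other series alone. The entries of `ẽ` commute with the Yangian factor and
satisfy the commutation relations of matrix units; the scalar added on the diagonal is central and
drops out of these relations. The new `E_m^{(r)}` involves the old `E_m^{(r)}` and `E_m^{(r-1)}`, so
its range of upper indices starts one step later: this is why the shift of the target is one less.

It has to be shown that the deformed families satisfy the defining relations. The relations are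
first put in difference form (multiplied by `u - v`, so to speak), where the sums over upper indices
disappear except in the relation between `E_a` and `F_a`: this is `SatisfiesRel`. Telescoping along
the lines `r + s = const` (`eq_sum_range_of_diff`, `eq_icoDiff_of_diff`) recovers the sums, and
`SatisfiesRel.exists_algHom` turns a family into a homomorphism.

A relation in which only one factor of each product is deformed survives by linearity. Where two
deformed factors meet, `sbr_deform` expands the supercommutator into four brackets of the old rows
at neighbouring upper indices, plus two sums caused by `[e, e] ≠ 0`. Those two sums are just what
makes the deformed right-hand side come out, so each new relation is a signed combination of old
ones. The cubic relation with two factors `E_m` and one `E_b` follows the same pattern with `[E_m,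
E_b]` as second row; it also needs the shifted cubic relation `SatisfiesRel.eee_shift`. All cases
are assembled in `SatisfiesRel.deform_last`.

`Δ_L` is the mirror image: passing to opposite rings, transposing indices and exchanging `E` with
`F` (`SatisfiesRel.transpose`) turns left multiplication into right multiplication. Uniqueness and
parity are checked on generators. -/

theorem sbr_zero_left (q : ZMod 2) (x y : A) : sbr 0 q x y = x * y - y * x := by
  simp [sbr]

theorem sbr_zero_right (p : ZMod 2) (x y : A) : sbr p 0 x y = x * y - y * x := by
  simp [sbr]

theorem sbr_zero_left_eq_zero (q : ZMod 2) {x y : A} (h : Commute x y) : sbr 0 q x y = 0 := by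
  rw [sbr_zero_left, h.eq, sub_self]

theorem commute_of_sbr_eq_zero {q : ZMod 2} {x y : A} (h : sbr 0 q x y = 0) : Commute x y := by
  rw [sbr_zero_left] at h
  exact sub_eq_zero.mp h

theorem sbr_sub_left (p q : ZMod 2) (x x' y : A) :
    sbr p q (x - x') y = sbr p q x y - sbr p q x' y := by
  simp only [sbr, sub_mul, mul_sub]; abel

theorem sbr_sub_right (p q : ZMod 2) (x y y' : A) :
    sbr p q x (y - y') = sbr p q x y - sbr p q x y' := by
  simp only [sbr, sub_mul, mul_sub]; abel

theorem sbr_neg_right (p q : ZMod 2) (x y : A) : sbr p q x (-y) = -sbr p q x y := by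
  simp only [sbr, neg_mul, mul_neg]; abel

@[simp] theorem sbr_apply_zero_left (p q : ZMod 2) (y : A) : sbr p q 0 y = 0 := by simp [sbr]

@[simp] theorem sbr_apply_zero_right (p q : ZMod 2) (x : A) : sbr p q x 0 = 0 := by simp [sbr]

theorem sbr_sum_left {ι : Type*} (p q : ZMod 2) (I : Finset ι) (X : ι → A) (y : A) :
    sbr p q (∑ i ∈ I, X i) y = ∑ i ∈ I, sbr p q (X i) y := by
  simp only [sbr, Finset.sum_mul, Finset.mul_sum, Finset.sum_sub_distrib]

theorem sbr_sum_right {ι : Type*} (p q : ZMod 2) (I : Finset ι) (x : A) (Y : ι → A) :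
    sbr p q x (∑ i ∈ I, Y i) = ∑ i ∈ I, sbr p q x (Y i) := by
  simp only [sbr, Finset.sum_mul, Finset.mul_sum, Finset.sum_sub_distrib]

/-- The parity labels do not change when `c` is multiplied in, so this is meant for even `c`. -/
theorem sbr_mul_right (p q : ZMod 2) (x y : A) {c : A} (h : Commute c x) :
    sbr p q x (y * c) = sbr p q x y * c := by
  simp only [sbr, sub_mul, mul_assoc, h.eq]

theorem sbr_mul_left (p q : ZMod 2) (x y : A) {c : A} (h : Commute c y) :
    sbr p q (x * c) y = sbr p q x y * c := by
  simp only [sbr, sub_mul, mul_assoc, h.eq]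

theorem sbr_sub_sum_right {ι : Type*} (p q : ZMod 2) (I : Finset ι) (x y : A) (Y c : ι → A)
    (h : ∀ i, Commute (c i) x) :
    sbr p q x (y - ∑ i ∈ I, Y i * c i) = sbr p q x y - ∑ i ∈ I, sbr p q x (Y i) * c i := by
  rw [sbr_sub_right, sbr_sum_right]
  simp only [fun i => sbr_mul_right p q x (Y i) (h i)]

theorem sbr_sub_sum_left {ι : Type*} (p q : ZMod 2) (I : Finset ι) (x y : A) (X c : ι → A)
    (h : ∀ i, Commute (c i) y) :
    sbr p q (x - ∑ i ∈ I, X i * c i) y = sbr p q x y - ∑ i ∈ I, sbr p q (X i) y * c i := by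
  rw [sbr_sub_left, sbr_sum_left]
  simp only [fun i => sbr_mul_left p q (X i) y (h i)]

theorem commute_sbr (p q : ZMod 2) {x y c : A} (hx : Commute c x) (hy : Commute c y) :
    Commute c (sbr p q x y) := by
  have h : Commute c ((-1) ^ (p.val * q.val)) := (Commute.neg_one_right c).pow_right _
  exact (hx.mul_right hy).sub_right (h.mul_right (hy.mul_right hx))

theorem sbr_swap (p q : ZMod 2) (x y : A) :
    sbr q p y x = -((-1) ^ (p.val * q.val) * sbr p q x y) := by
  rcases neg_one_pow_eq_or A (p.val * q.val) with h | h <;>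
    simp only [sbr, mul_comm q.val p.val, h] <;> noncomm_ring

theorem map_sbr {B 𝓕 : Type*} [Ring B] [FunLike 𝓕 A B] [RingHomClass 𝓕 A B] (f : 𝓕)
    (p q : ZMod 2) (x y : A) :
    f (sbr p q x y) = sbr p q (f x) (f y) := by
  simp [sbr]

-- The sign in `sbr` is symmetric in the two parities, so reversing products costs no sign.
open MulOpposite in
theorem sbr_op (p q : ZMod 2) (x y : A) : sbr p q (op x) (op y) = op (sbr q p y x) := by
  rcases Nat.even_or_odd (p.val * q.val) with h | h <;>
    simp [sbr, mul_comm q.val p.val, h.neg_one_pow]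

/-- The supercommutator of two elements deformed by commuting copies of the matrix units. -/
theorem sbr_sub_sum_sub_sum (p q : ZMod 2) (I : Finset ℕ) {e : ℕ → ℕ → A} (x y : A) (X Y : ℕ → A)
    {j k : ℕ} (hj : j ∈ I) (hk : k ∈ I)
    (he : ∀ a ∈ I, ∀ b ∈ I, ∀ c ∈ I, ∀ d ∈ I, e a b * e c d - e c d * e a b =
      (if c = b then e a d else 0) - (if a = d then e c b else 0))
    (hx : ∀ a b, Commute (e a b) x) (hy : ∀ a b, Commute (e a b) y)
    (hX : ∀ a b i, Commute (e a b) (X i)) (hY : ∀ a b i, Commute (e a b) (Y i)) :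
    sbr p q (x - ∑ a ∈ I, X a * e a j) (y - ∑ b ∈ I, Y b * e b k) =
      sbr p q x y - ∑ b ∈ I, sbr p q x (Y b) * e b k - ∑ a ∈ I, sbr p q (X a) y * e a j
      + ∑ a ∈ I, ∑ b ∈ I, sbr p q (X a) (Y b) * (e b k * e a j)
      + ∑ a ∈ I, X a * Y j * e a k - ∑ b ∈ I, X k * Y b * e b j := by
  -- The units are brought into the order `e b k * e a j`, which they already have in the second
  -- half of the bracket. The commutator of the two units leaves the two Kronecker terms.
  have key : ∀ a ∈ I, ∀ b ∈ I, sbr p q (X a * e a j) (Y b * e b k) =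
      sbr p q (X a) (Y b) * (e b k * e a j) +
      ((if b = j then X a * Y b * e a k else 0) - (if a = k then X a * Y b * e b j else 0)) := by
    intro a ha b hb
    have h1 := he a ha j hj b hb k hk
    have e1 : X a * e a j * (Y b * e b k) = X a * Y b * (e a j * e b k) := by
      rw [mul_assoc, ← mul_assoc (e a j), (hY a j b).eq]; noncomm_ring
    have e2 : Y b * e b k * (X a * e a j) = Y b * X a * (e b k * e a j) := by
      rw [mul_assoc, ← mul_assoc (e b k), (hX b k a).eq]; noncomm_ring
    rw [sbr, sbr, e1, e2, sub_eq_iff_eq_add.mp h1]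
    split_ifs <;> noncomm_ring
  simp only [sbr_sub_right, sbr_sub_left, sbr_sum_right, sbr_sum_left,
    fun b => sbr_mul_right p q x (Y b) (hx b k), fun a => sbr_mul_left p q (X a) y (hy a j)]
  rw [Finset.sum_sub_distrib, Finset.sum_comm (s := I) (t := I)
    (f := fun b a => sbr p q (X a * e a j) (Y b * e b k)), Finset.sum_congr rfl fun a ha =>
      Finset.sum_congr rfl (key a ha)]
  simp only [Finset.sum_add_distrib, Finset.sum_sub_distrib, Finset.sum_ite_eq', hj, if_true]
  rw [Finset.sum_comm (f := fun a b => if a = k then X a * Y b * e b j else 0)]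
  simp only [Finset.sum_ite_eq', hk, if_true]
  abel

theorem sub_sum_mul_sub_sum (I : Finset ℕ) {e : ℕ → ℕ → A} (x y : A) (X Y : ℕ → A) (j k : ℕ)
    (hy : ∀ a b, Commute (e a b) y) (hY : ∀ a b i, Commute (e a b) (Y i)) :
    (x - ∑ a ∈ I, X a * e a j) * (y - ∑ b ∈ I, Y b * e b k) =
      x * y - ∑ b ∈ I, x * Y b * e b k - ∑ a ∈ I, X a * y * e a j
      + ∑ a ∈ I, ∑ b ∈ I, X a * Y b * (e a j * e b k) := by
  have key : ∀ a b, X a * e a j * (Y b * e b k) = X a * Y b * (e a j * e b k) := by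
    intro a b
    rw [mul_assoc, ← mul_assoc (e a j), (hY a j b).eq]; noncomm_ring
  have key' : ∀ a, X a * e a j * y = X a * y * e a j := by
    intro a
    rw [mul_assoc, (hy a j).eq]; noncomm_ring
  simp only [sub_mul, mul_sub, Finset.sum_mul, Finset.mul_sum, key, key', mul_assoc x]
  rw [Finset.sum_sub_distrib, Finset.sum_comm (s := I) (t := I)
    (f := fun b a => X a * Y b * (e a j * e b k))]
  abel

end Supercommutator

/-! ### Doubly indexed families and their differences -/

section Differences

variable {A : Type*} [AddCommGroup A]

/-- Each step lowers `r` and raises `s` at the cost of one value of `G`; the descent ends at `r =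
0`, where `P` vanishes. -/
theorem eq_sum_range_of_diff {s₀ : ℕ} {P G : ℕ → ℕ → A} (h0 : ∀ s, s₀ < s → P 0 s = 0)
    (h : ∀ r s, s₀ < s → P (r + 1) s - P r (s + 1) = G r s) (r s : ℕ) (hs : s₀ < s) :
    P r s = ∑ t ∈ Finset.range r, G t (r + s - 1 - t) := by
  induction r generalizing s with
  | zero => simpa using h0 s hs
  | succ r ih =>
    rw [Finset.sum_range_succ, sub_eq_iff_eq_add'.mp (h r s hs), ih (s + 1) (by omega)]
    congr 1
    · exact Finset.sum_congr rfl fun t _ => by congr 1; omega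
    · congr 1; omega

theorem sum_range_diff (G : ℕ → ℕ → A) (r s : ℕ) :
    ∑ t ∈ Finset.range (r + 1), G t (r + 1 + s - 1 - t) -
      ∑ t ∈ Finset.range r, G t (r + (s + 1) - 1 - t) = G r s := by
  rw [show r + 1 + s - 1 = r + s by omega, show r + (s + 1) - 1 = r + s by omega,
    Finset.sum_range_succ, add_sub_cancel_left, show r + s - r = s by omega]

/-- For `s ≤ r` the surplus range `s ≤ t < r` is stable under `t ↦ r + s - 1 - t`, which changes the
sign of the summand, so it contributes nothing. -/
theorem sum_range_min (G : ℕ → ℕ → A) (r s : ℕ) :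
    ∑ t ∈ Finset.range r, (G t (r + s - 1 - t) - G (r + s - 1 - t) t) =
      ∑ t ∈ Finset.range (min r s), (G t (r + s - 1 - t) - G (r + s - 1 - t) t) := by
  rcases le_total r s with h | h
  · rw [min_eq_left h]
  · rw [min_eq_right h, ← Finset.sum_range_add_sum_Ico _ h, add_eq_left, Finset.sum_sub_distrib,
      sub_eq_zero]
    refine Finset.sum_nbij' (fun t => r + s - 1 - t) (fun t => r + s - 1 - t) ?_ ?_ ?_ ?_ ?_
    all_goals intro t ht; simp only [Finset.mem_Ico] at ht ⊢
    all_goals try omega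
    rw [show r + s - 1 - (r + s - 1 - t) = t by omega]

theorem sum_range_min_diff (G : ℕ → ℕ → A) (r s : ℕ) :
    ∑ t ∈ Finset.range (min (r + 1) s), (G t (r + 1 + s - 1 - t) - G (r + 1 + s - 1 - t) t) -
      ∑ t ∈ Finset.range (min r (s + 1)),
        (G t (r + (s + 1) - 1 - t) - G (r + (s + 1) - 1 - t) t) = G r s - G s r := by
  rw [show r + 1 + s - 1 = r + s by omega, show r + (s + 1) - 1 = r + s by omega]
  rcases lt_trichotomy r s with h | h | h
  · rw [min_eq_left (by omega), min_eq_left (by omega), Finset.sum_range_succ, add_sub_cancel_left,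
      show r + s - r = s by omega]
  · subst h; simp
  · rw [min_eq_right (by omega), min_eq_right (by omega), Finset.sum_range_succ,
      show r + s - s = r by omega]
    abel

/-- `∑_{1 ≤ t < r} H(t, r+s-1-t) - ∑_{1 ≤ t < s} H(t, r+s-1-t)`. -/
def icoDiff (H : ℕ → ℕ → A) (r s : ℕ) : A :=
  ∑ t ∈ Finset.Ico 1 r, H t (r + s - 1 - t) - ∑ t ∈ Finset.Ico 1 s, H t (r + s - 1 - t)

theorem icoDiff_self (H : ℕ → ℕ → A) (r : ℕ) : icoDiff H r r = 0 := sub_self _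

theorem icoDiff_succ (H : ℕ → ℕ → A) {r : ℕ} (hr : 0 < r) : icoDiff H (r + 1) r = H r r := by
  rw [icoDiff, Finset.sum_Ico_succ_top hr, add_sub_cancel_left]
  congr 1; omega

theorem icoDiff_diff (H : ℕ → ℕ → A) {r s : ℕ} (hr : 0 < r) (hs : 0 < s) :
    icoDiff H (r + 1) s - icoDiff H r (s + 1) = H r s + H s r := by
  simp only [icoDiff]
  rw [Finset.sum_Ico_succ_top hr, Finset.sum_Ico_succ_top hs, show r + 1 + s - 1 = r + s by omega,
    show r + (s + 1) - 1 = r + s by omega, show r + s - r = s by omega,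
    show r + s - s = r by omega]
  abel

theorem icoDiff_swap (H : ℕ → ℕ → A) (r s : ℕ) : icoDiff H s r = -icoDiff H r s := by
  simp only [icoDiff, add_comm s r, neg_sub]

/-- The terms common to both sums cancel. Those that remain have both indices above `s₀`, which is
why symbols that are not generators play no role. -/
theorem icoDiff_congr {H H' : ℕ → ℕ → A} {s₀ r s : ℕ} (hr : s₀ < r) (hs : s₀ < s)
    (h : ∀ t u, s₀ < t → s₀ < u → H t u = H' t u) : icoDiff H r s = icoDiff H' r s := by
  wlog hrs : s ≤ r generalizing r s
  · rw [icoDiff_swap, icoDiff_swap H', this hs hr (by omega)]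
  · have key : ∀ K : ℕ → ℕ → A, icoDiff K r s = ∑ t ∈ Finset.Ico s r, K t (r + s - 1 - t) := by
      intro K
      rw [icoDiff, ← Finset.sum_Ico_consecutive _ (by omega : 1 ≤ s) hrs, add_sub_cancel_left]
    rw [key, key]
    refine Finset.sum_congr rfl fun t ht => ?_
    rw [Finset.mem_Ico] at ht
    exact h _ _ (by omega) (by omega)

/-- The difference relation compares neighbours on a line `r + s = const`, so each line needs one
known value: `B r r` if the sum is even, `B (r + 1) r` if it is odd. From there the induction is on
the distance `|r - s|`. -/
theorem eq_icoDiff_of_diff {s₀ : ℕ} {B H : ℕ → ℕ → A} (h0 : ∀ r, s₀ < r → B r r = 0)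
    (h1 : ∀ r, s₀ < r → B (r + 1) r = H r r)
    (h : ∀ r s, s₀ < r → s₀ < s → B (r + 1) s - B r (s + 1) = H r s + H s r)
    (r s : ℕ) (hr : s₀ < r) (hs : s₀ < s) : B r s = icoDiff H r s := by
  have main : ∀ d r s, s₀ < r → s₀ < s → r - s ≤ d → s - r ≤ d → B r s = icoDiff H r s := by
    have step : ∀ r s, s₀ < r → s₀ < s → (B (r + 1) s = icoDiff H (r + 1) s ↔
        B r (s + 1) = icoDiff H r (s + 1)) := by
      intro r s hr hs
      have e := (h r s hr hs).trans (icoDiff_diff H (by omega) (by omega)).symm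
      rw [sub_eq_sub_iff_add_eq_add] at e
      constructor
      · intro e'; rw [e'] at e; exact (add_left_cancel e).symm
      · intro e'; rw [e', add_comm] at e
        exact add_left_cancel (e.trans (add_comm _ _))
    have base : ∀ r, s₀ < r → B (r + 1) r = icoDiff H (r + 1) r := fun r hr => by
      rw [h1 r hr, icoDiff_succ H (by omega)]
    intro d
    induction d with
    | zero =>
      intro r s hr hs h2 h3
      obtain rfl : r = s := by omega
      rw [h0 r hr, icoDiff_self]
    | succ d ih =>
      intro r s hr hs h2 h3
      rcases lt_trichotomy r s with h4 | rfl | h4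
      · obtain ⟨s, rfl⟩ : ∃ s', s = s' + 1 := ⟨s - 1, by omega⟩
        rw [← step r s hr (by omega)]
        by_cases h5 : r = s
        · subst h5; exact base r hr
        · exact ih _ _ (by omega) (by omega) (by omega) (by omega)
      · rw [h0 r hr, icoDiff_self]
      · obtain ⟨r, rfl⟩ : ∃ r', r = r' + 1 := ⟨r - 1, by omega⟩
        by_cases h5 : r = s
        · subst h5; exact base r hs
        · rw [step r s (by omega) hs]
          exact ih _ _ (by omega) (by omega) (by omega) (by omega)
  exact main (r + s) r s hr hs (by omega) (by omega)

end Differences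

/-! ### Families satisfying the defining relations -/

section Relations

variable {n : ℕ} {A : Type*} [Ring A]

/-- Families `D`, `E`, `F` of elements of a ring that satisfy the relations of `Y_μ(σ)`, written
through differences, so that no sums over the upper indices occur. -/
structure SatisfiesRel (ν : Composition n) (σ : ℕ → ℕ → ℕ) (D E F : ℕ → ℕ → ℕ → ℕ → A) :
    Prop where
  d_zero (a i j : ℕ) : Symb.Valid ν σ (.D a i j 0) → D a i j 0 = if i = j then 1 else 0
  dd_ne (a i j r b h k s : ℕ) : Symb.Valid ν σ (.D a i j r) → Symb.Valid ν σ (.D b h k s) →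
    a ≠ b → sbr 0 0 (D a i j r) (D b h k s) = 0
  dd_same (a i j r h k s : ℕ) : Symb.Valid ν σ (.D a i j r) → Symb.Valid ν σ (.D a h k s) →
    sbr 0 0 (D a i j (r + 1)) (D a h k s) - sbr 0 0 (D a i j r) (D a h k (s + 1)) =
      (-1) ^ pa a * (D a h j r * D a i k s - D a h j s * D a i k r)
  de_ne (a i j r b h k s : ℕ) : Symb.Valid ν σ (.D a i j r) → Symb.Valid ν σ (.E b h k s) →
    a ≠ b → a ≠ b + 1 → sbr 0 (rootParity b) (D a i j r) (E b h k s) = 0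
  de_same (i j r b h k s : ℕ) : Symb.Valid ν σ (.D b i j r) → Symb.Valid ν σ (.E b h k s) →
    sbr 0 (rootParity b) (D b i j (r + 1)) (E b h k s)
        - sbr 0 (rootParity b) (D b i j r) (E b h k (s + 1)) =
      if h = j then (if b = 1 then 1 else -1) *
        ∑ p ∈ Finset.Icc 1 (part ν b), D b i p r * E b p k s else 0
  de_next (i j r b h k s : ℕ) : Symb.Valid ν σ (.D (b + 1) i j r) →
    Symb.Valid ν σ (.E b h k s) →
    sbr 0 (rootParity b) (D (b + 1) i j (r + 1)) (E b h k s)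
        - sbr 0 (rootParity b) (D (b + 1) i j r) (E b h k (s + 1)) =
      D (b + 1) i k r * E b h j s
  df_ne (a i j r b h k s : ℕ) : Symb.Valid ν σ (.D a i j r) → Symb.Valid ν σ (.F b h k s) →
    a ≠ b → a ≠ b + 1 → sbr 0 (rootParity b) (D a i j r) (F b h k s) = 0
  df_same (i j r b h k s : ℕ) : Symb.Valid ν σ (.D b i j r) → Symb.Valid ν σ (.F b h k s) →
    sbr 0 (rootParity b) (D b i j (r + 1)) (F b h k s)
        - sbr 0 (rootParity b) (D b i j r) (F b h k (s + 1)) =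
      if k = i then (if b = 1 then -1 else 1) *
        ∑ p ∈ Finset.Icc 1 (part ν b), F b h p s * D b p j r else 0
  df_next (i j r b h k s : ℕ) : Symb.Valid ν σ (.D (b + 1) i j r) →
    Symb.Valid ν σ (.F b h k s) →
    sbr 0 (rootParity b) (D (b + 1) i j (r + 1)) (F b h k s)
        - sbr 0 (rootParity b) (D (b + 1) i j r) (F b h k (s + 1)) =
      -(F b i k s * D (b + 1) h j r)
  ee_diag (a i j r h k : ℕ) : Symb.Valid ν σ (.E a i j r) → Symb.Valid ν σ (.E a h k r) →
    sbr (rootParity a) (rootParity a) (E a i j r) (E a h k r) = 0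
  -- This value next to the diagonal is kept as a separate relation because `ee_diff` at `r = s`
  -- only controls a difference of two brackets.
  ee_succ (a i j r h k : ℕ) : Symb.Valid ν σ (.E a i j r) → Symb.Valid ν σ (.E a h k r) →
    sbr (rootParity a) (rootParity a) (E a i j (r + 1)) (E a h k r) = E a i k r * E a h j r
  ee_diff (a i j r h k s : ℕ) : Symb.Valid ν σ (.E a i j r) → Symb.Valid ν σ (.E a h k s) →
    sbr (rootParity a) (rootParity a) (E a i j (r + 1)) (E a h k s)
        - sbr (rootParity a) (rootParity a) (E a i j r) (E a h k (s + 1)) =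
      E a i k r * E a h j s + E a i k s * E a h j r
  ff_diag (a i j r h k : ℕ) : Symb.Valid ν σ (.F a i j r) → Symb.Valid ν σ (.F a h k r) →
    sbr (rootParity a) (rootParity a) (F a i j r) (F a h k r) = 0
  ff_succ (a i j r h k : ℕ) : Symb.Valid ν σ (.F a i j r) → Symb.Valid ν σ (.F a h k r) →
    sbr (rootParity a) (rootParity a) (F a i j (r + 1)) (F a h k r) =
      (if a = 1 then 1 else -1) * (F a i k r * F a h j r)
  ff_diff (a i j r h k s : ℕ) : Symb.Valid ν σ (.F a i j r) → Symb.Valid ν σ (.F a h k s) →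
    sbr (rootParity a) (rootParity a) (F a i j (r + 1)) (F a h k s)
        - sbr (rootParity a) (rootParity a) (F a i j r) (F a h k (s + 1)) =
      (if a = 1 then 1 else -1) * (F a i k s * F a h j r + F a i k r * F a h j s)
  ef_ne (a i j r b h k s : ℕ) : Symb.Valid ν σ (.E a i j r) → Symb.Valid ν σ (.F b h k s) →
    a ≠ b → sbr (rootParity a) (rootParity b) (E a i j r) (F b h k s) = 0
  ef_same (a i j r h k s : ℕ) : Symb.Valid ν σ (.E a i j r) → Symb.Valid ν σ (.F a h k s) →
    sbr (rootParity a) (rootParity a) (E a i j r) (F a h k s) =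
      ∑ t ∈ Finset.range (r + s), D (a + 1) h j (r + s - 1 - t) *
        invCoeff (part ν a) (fun t i j => D a i j t) t i k
  ee_next (a i j r h k s : ℕ) : Symb.Valid ν σ (.E a i j r) →
    Symb.Valid ν σ (.E (a + 1) h k s) →
    sbr (rootParity a) (rootParity (a + 1)) (E a i j (r + 1)) (E (a + 1) h k s)
        - sbr (rootParity a) (rootParity (a + 1)) (E a i j r) (E (a + 1) h k (s + 1)) =
      if h = j then -∑ q ∈ Finset.Icc 1 (part ν (a + 1)), E a i q r * E (a + 1) q k s else 0
  ff_next (a i j r h k s : ℕ) : Symb.Valid ν σ (.F a i j r) →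
    Symb.Valid ν σ (.F (a + 1) h k s) →
    sbr (rootParity a) (rootParity (a + 1)) (F a i j (r + 1)) (F (a + 1) h k s)
        - sbr (rootParity a) (rootParity (a + 1)) (F a i j r) (F (a + 1) h k (s + 1)) =
      if i = k then ∑ q ∈ Finset.Icc 1 (part ν (a + 1)), F (a + 1) h q s * F a q j r else 0
  ee_zero (a i j r b h k s : ℕ) : Symb.Valid ν σ (.E a i j r) → Symb.Valid ν σ (.E b h k s) →
    (a + 1 < b ∨ (b = a + 1 ∧ h ≠ j)) →
    sbr (rootParity a) (rootParity b) (E a i j r) (E b h k s) = 0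
  ff_zero (a i j r b h k s : ℕ) : Symb.Valid ν σ (.F a i j r) → Symb.Valid ν σ (.F b h k s) →
    (a + 1 < b ∨ (b = a + 1 ∧ i ≠ k)) →
    sbr (rootParity a) (rootParity b) (F a i j r) (F b h k s) = 0
  eee (a i j r h k s b f g l : ℕ) : Symb.Valid ν σ (.E a i j r) → Symb.Valid ν σ (.E a h k s) →
    Symb.Valid ν σ (.E b f g l) → a ≠ b →
    sbr (rootParity a) (rootParity a + rootParity b) (E a i j r)
        (sbr (rootParity a) (rootParity b) (E a h k s) (E b f g l))
      + sbr (rootParity a) (rootParity a + rootParity b) (E a i j s)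
        (sbr (rootParity a) (rootParity b) (E a h k r) (E b f g l)) = 0
  fff (a i j r h k s b f g l : ℕ) : Symb.Valid ν σ (.F a i j r) → Symb.Valid ν σ (.F a h k s) →
    Symb.Valid ν σ (.F b f g l) → a ≠ b →
    sbr (rootParity a) (rootParity a + rootParity b) (F a i j r)
        (sbr (rootParity a) (rootParity b) (F a h k s) (F b f g l))
      + sbr (rootParity a) (rootParity a + rootParity b) (F a i j s)
        (sbr (rootParity a) (rootParity b) (F a h k r) (F b f g l)) = 0

namespace SatisfiesRel

variable {ν : Composition n} {σ : ℕ → ℕ → ℕ} {D E F : ℕ → ℕ → ℕ → ℕ → A}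

theorem map {B : Type*} [Ring B] (H : SatisfiesRel ν σ D E F) (f : A →+* B) :
    SatisfiesRel ν σ (fun a i j r => f (D a i j r)) (fun a i j r => f (E a i j r))
      (fun a i j r => f (F a i j r)) where
  d_zero a i j h := by rw [H.d_zero a i j h, apply_ite f, map_one, map_zero]
  dd_ne a i j r b h k s h1 h2 h3 := by
    simpa [map_sbr] using congrArg f (H.dd_ne a i j r b h k s h1 h2 h3)
  dd_same a i j r h k s h1 h2 := by
    simpa [map_sbr] using congrArg f (H.dd_same a i j r h k s h1 h2)
  de_ne a i j r b h k s h1 h2 h3 h4 := by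
    simpa [map_sbr] using congrArg f (H.de_ne a i j r b h k s h1 h2 h3 h4)
  de_same i j r b h k s h1 h2 := by
    simpa [map_sbr, apply_ite f] using congrArg f (H.de_same i j r b h k s h1 h2)
  de_next i j r b h k s h1 h2 := by
    simpa [map_sbr] using congrArg f (H.de_next i j r b h k s h1 h2)
  df_ne a i j r b h k s h1 h2 h3 h4 := by
    simpa [map_sbr] using congrArg f (H.df_ne a i j r b h k s h1 h2 h3 h4)
  df_same i j r b h k s h1 h2 := by
    simpa [map_sbr, apply_ite f] using congrArg f (H.df_same i j r b h k s h1 h2)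
  df_next i j r b h k s h1 h2 := by
    simpa [map_sbr] using congrArg f (H.df_next i j r b h k s h1 h2)
  ee_diag a i j r h k h1 h2 := by
    simpa [map_sbr] using congrArg f (H.ee_diag a i j r h k h1 h2)
  ee_succ a i j r h k h1 h2 := by
    simpa [map_sbr] using congrArg f (H.ee_succ a i j r h k h1 h2)
  ee_diff a i j r h k s h1 h2 := by
    simpa [map_sbr] using congrArg f (H.ee_diff a i j r h k s h1 h2)
  ff_diag a i j r h k h1 h2 := by
    simpa [map_sbr] using congrArg f (H.ff_diag a i j r h k h1 h2)
  ff_succ a i j r h k h1 h2 := by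
    simpa [map_sbr, apply_ite f] using congrArg f (H.ff_succ a i j r h k h1 h2)
  ff_diff a i j r h k s h1 h2 := by
    simpa [map_sbr, apply_ite f] using congrArg f (H.ff_diff a i j r h k s h1 h2)
  ef_ne a i j r b h k s h1 h2 h3 := by
    simpa [map_sbr] using congrArg f (H.ef_ne a i j r b h k s h1 h2 h3)
  ef_same a i j r h k s h1 h2 := by
    simpa [map_sbr, map_invCoeff] using congrArg f (H.ef_same a i j r h k s h1 h2)
  ee_next a i j r h k s h1 h2 := by
    simpa [map_sbr, apply_ite f] using congrArg f (H.ee_next a i j r h k s h1 h2)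
  ff_next a i j r h k s h1 h2 := by
    simpa [map_sbr, apply_ite f] using congrArg f (H.ff_next a i j r h k s h1 h2)
  ee_zero a i j r b h k s h1 h2 h3 := by
    simpa [map_sbr] using congrArg f (H.ee_zero a i j r b h k s h1 h2 h3)
  ff_zero a i j r b h k s h1 h2 h3 := by
    simpa [map_sbr] using congrArg f (H.ff_zero a i j r b h k s h1 h2 h3)
  eee a i j r h k s b f' g l h1 h2 h3 h4 := by
    simpa [map_sbr] using congrArg f (H.eee a i j r h k s b f' g l h1 h2 h3 h4)
  fff a i j r h k s b f' g l h1 h2 h3 h4 := by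
    simpa [map_sbr] using congrArg f (H.fff a i j r h k s b f' g l h1 h2 h3 h4)

/-! #### The relations in summed form -/

/-- Starting value of the telescoping: `D^{(0)}` has scalar entries. -/
theorem sbr_d_zero_left (H : SatisfiesRel ν σ D E F) {a i j : ℕ}
    (h : Symb.Valid ν σ (.D a i j 0)) (q : ZMod 2) (x : A) : sbr 0 q (D a i j 0) x = 0 := by
  apply sbr_zero_left_eq_zero
  rw [H.d_zero a i j h]
  split_ifs
  exacts [Commute.one_left x, Commute.zero_left x]

theorem dd_sum (H : SatisfiesRel ν σ D E F) {a i j r h k s : ℕ}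
    (h₁ : Symb.Valid ν σ (.D a i j r)) (h₂ : Symb.Valid ν σ (.D a h k s)) :
    sbr 0 0 (D a i j r) (D a h k s) = (-1) ^ pa a * ∑ t ∈ Finset.range (min r s),
      (D a h j t * D a i k (r + s - 1 - t) - D a h j (r + s - 1 - t) * D a i k t) := by
  rcases Nat.eq_zero_or_pos s with rfl | hs
  · rw [min_eq_right (Nat.zero_le r), Finset.range_zero, Finset.sum_empty, mul_zero,
      sbr_zero_left, ← neg_sub, ← sbr_zero_left 0, H.sbr_d_zero_left h₂, neg_zero]
  · have := eq_sum_range_of_diff (s₀ := 0) (P := fun r s => sbr 0 0 (D a i j r) (D a h k s))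
      (fun s _ => H.sbr_d_zero_left h₁ 0 _) (fun r s _ => H.dd_same a i j r h k s h₁ h₂) r s hs
    simp only [← Finset.mul_sum] at this
    rw [this, sum_range_min (fun t u => D a h j t * D a i k u)]

/-- The right side of `dd_sum` depends on `r` and `s` only through `min r s` and `r + s`. The
symmetry is needed when products are reversed. -/
theorem dd_symm (H : SatisfiesRel ν σ D E F) {a i j r h k s : ℕ}
    (h₁ : Symb.Valid ν σ (.D a i j r)) (h₂ : Symb.Valid ν σ (.D a h k s)) :
    sbr 0 0 (D a i j r) (D a h k s) = sbr 0 0 (D a i j s) (D a h k r) := by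
  rw [H.dd_sum h₁ h₂, H.dd_sum (r := s) (s := r) h₁ h₂, min_comm, add_comm r s]

theorem ee_sum (H : SatisfiesRel ν σ D E F) {a i j r h k s : ℕ}
    (h₁ : Symb.Valid ν σ (.E a i j r)) (h₂ : Symb.Valid ν σ (.E a h k s)) :
    sbr (rootParity a) (rootParity a) (E a i j r) (E a h k s) =
      icoDiff (fun t u => E a i k t * E a h j u) r s := by
  obtain ⟨ha, hi, hj, hr⟩ := h₁
  obtain ⟨-, hh, hk, hs⟩ := h₂
  exact eq_icoDiff_of_diff
    (B := fun r s => sbr (rootParity a) (rootParity a) (E a i j r) (E a h k s))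
    (fun r hr => H.ee_diag a i j r h k ⟨ha, hi, hj, hr⟩ ⟨ha, hh, hk, hr⟩)
    (fun r hr => H.ee_succ a i j r h k ⟨ha, hi, hj, hr⟩ ⟨ha, hh, hk, hr⟩)
    (fun r s hr hs => H.ee_diff a i j r h k s ⟨ha, hi, hj, hr⟩ ⟨ha, hh, hk, hs⟩) r s hr hs

theorem ee_antisymm (H : SatisfiesRel ν σ D E F) {a i j r h k s : ℕ}
    (h₁ : Symb.Valid ν σ (.E a i j r)) (h₂ : Symb.Valid ν σ (.E a h k s)) :
    sbr (rootParity a) (rootParity a) (E a i j r) (E a h k s) +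
      sbr (rootParity a) (rootParity a) (E a i j s) (E a h k r) = 0 := by
  have h₁' : Symb.Valid ν σ (.E a i j s) := ⟨h₁.1, h₁.2.1, h₁.2.2.1, h₂.2.2.2⟩
  have h₂' : Symb.Valid ν σ (.E a h k r) := ⟨h₂.1, h₂.2.1, h₂.2.2.1, h₁.2.2.2⟩
  rw [H.ee_sum h₁ h₂, H.ee_sum h₁' h₂', icoDiff_swap _ r s, add_neg_cancel]

theorem ff_sum (H : SatisfiesRel ν σ D E F) {a i j r h k s : ℕ}
    (h₁ : Symb.Valid ν σ (.F a i j r)) (h₂ : Symb.Valid ν σ (.F a h k s)) :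
    sbr (rootParity a) (rootParity a) (F a i j r) (F a h k s) =
      (if a = 1 then 1 else -1) * icoDiff (fun t u => F a i k u * F a h j t) r s := by
  obtain ⟨ha, hi, hj, hr⟩ := h₁
  obtain ⟨-, hh, hk, hs⟩ := h₂
  have := eq_icoDiff_of_diff
    (B := fun r s => sbr (rootParity a) (rootParity a) (F a i j r) (F a h k s))
    (H := fun t u => (if a = 1 then 1 else -1) * (F a i k u * F a h j t))
    (fun r hr => H.ff_diag a i j r h k ⟨ha, hi, hj, hr⟩ ⟨ha, hh, hk, hr⟩)
    (fun r hr => H.ff_succ a i j r h k ⟨ha, hi, hj, hr⟩ ⟨ha, hh, hk, hr⟩)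
    (fun r s hr hs => (H.ff_diff a i j r h k s ⟨ha, hi, hj, hr⟩ ⟨ha, hh, hk, hs⟩).trans
      (mul_add _ _ _)) r s hr hs
  rw [this]
  simp only [icoDiff, mul_sub, Finset.mul_sum]

theorem de_same_sum (H : SatisfiesRel ν σ D E F) {i j r b h k s : ℕ}
    (h₁ : Symb.Valid ν σ (.D b i j r)) (h₂ : Symb.Valid ν σ (.E b h k s)) :
    sbr 0 (rootParity b) (D b i j r) (E b h k s) =
      if h = j then (if b = 1 then 1 else -1) * ∑ t ∈ Finset.range r,
        ∑ p ∈ Finset.Icc 1 (part ν b), D b i p t * E b p k (r + s - 1 - t) else 0 := by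
  obtain ⟨hb, hh, hk, hs⟩ := h₂
  rw [eq_sum_range_of_diff (P := fun r s => sbr 0 (rootParity b) (D b i j r) (E b h k s))
    (fun s _ => H.sbr_d_zero_left h₁ _ _)
    (fun r s hs => H.de_same i j r b h k s h₁ ⟨hb, hh, hk, hs⟩) r s hs]
  split_ifs <;> simp [Finset.mul_sum]

theorem de_next_sum (H : SatisfiesRel ν σ D E F) {i j r b h k s : ℕ}
    (h₁ : Symb.Valid ν σ (.D (b + 1) i j r)) (h₂ : Symb.Valid ν σ (.E b h k s)) :
    sbr 0 (rootParity b) (D (b + 1) i j r) (E b h k s) =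
      ∑ t ∈ Finset.range r, D (b + 1) i k t * E b h j (r + s - 1 - t) := by
  obtain ⟨hb, hh, hk, hs⟩ := h₂
  exact eq_sum_range_of_diff (P := fun r s => sbr 0 (rootParity b) (D (b + 1) i j r) (E b h k s))
    (fun s _ => H.sbr_d_zero_left h₁ _ _)
    (fun r s hs => H.de_next i j r b h k s h₁ ⟨hb, hh, hk, hs⟩) r s hs

theorem df_same_sum (H : SatisfiesRel ν σ D E F) {i j r b h k s : ℕ}
    (h₁ : Symb.Valid ν σ (.D b i j r)) (h₂ : Symb.Valid ν σ (.F b h k s)) :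
    sbr 0 (rootParity b) (D b i j r) (F b h k s) =
      if k = i then (if b = 1 then -1 else 1) * ∑ t ∈ Finset.range r,
        ∑ p ∈ Finset.Icc 1 (part ν b), F b h p (r + s - 1 - t) * D b p j t else 0 := by
  obtain ⟨hb, hh, hk, hs⟩ := h₂
  rw [eq_sum_range_of_diff (P := fun r s => sbr 0 (rootParity b) (D b i j r) (F b h k s))
    (fun s _ => H.sbr_d_zero_left h₁ _ _)
    (fun r s hs => H.df_same i j r b h k s h₁ ⟨hb, hh, hk, hs⟩) r s hs]
  split_ifs <;> simp [Finset.mul_sum]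

theorem df_next_sum (H : SatisfiesRel ν σ D E F) {i j r b h k s : ℕ}
    (h₁ : Symb.Valid ν σ (.D (b + 1) i j r)) (h₂ : Symb.Valid ν σ (.F b h k s)) :
    sbr 0 (rootParity b) (D (b + 1) i j r) (F b h k s) =
      -∑ t ∈ Finset.range r, F b i k (r + s - 1 - t) * D (b + 1) h j t := by
  obtain ⟨hb, hh, hk, hs⟩ := h₂
  rw [eq_sum_range_of_diff (P := fun r s => sbr 0 (rootParity b) (D (b + 1) i j r) (F b h k s))
    (fun s _ => H.sbr_d_zero_left h₁ _ _)
    (fun r s hs => H.df_next i j r b h k s h₁ ⟨hb, hh, hk, hs⟩) r s hs, Finset.sum_neg_distrib]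

end SatisfiesRel

end Relations

/-! ### Passage between the presentation and the difference relations. -/

section Presentation

variable {n : ℕ}

theorem invCoeff_congr {A : Type*} [Ring A] {q : ℕ} {X X' : ℕ → ℕ → ℕ → A}
    (h : ∀ t, ∀ i ∈ Finset.Icc 1 q, ∀ p ∈ Finset.Icc 1 q, X t i p = X' t i p) (r i j : ℕ)
    (hi : i ∈ Finset.Icc 1 q) : invCoeff q X r i j = invCoeff q X' r i j := by
  induction r using Nat.strong_induction_on generalizing i with
  | _ r ih =>
    cases r with
    | zero => rw [invCoeff, invCoeff]
    | succ r =>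
      rw [invCoeff, invCoeff]
      congr 1
      refine Finset.sum_congr rfl fun t _ => Finset.sum_congr rfl fun p hp => ?_
      rw [h _ i hi p hp, ih _ (by omega) p hp]

theorem yangian_satisfiesRel (ν : Composition n) (σ : ℕ → ℕ → ℕ) :
    SatisfiesRel ν σ (yD ν σ) (yE ν σ) (yF ν σ) := by
  have R : ∀ {x y : Free ν σ}, Rel ν σ x y →
      RingQuot.mkAlgHom ℂ (Rel ν σ) x = RingQuot.mkAlgHom ℂ (Rel ν σ) y :=
    fun h => RingQuot.mkAlgHom_rel ℂ h
  have mD : ∀ a i j r, RingQuot.mkAlgHom ℂ (Rel ν σ) (fD ν σ a i j r) = yD ν σ a i j r :=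
    fun _ _ _ _ => rfl
  have mE : ∀ a i j r, RingQuot.mkAlgHom ℂ (Rel ν σ) (fE ν σ a i j r) = yE ν σ a i j r :=
    fun _ _ _ _ => rfl
  have mF : ∀ a i j r, RingQuot.mkAlgHom ℂ (Rel ν σ) (fF ν σ a i j r) = yF ν σ a i j r :=
    fun _ _ _ _ => rfl
  have dd : ∀ {a i j r b h k s}, Symb.Valid ν σ (.D a i j r) → Symb.Valid ν σ (.D b h k s) →
      sbr 0 0 (yD ν σ a i j r) (yD ν σ b h k s) =
        if a = b then (-1) ^ pa a * ∑ t ∈ Finset.range (min r s),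
          (yD ν σ a h j t * yD ν σ a i k (r + s - 1 - t)
            - yD ν σ a h j (r + s - 1 - t) * yD ν σ a i k t) else 0 := by
    intro a i j r b h k s h₁ h₂
    simpa only [mD, mE, mF, map_sbr, apply_ite (RingQuot.mkAlgHom ℂ (Rel ν σ)), map_sum, map_mul, map_sub,
      map_pow, map_neg, map_one, map_zero] using R (Rel.dd a i j r b h k s h₁ h₂)
  have de : ∀ {a i j r b h k s}, Symb.Valid ν σ (.D a i j r) → Symb.Valid ν σ (.E b h k s) →
      sbr 0 (rootParity b) (yD ν σ a i j r) (yE ν σ b h k s) =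
        (if a = b ∧ h = j then (if b = 1 then 1 else -1) *
            ∑ t ∈ Finset.range r, ∑ p ∈ Finset.Icc 1 (part ν a),
              yD ν σ a i p t * yE ν σ a p k (r + s - 1 - t) else 0)
        + (if a = b + 1 then
            ∑ t ∈ Finset.range r, yD ν σ a i k t * yE ν σ b h j (r + s - 1 - t) else 0) := by
    intro a i j r b h k s h₁ h₂
    simpa only [mD, mE, mF, map_sbr, apply_ite (RingQuot.mkAlgHom ℂ (Rel ν σ)), map_sum, map_mul, map_sub,
      map_add, map_neg, map_one, map_zero] using R (Rel.de a i j r b h k s h₁ h₂)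
  have df : ∀ {a i j r b h k s}, Symb.Valid ν σ (.D a i j r) → Symb.Valid ν σ (.F b h k s) →
      sbr 0 (rootParity b) (yD ν σ a i j r) (yF ν σ b h k s) =
        (if a = b ∧ k = i then (if b = 1 then -1 else 1) *
            ∑ t ∈ Finset.range r, ∑ p ∈ Finset.Icc 1 (part ν a),
              yF ν σ b h p (r + s - 1 - t) * yD ν σ a p j t else 0)
        - (if a = b + 1 then
            ∑ t ∈ Finset.range r, yF ν σ b i k (r + s - 1 - t) * yD ν σ a h j t else 0) := by
    intro a i j r b h k s h₁ h₂
    simpa only [mD, mE, mF, map_sbr, apply_ite (RingQuot.mkAlgHom ℂ (Rel ν σ)), map_sum, map_mul, map_sub,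
      map_add, map_neg, map_one, map_zero] using R (Rel.df a i j r b h k s h₁ h₂)
  have ee : ∀ {a i j r h k s}, Symb.Valid ν σ (.E a i j r) → Symb.Valid ν σ (.E a h k s) →
      sbr (rootParity a) (rootParity a) (yE ν σ a i j r) (yE ν σ a h k s) =
        icoDiff (fun t u => yE ν σ a i k t * yE ν σ a h j u) r s := by
    intro a i j r h k s h₁ h₂
    simpa only [mD, mE, mF, map_sbr, map_sum, map_mul, map_sub, icoDiff] using R (Rel.ee_same a i j r h k s h₁ h₂)
  have ff : ∀ {a i j r h k s}, Symb.Valid ν σ (.F a i j r) → Symb.Valid ν σ (.F a h k s) →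
      sbr (rootParity a) (rootParity a) (yF ν σ a i j r) (yF ν σ a h k s) =
        (if a = 1 then 1 else -1) *
          icoDiff (fun t u => yF ν σ a i k u * yF ν σ a h j t) r s := by
    intro a i j r h k s h₁ h₂
    simpa only [mD, mE, mF, map_sbr, map_sum, map_mul, map_sub, apply_ite (RingQuot.mkAlgHom ℂ (Rel ν σ)),
      map_neg, map_one, icoDiff] using R (Rel.ff_same a i j r h k s h₁ h₂)
  have succE : ∀ {a i j r}, Symb.Valid ν σ (.E a i j r) → Symb.Valid ν σ (.E a i j (r + 1)) :=
    fun h => ⟨h.1, h.2.1, h.2.2.1, h.2.2.2.trans (Nat.lt_succ_self _)⟩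
  have succF : ∀ {a i j r}, Symb.Valid ν σ (.F a i j r) → Symb.Valid ν σ (.F a i j (r + 1)) :=
    fun h => ⟨h.1, h.2.1, h.2.2.1, h.2.2.2.trans (Nat.lt_succ_self _)⟩
  have posE : ∀ {a i j r}, Symb.Valid ν σ (.E a i j r) → 0 < r := fun h => pos_of_gt h.2.2.2
  have posF : ∀ {a i j r}, Symb.Valid ν σ (.F a i j r) → 0 < r := fun h => pos_of_gt h.2.2.2
  have hb : ∀ (b : ℕ) (P : Prop), ¬(b + 1 = b ∧ P) := fun b P h => Nat.succ_ne_self b h.1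
  constructor
  case d_zero =>
    intro a i j h
    simpa only [mD, apply_ite (RingQuot.mkAlgHom ℂ (Rel ν σ)), map_one, map_zero]
      using R (Rel.d_zero a i j h)
  case dd_ne =>
    intro a i j r b h k s h₁ h₂ hab
    rw [dd h₁ h₂, if_neg hab]
  case dd_same =>
    intro a i j r h k s h₁ h₂
    rw [dd (r := r + 1) h₁ h₂, dd (s := s + 1) h₁ h₂, if_pos rfl, if_pos rfl, ← mul_sub,
      sum_range_min_diff (fun t u => yD ν σ a h j t * yD ν σ a i k u)]
  case de_ne =>
    intro a i j r b h k s h₁ h₂ hab hab'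
    rw [de h₁ h₂, if_neg fun h => hab h.1, if_neg hab', add_zero]
  case de_same =>
    intro i j r b h k s h₁ h₂
    rw [de (r := r + 1) h₁ h₂, de h₁ (succE h₂), if_neg (Nat.lt_succ_self b).ne, if_neg (Nat.lt_succ_self b).ne]
    by_cases hj : h = j
    · simp only [hj, true_and, if_true, add_zero]
      rw [← mul_sub, sum_range_diff
        (fun t u => ∑ p ∈ Finset.Icc 1 (part ν b), yD ν σ b i p t * yE ν σ b p k u)]
    · simp [hj]
  case de_next =>
    intro i j r b h k s h₁ h₂
    rw [de (r := r + 1) h₁ h₂, de h₁ (succE h₂), if_neg (hb b _), if_neg (hb b _), if_pos rfl, if_pos rfl,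
      zero_add, zero_add, sum_range_diff (fun t u => yD ν σ (b + 1) i k t * yE ν σ b h j u)]
  case df_ne =>
    intro a i j r b h k s h₁ h₂ hab hab'
    rw [df h₁ h₂, if_neg fun h => hab h.1, if_neg hab', sub_zero]
  case df_same =>
    intro i j r b h k s h₁ h₂
    rw [df (r := r + 1) h₁ h₂, df h₁ (succF h₂), if_neg (Nat.lt_succ_self b).ne, if_neg (Nat.lt_succ_self b).ne]
    by_cases hj : k = i
    · simp only [hj, true_and, if_true, sub_zero]
      rw [← mul_sub, sum_range_diff
        (fun t u => ∑ p ∈ Finset.Icc 1 (part ν b), yF ν σ b h p u * yD ν σ b p j t)]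
    · simp [hj]
  case df_next =>
    intro i j r b h k s h₁ h₂
    rw [df (r := r + 1) h₁ h₂, df h₁ (succF h₂), if_neg (hb b _), if_neg (hb b _), if_pos rfl, if_pos rfl,
      zero_sub, zero_sub, neg_sub_neg, ← neg_sub,
      sum_range_diff (fun t u => yF ν σ b i k u * yD ν σ (b + 1) h j t)]
  case ee_diag =>
    intro a i j r h k h₁ h₂
    rw [ee h₁ h₂, icoDiff_self]
  case ee_succ =>
    intro a i j r h k h₁ h₂
    rw [ee (succE h₁) h₂, icoDiff_succ _ (posE h₁)]
  case ee_diff =>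
    intro a i j r h k s h₁ h₂
    rw [ee (succE h₁) h₂, ee h₁ (succE h₂), icoDiff_diff _ (posE h₁) (posE h₂)]
  case ff_diag =>
    intro a i j r h k h₁ h₂
    rw [ff h₁ h₂, icoDiff_self, mul_zero]
  case ff_succ =>
    intro a i j r h k h₁ h₂
    rw [ff (succF h₁) h₂, icoDiff_succ _ (posF h₁)]
  case ff_diff =>
    intro a i j r h k s h₁ h₂
    rw [ff (succF h₁) h₂, ff h₁ (succF h₂), ← mul_sub, icoDiff_diff _ (posF h₁) (posF h₂)]
  case ef_ne =>
    intro a i j r b h k s h₁ h₂ hab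
    simpa only [mD, mE, mF, map_sbr, if_neg hab, map_zero] using R (Rel.ef a i j r b h k s h₁ h₂)
  case ef_same =>
    intro a i j r h k s h₁ h₂
    have inv : ∀ t, RingQuot.mkAlgHom ℂ (Rel ν σ) (fDinv ν σ a i k t) =
        invCoeff (part ν a) (fun t i j => yD ν σ a i j t) t i k := fun t =>
      map_invCoeff (RingQuot.mkAlgHom ℂ (Rel ν σ) : Free ν σ →+* Yangian ν σ) (part ν a)
        (fun t i' j' => fD ν σ a i' j' t) t i k
    simpa only [mD, mE, mF, map_sbr, if_true, map_sum, map_mul, inv] using R (Rel.ef a i j r a h k s h₁ h₂)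
  case ee_next =>
    intro a i j r h k s h₁ h₂
    simpa only [mD, mE, mF, map_sbr, apply_ite (RingQuot.mkAlgHom ℂ (Rel ν σ)), map_sum, map_mul, map_sub,
      map_neg, map_zero] using R (Rel.ee_next a i j r h k s h₁ h₂)
  case ff_next =>
    intro a i j r h k s h₁ h₂
    simpa only [mD, mE, mF, map_sbr, apply_ite (RingQuot.mkAlgHom ℂ (Rel ν σ)), map_sum, map_mul, map_sub,
      map_neg, map_zero] using R (Rel.ff_next a i j r h k s h₁ h₂)
  case ee_zero =>
    intro a i j r b h k s h₁ h₂ hab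
    simpa only [mD, mE, mF, map_sbr, map_zero] using R (Rel.ee_zero a i j r b h k s h₁ h₂ hab)
  case ff_zero =>
    intro a i j r b h k s h₁ h₂ hab
    simpa only [mD, mE, mF, map_sbr, map_zero] using R (Rel.ff_zero a i j r b h k s h₁ h₂ hab)
  case eee =>
    intro a i j r h k s b f g l h₁ h₂ h₃ hab
    simpa only [mD, mE, mF, map_sbr, map_zero, map_add] using R (Rel.eee a i j r h k s b f g l h₁ h₂ h₃ hab)
  case fff =>
    intro a i j r h k s b f g l h₁ h₂ h₃ hab
    simpa only [mD, mE, mF, map_sbr, map_zero, map_add] using R (Rel.fff a i j r h k s b f g l h₁ h₂ h₃ hab)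

variable {A : Type*} [Ring A] {ν : Composition n} {σ : ℕ → ℕ → ℕ}

/-- Symbols outside the range are zero in the free algebra, whereas the families are arbitrary
there. Hence every term of every relation must be seen to be a genuine generator before its image
can be read off. -/
theorem SatisfiesRel.exists_algHom [Algebra ℂ A] {D E F : ℕ → ℕ → ℕ → ℕ → A}
    (H : SatisfiesRel ν σ D E F) :
    ∃ Δ : Yangian ν σ →ₐ[ℂ] A,
      (∀ a i j r, Symb.Valid ν σ (.D a i j r) → Δ (yD ν σ a i j r) = D a i j r) ∧
      (∀ a i j r, Symb.Valid ν σ (.E a i j r) → Δ (yE ν σ a i j r) = E a i j r) ∧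
      (∀ a i j r, Symb.Valid ν σ (.F a i j r) → Δ (yF ν σ a i j r) = F a i j r) := by
  let val : Symb → A
    | .D a i j r => D a i j r
    | .E a i j r => E a i j r
    | .F a i j r => F a i j r
  let φ : Free ν σ →ₐ[ℂ] A := FreeAlgebra.lift ℂ fun g => val g.1
  have hφ : ∀ g : Symb, g.Valid ν σ → φ (symb ν σ g) = val g := by
    intro g hg
    rw [symb, dif_pos hg, FreeAlgebra.lift_ι_apply]
  have hD : ∀ {a i j r}, Symb.Valid ν σ (.D a i j r) → φ (fD ν σ a i j r) = D a i j r :=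
    fun h => hφ _ h
  have hE : ∀ {a i j r}, Symb.Valid ν σ (.E a i j r) → φ (fE ν σ a i j r) = E a i j r :=
    fun h => hφ _ h
  have hF : ∀ {a i j r}, Symb.Valid ν σ (.F a i j r) → φ (fF ν σ a i j r) = F a i j r :=
    fun h => hφ _ h
  have succE : ∀ {a i j r}, Symb.Valid ν σ (.E a i j r) → Symb.Valid ν σ (.E a i j (r + 1)) :=
    fun h => ⟨h.1, h.2.1, h.2.2.1, h.2.2.2.trans (Nat.lt_succ_self _)⟩
  have succF : ∀ {a i j r}, Symb.Valid ν σ (.F a i j r) → Symb.Valid ν σ (.F a i j (r + 1)) :=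
    fun h => ⟨h.1, h.2.1, h.2.2.1, h.2.2.2.trans (Nat.lt_succ_self _)⟩
  have key : ∀ ⦃x y : Free ν σ⦄, Rel ν σ x y → φ x = φ y := by
    intro x y hxy
    cases hxy
    case d_zero a i j h =>
      rw [hD h, H.d_zero a i j h, apply_ite φ, map_one, map_zero]
    case dd a i j r b h k s h₁ h₂ =>
      rw [map_sbr, hD h₁, hD h₂]
      by_cases hab : a = b
      · subst hab
        rw [if_pos rfl, H.dd_sum h₁ h₂]
        simp only [map_mul, map_sum, map_sub, map_pow, map_neg, map_one]
        congr 1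
        refine Finset.sum_congr rfl fun t _ => ?_
        rw [hD ⟨h₁.1, h₂.2.1, h₁.2.2⟩, hD ⟨h₁.1, h₁.2.1, h₂.2.2⟩, hD ⟨h₁.1, h₂.2.1, h₁.2.2⟩,
          hD ⟨h₁.1, h₁.2.1, h₂.2.2⟩]
      · rw [if_neg hab, map_zero, H.dd_ne a i j r b h k s h₁ h₂ hab]
    case de a i j r b h k s h₁ h₂ =>
      rw [map_sbr, hD h₁, hE h₂]
      by_cases hab : a = b
      · subst hab
        rw [if_neg (Nat.lt_succ_self a).ne, add_zero, H.de_same_sum h₁ h₂]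
        simp only [true_and, apply_ite φ, map_mul, map_sum, map_neg, map_one, map_zero]
        split_ifs
        · congr 1
          refine Finset.sum_congr rfl fun t ht => Finset.sum_congr rfl fun p hp => ?_
          have := h₂.2.2.2
          rw [Finset.mem_range] at ht
          rw [hD ⟨h₁.1, h₁.2.1, hp⟩, hE ⟨h₂.1, hp, h₂.2.2.1, by omega⟩]
        · congr 1
          refine Finset.sum_congr rfl fun t ht => Finset.sum_congr rfl fun p hp => ?_
          have := h₂.2.2.2
          rw [Finset.mem_range] at ht
          rw [hD ⟨h₁.1, h₁.2.1, hp⟩, hE ⟨h₂.1, hp, h₂.2.2.1, by omega⟩]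
        · rfl
      · rw [if_neg fun h => hab h.1, zero_add]
        by_cases hab' : a = b + 1
        · subst hab'
          rw [if_pos rfl, H.de_next_sum h₁ h₂]
          simp only [map_mul, map_sum]
          refine Finset.sum_congr rfl fun t ht => ?_
          have := h₂.2.2.2
          rw [Finset.mem_range] at ht
          rw [hD ⟨h₁.1, h₁.2.1, h₂.2.2.1⟩, hE ⟨h₂.1, h₂.2.1, h₁.2.2, by omega⟩]
        · rw [if_neg hab', map_zero, H.de_ne a i j r b h k s h₁ h₂ hab hab']
    case df a i j r b h k s h₁ h₂ =>
      rw [map_sbr, hD h₁, hF h₂]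
      by_cases hab : a = b
      · subst hab
        rw [if_neg (Nat.lt_succ_self a).ne, sub_zero, H.df_same_sum h₁ h₂]
        simp only [true_and, apply_ite φ, map_mul, map_sum, map_neg, map_one, map_zero]
        split_ifs
        · congr 1
          refine Finset.sum_congr rfl fun t ht => Finset.sum_congr rfl fun p hp => ?_
          have := h₂.2.2.2
          rw [Finset.mem_range] at ht
          rw [hD ⟨h₁.1, hp, h₁.2.2⟩, hF ⟨h₂.1, h₂.2.1, hp, by omega⟩]
        · congr 1
          refine Finset.sum_congr rfl fun t ht => Finset.sum_congr rfl fun p hp => ?_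
          have := h₂.2.2.2
          rw [Finset.mem_range] at ht
          rw [hD ⟨h₁.1, hp, h₁.2.2⟩, hF ⟨h₂.1, h₂.2.1, hp, by omega⟩]
        · rfl
      · rw [if_neg fun h => hab h.1, zero_sub]
        by_cases hab' : a = b + 1
        · subst hab'
          rw [if_pos rfl, H.df_next_sum h₁ h₂]
          simp only [map_mul, map_sum, map_neg]
          congr 1
          refine Finset.sum_congr rfl fun t ht => ?_
          have := h₂.2.2.2
          rw [Finset.mem_range] at ht
          rw [hD ⟨h₁.1, h₂.2.1, h₁.2.2⟩, hF ⟨h₂.1, h₁.2.1, h₂.2.2.1, by omega⟩]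
        · rw [if_neg hab', neg_zero, map_zero, H.df_ne a i j r b h k s h₁ h₂ hab hab']
    case ee_same a i j r h k s h₁ h₂ =>
      rw [map_sbr, hE h₁, hE h₂, H.ee_sum h₁ h₂]
      simp only [map_sub, map_sum, map_mul]
      -- The individual sums contain symbols with too small an upper index; only the difference of
      -- the sums can be compared.
      refine icoDiff_congr (H' := fun t u => φ (fE ν σ a i k t) * φ (fE ν σ a h j u))
        h₁.2.2.2 h₂.2.2.2 fun t u ht hu => ?_
      rw [hE ⟨h₁.1, h₁.2.1, h₂.2.2.1, ht⟩, hE ⟨h₁.1, h₂.2.1, h₁.2.2.1, hu⟩]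
    case ff_same a i j r h k s h₁ h₂ =>
      rw [map_sbr, hF h₁, hF h₂, H.ff_sum h₁ h₂]
      simp only [map_sub, map_sum, map_mul, apply_ite φ, map_neg, map_one]
      congr 1
      refine icoDiff_congr (H' := fun t u => φ (fF ν σ a i k u) * φ (fF ν σ a h j t))
        h₁.2.2.2 h₂.2.2.2 fun t u ht hu => ?_
      rw [hF ⟨h₁.1, h₁.2.1, h₂.2.2.1, hu⟩, hF ⟨h₁.1, h₂.2.1, h₁.2.2.1, ht⟩]
    case ef a i j r b h k s h₁ h₂ =>
      rw [map_sbr, hE h₁, hF h₂]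
      by_cases hab : a = b
      · subst hab
        have ha := Finset.mem_Icc.mp h₁.1
        rw [if_pos rfl, map_sum, H.ef_same a i j r h k s h₁ h₂]
        refine Finset.sum_congr rfl fun t _ => ?_
        rw [map_mul, hD ⟨Finset.mem_Icc.mpr ⟨by omega, by omega⟩, h₂.2.1, h₁.2.2.1⟩]
        congr 1
        refine Eq.trans ?_ (map_invCoeff (φ : Free ν σ →+* A) (part ν a)
          (fun t i' j' => fD ν σ a i' j' t) t i k).symm
        refine invCoeff_congr (fun t i hi p hp => ?_) _ _ _ h₁.2.1
        exact (hD ⟨Finset.mem_Icc.mpr ⟨by omega, by omega⟩, hi, hp⟩).symm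
      · rw [if_neg hab, map_zero, H.ef_ne a i j r b h k s h₁ h₂ hab]
    case ee_next a i j r h k s h₁ h₂ =>
      rw [map_sub, map_sbr, map_sbr, hE h₁, hE h₂, hE (succE h₁), hE (succE h₂),
        H.ee_next a i j r h k s h₁ h₂, apply_ite φ, map_neg, map_sum, map_zero]
      congr 2
      refine Finset.sum_congr rfl fun q hq => ?_
      rw [map_mul, hE ⟨h₁.1, h₁.2.1, hq, h₁.2.2.2⟩, hE ⟨h₂.1, hq, h₂.2.2.1, h₂.2.2.2⟩]
    case ff_next a i j r h k s h₁ h₂ =>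
      rw [map_sub, map_sbr, map_sbr, hF h₁, hF h₂, hF (succF h₁), hF (succF h₂),
        H.ff_next a i j r h k s h₁ h₂, apply_ite φ, map_sum, map_zero]
      congr 1
      refine Finset.sum_congr rfl fun q hq => ?_
      rw [map_mul, hF ⟨h₁.1, hq, h₁.2.2.1, h₁.2.2.2⟩, hF ⟨h₂.1, h₂.2.1, hq, h₂.2.2.2⟩]
    case ee_zero a i j r b h k s h₁ h₂ hab =>
      rw [map_sbr, hE h₁, hE h₂, H.ee_zero a i j r b h k s h₁ h₂ hab, map_zero]
    case ff_zero a i j r b h k s h₁ h₂ hab =>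
      rw [map_sbr, hF h₁, hF h₂, H.ff_zero a i j r b h k s h₁ h₂ hab, map_zero]
    case eee a i j r h k s b f g l h₁ h₂ h₃ hab =>
      have h₁' : Symb.Valid ν σ (.E a i j s) := ⟨h₁.1, h₁.2.1, h₁.2.2.1, h₂.2.2.2⟩
      have h₂' : Symb.Valid ν σ (.E a h k r) := ⟨h₂.1, h₂.2.1, h₂.2.2.1, h₁.2.2.2⟩
      rw [map_add, map_sbr, map_sbr, map_sbr, map_sbr, hE h₁, hE h₂, hE h₃, hE h₁', hE h₂',
        H.eee a i j r h k s b f g l h₁ h₂ h₃ hab, map_zero]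
    case fff a i j r h k s b f g l h₁ h₂ h₃ hab =>
      have h₁' : Symb.Valid ν σ (.F a i j s) := ⟨h₁.1, h₁.2.1, h₁.2.2.1, h₂.2.2.2⟩
      have h₂' : Symb.Valid ν σ (.F a h k r) := ⟨h₂.1, h₂.2.1, h₂.2.2.1, h₁.2.2.2⟩
      rw [map_add, map_sbr, map_sbr, map_sbr, map_sbr, hF h₁, hF h₂, hF h₃, hF h₁', hF h₂',
        H.fff a i j r h k s b f g l h₁ h₂ h₃ hab, map_zero]
  refine ⟨RingQuot.liftAlgHom ℂ ⟨φ, key⟩, fun a i j r h => ?_, fun a i j r h => ?_,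
    fun a i j r h => ?_⟩
  · exact (RingQuot.liftAlgHom_mkAlgHom_apply ℂ φ key _).trans (hD h)
  · exact (RingQuot.liftAlgHom_mkAlgHom_apply ℂ φ key _).trans (hE h)
  · exact (RingQuot.liftAlgHom_mkAlgHom_apply ℂ φ key _).trans (hF h)

end Presentation

/-! ### Transposition -/

section Transpose

variable {n : ℕ} {A : Type*} [Ring A]

/-- The power series with matrix coefficients `Y^{(t)}`. -/
def matSeries (q : ℕ) (Y : ℕ → ℕ → ℕ → A) :
    PowerSeries (Matrix (Finset.Icc 1 q) (Finset.Icc 1 q) A) :=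
  PowerSeries.mk fun t => Matrix.of fun i j => Y t i j

-- The recursion for `invCoeff` produces a right inverse. In the opposite ring the transpose of that
-- inverse is a left inverse of the original series, and the two one-sided inverses coincide in the
-- ring of power series with matrix coefficients.
open MulOpposite PowerSeries in
theorem invCoeff_op {q : ℕ} {X : ℕ → ℕ → ℕ → A}
    (hX : ∀ i ∈ Finset.Icc 1 q, ∀ j ∈ Finset.Icc 1 q, X 0 i j = if i = j then 1 else 0)
    (r : ℕ) {i j : ℕ} (hi : i ∈ Finset.Icc 1 q) (hj : j ∈ Finset.Icc 1 q) :
    invCoeff q (fun t i j => op (X t j i)) r i j = op (invCoeff q X r j i) := by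
  have hmul : ∀ Y Z : ℕ → ℕ → ℕ → A,
      (∀ r, ∀ i ∈ Finset.Icc 1 q, ∀ j ∈ Finset.Icc 1 q,
        ∑ t ∈ Finset.range (r + 1), ∑ p ∈ Finset.Icc 1 q, Y t i p * Z (r - t) p j =
          if r = 0 ∧ i = j then 1 else 0) → matSeries q Y * matSeries q Z = 1 := by
    intro Y Z h
    ext r ⟨i, hi⟩ ⟨j, hj⟩
    have hsum : ∀ t u, ∑ p : Finset.Icc 1 q, Y t i p * Z u p j =
        ∑ p ∈ Finset.Icc 1 q, Y t i p * Z u p j := fun t u =>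
      Finset.sum_coe_sort (Finset.Icc 1 q) (fun p => Y t i p * Z u p j)
    rw [PowerSeries.coeff_mul, Finset.Nat.sum_antidiagonal_eq_sum_range_succ_mk, Matrix.sum_apply]
    simp only [matSeries, PowerSeries.coeff_mk, Matrix.mul_apply, Matrix.of_apply, hsum]
    rw [h r i hi j hj, PowerSeries.coeff_one]
    by_cases hr : r = 0 <;> by_cases hij : i = j <;> simp [hr, hij, Matrix.one_apply]
  have h1 : matSeries q X * matSeries q (invCoeff q X) = 1 :=
    hmul _ _ fun r i hi j _ => sum_mul_invCoeff q X hX r i j hi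
  have h2 : matSeries q (fun t i j => unop (invCoeff q (fun t i j => op (X t j i)) t j i)) *
      matSeries q X = 1 := by
    refine hmul _ _ fun r i hi j hj => ?_
    have := congrArg unop (sum_mul_invCoeff q (fun t i j => op (X t j i))
      (fun i hi j hj => by rw [hX j hj i hi]; simp [eq_comm, apply_ite op]) r j i hj)
    simp only [Finset.unop_sum, unop_mul, unop_op, apply_ite unop, unop_one, unop_zero] at this
    -- Reversing the factors exchanges the degrees `t` and `r - t`.
    rw [← Finset.sum_range_reflect]
    simp only [eq_comm (a := i)]
    rw [← this]
    refine Finset.sum_congr rfl fun t ht => ?_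
    rw [Finset.mem_range] at ht
    rw [show r + 1 - 1 - t = r - t by omega, show r - (r - t) = t by omega]
  have h3 := congrArg (fun P => (PowerSeries.coeff r P :
    Matrix (Finset.Icc 1 q) (Finset.Icc 1 q) A) ⟨j, hj⟩ ⟨i, hi⟩) (left_inv_eq_right_inv h2 h1)
  simp only [matSeries, PowerSeries.coeff_mk, Matrix.of_apply] at h3
  rw [← h3, op_unop]

theorem commute_invCoeff {q : ℕ} {X : ℕ → ℕ → ℕ → A} {z : A}
    (h : ∀ t, ∀ i ∈ Finset.Icc 1 q, ∀ p ∈ Finset.Icc 1 q, Commute z (X t i p)) (r : ℕ) {i : ℕ}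
    (j : ℕ) (hi : i ∈ Finset.Icc 1 q) : Commute z (invCoeff q X r i j) := by
  induction r using Nat.strong_induction_on generalizing i with
  | _ r ih =>
    cases r with
    | zero =>
      rw [invCoeff]
      split_ifs
      exacts [Commute.one_right z, Commute.zero_right z]
    | succ r =>
      rw [invCoeff]
      exact (Commute.sum_right _ _ _ fun t _ => Commute.sum_right _ _ _ fun p hp =>
        (h _ i hi p hp).mul_right (ih _ (by omega) hp)).neg_right

theorem rootParity_mul_eq_zero {a b : ℕ} (h : a ≠ b) :
    (rootParity a).val * (rootParity b).val = 0 := by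
  unfold rootParity
  split_ifs with h1 h2
  · omega
  all_goals simp

theorem sbr_rootParity_swap {a b : ℕ} (h : a ≠ b) (x y : A) :
    sbr (rootParity b) (rootParity a) y x = -sbr (rootParity a) (rootParity b) x y := by
  rw [sbr_swap, rootParity_mul_eq_zero h, pow_zero, one_mul]

/-- The bracket of two odd elements is symmetric, that of two even ones antisymmetric. This sign is
exactly the `ε_a` that distinguishes the quadratic relations of `F_a` from those of `E_a`. -/
theorem sbr_rootParity_self_swap (a : ℕ) (x y : A) :
    sbr (rootParity a) (rootParity a) y x =
      (if a = 1 then 1 else -1) * sbr (rootParity a) (rootParity a) x y := by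
  rw [sbr_swap]
  unfold rootParity
  split_ifs <;> simp [show (1 : ZMod 2).val = 1 from rfl]

theorem ite_neg_one_mul_self (p : Prop) [Decidable p] (x : A) :
    (if p then 1 else -1) * ((if p then 1 else -1) * x) = x := by
  split_ifs <;> simp

theorem Symb.valid_transpose_E {ν : Composition n} {σ : ℕ → ℕ → ℕ} {a i j r : ℕ} :
    Symb.Valid ν (fun i j => σ j i) (.E a i j r) ↔ Symb.Valid ν σ (.F a j i r) :=
  ⟨fun h => ⟨h.1, h.2.2.1, h.2.1, h.2.2.2⟩, fun h => ⟨h.1, h.2.2.1, h.2.1, h.2.2.2⟩⟩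

theorem Symb.valid_transpose_F {ν : Composition n} {σ : ℕ → ℕ → ℕ} {a i j r : ℕ} :
    Symb.Valid ν (fun i j => σ j i) (.F a i j r) ↔ Symb.Valid ν σ (.E a j i r) :=
  ⟨fun h => ⟨h.1, h.2.2.1, h.2.1, h.2.2.2⟩, fun h => ⟨h.1, h.2.2.1, h.2.1, h.2.2.2⟩⟩

theorem Symb.valid_transpose_D {ν : Composition n} {σ : ℕ → ℕ → ℕ} {a i j r r' : ℕ} :
    Symb.Valid ν (fun i j => σ j i) (.D a i j r) ↔ Symb.Valid ν σ (.D a j i r') :=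
  ⟨fun h => ⟨h.1, h.2.2, h.2.1⟩, fun h => ⟨h.1, h.2.2, h.2.1⟩⟩

variable {ν : Composition n} {σ : ℕ → ℕ → ℕ} {D E F : ℕ → ℕ → ℕ → ℕ → A}

open MulOpposite Symb in
/-- Transposition exchanges `E` and `F` and reverses products. -/
theorem SatisfiesRel.transpose (H : SatisfiesRel ν σ D E F) :
    SatisfiesRel ν (fun i j => σ j i) (fun a i j r => op (D a j i r)) (fun a i j r => op (F a j i r))
      (fun a i j r => op (E a j i r)) := by
  constructor
  case d_zero =>
    intro a i j h
    rw [H.d_zero a j i (valid_transpose_D.mp h), apply_ite op]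
    simp [eq_comm]
  case dd_ne =>
    intro a i j r b h k s h₁ h₂ hab
    rw [sbr_op, H.dd_ne b k h s a j i r (valid_transpose_D.mp h₂) (valid_transpose_D.mp h₁) hab.symm,
      op_zero]
  case dd_same =>
    intro a i j r h k s h₁ h₂
    have e := H.dd_same a k h s j i r (valid_transpose_D.mp h₂) (valid_transpose_D.mp h₁)
    -- Reversal puts the factors of the right-hand side in the other order; the symmetry in the
    -- upper indices puts the difference of products back.
    have e' := H.dd_symm (r := r) (s := s) (i := j) (j := h) (h := k) (k := i)
      ⟨h₁.1, h₁.2.2, h₂.2.1⟩ ⟨h₁.1, h₂.2.2, h₁.2.1⟩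
    rw [sbr_zero_left, sbr_zero_left] at e'
    rw [sbr_op, sbr_op, ← op_sub, ← neg_sub, e]
    apply unop_injective
    rw [← op_one, ← op_neg, ← op_pow]
    simp only [unop_op, unop_mul, unop_sub]
    have e'' : D a k i s * D a j h r - D a k i r * D a j h s =
      -(D a j h s * D a k i r - D a j h r * D a k i s) := by
      linear_combination (norm := abel) -e'
    rw [e'', neg_mul, neg_inj]
    exact (Commute.neg_one_left _).pow_left _
  case de_ne =>
    intro a i j r b h k s h₁ h₂ hab hab'
    rw [sbr_op, sbr_swap, H.df_ne a j i r b k h s (valid_transpose_D.mp h₁)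
      (valid_transpose_E.mp h₂) hab hab']
    simp
  case de_same =>
    intro i j r b h k s h₁ h₂
    have e := H.df_same j i r b k h s (valid_transpose_D.mp h₁) (valid_transpose_E.mp h₂)
    rw [sbr_op, sbr_op, ← op_sub, sbr_swap, sbr_swap 0]
    simp only [ZMod.val_zero, zero_mul, pow_zero, one_mul]
    rw [neg_sub_neg, ← neg_sub, e]
    apply unop_injective
    by_cases hj : h = j <;> by_cases hb : b = 1 <;> simp [hj, hb]
  case de_next =>
    intro i j r b h k s h₁ h₂
    have e := H.df_next j i r b k h s (valid_transpose_D.mp h₁) (valid_transpose_E.mp h₂)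
    rw [sbr_op, sbr_op, ← op_sub, sbr_swap, sbr_swap 0]
    simp only [ZMod.val_zero, zero_mul, pow_zero, one_mul]
    rw [neg_sub_neg, ← neg_sub, e, neg_neg, op_mul]
  case df_ne =>
    intro a i j r b h k s h₁ h₂ hab hab'
    rw [sbr_op, sbr_swap, H.de_ne a j i r b k h s (valid_transpose_D.mp h₁)
      (valid_transpose_F.mp h₂) hab hab']
    simp
  case df_same =>
    intro i j r b h k s h₁ h₂
    have e := H.de_same j i r b k h s (valid_transpose_D.mp h₁) (valid_transpose_F.mp h₂)
    rw [sbr_op, sbr_op, ← op_sub, sbr_swap, sbr_swap 0]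
    simp only [ZMod.val_zero, zero_mul, pow_zero, one_mul]
    rw [neg_sub_neg, ← neg_sub, e]
    apply unop_injective
    by_cases hj : k = i <;> by_cases hb : b = 1 <;> simp [hj, hb]
  case df_next =>
    intro i j r b h k s h₁ h₂
    have e := H.de_next j i r b k h s (valid_transpose_D.mp h₁) (valid_transpose_F.mp h₂)
    rw [sbr_op, sbr_op, ← op_sub, sbr_swap, sbr_swap 0]
    simp only [ZMod.val_zero, zero_mul, pow_zero, one_mul]
    rw [neg_sub_neg, ← neg_sub, e, op_neg, op_mul]
  case ee_diag =>
    intro a i j r h k h₁ h₂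
    rw [sbr_op, H.ff_diag a k h r j i (valid_transpose_E.mp h₂) (valid_transpose_E.mp h₁), op_zero]
  case ee_succ =>
    intro a i j r h k h₁ h₂
    rw [sbr_op, sbr_rootParity_self_swap,
      H.ff_succ a j i r k h (valid_transpose_E.mp h₁) (valid_transpose_E.mp h₂),
      ite_neg_one_mul_self, op_mul]
  case ee_diff =>
    intro a i j r h k s h₁ h₂
    rw [sbr_op, sbr_op, ← op_sub, sbr_rootParity_self_swap, sbr_rootParity_self_swap a (F a j i r),
      ← mul_sub, H.ff_diff a j i r k h s (valid_transpose_E.mp h₁) (valid_transpose_E.mp h₂),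
      ite_neg_one_mul_self, op_add, op_mul, op_mul]
  case ff_diag =>
    intro a i j r h k h₁ h₂
    rw [sbr_op, H.ee_diag a k h r j i (valid_transpose_F.mp h₂) (valid_transpose_F.mp h₁), op_zero]
  case ff_succ =>
    intro a i j r h k h₁ h₂
    rw [sbr_op, sbr_rootParity_self_swap,
      H.ee_succ a j i r k h (valid_transpose_F.mp h₁) (valid_transpose_F.mp h₂)]
    split_ifs <;> simp
  case ff_diff =>
    intro a i j r h k s h₁ h₂
    rw [sbr_op, sbr_op, ← op_sub, sbr_rootParity_self_swap, sbr_rootParity_self_swap a (E a j i r),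
      ← mul_sub, H.ee_diff a j i r k h s (valid_transpose_F.mp h₁) (valid_transpose_F.mp h₂)]
    split_ifs <;> simp
  case ef_ne =>
    intro a i j r b h k s h₁ h₂ hab
    rw [sbr_op, H.ef_ne b k h s a j i r (valid_transpose_F.mp h₂) (valid_transpose_E.mp h₁)
      hab.symm, op_zero]
  case ef_same =>
    intro a i j r h k s h₁ h₂
    have ha := Finset.mem_Icc.mp h₁.1
    rw [sbr_op, H.ef_same a k h s j i r (valid_transpose_F.mp h₂) (valid_transpose_E.mp h₁),
      Finset.op_sum, add_comm s r]
    refine Finset.sum_congr rfl fun t _ => ?_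
    rw [invCoeff_op (X := fun t i j => D a i j t) (fun i hi j hj => H.d_zero a i j
      ⟨Finset.mem_Icc.mpr ⟨by omega, by omega⟩, hi, hj⟩) t h₁.2.1 h₂.2.2.1, ← op_mul]
    congr 1
    -- The reversed product has `D'_a` before `D_{a+1}`; entries of different blocks commute, so the
    -- order can be restored.
    refine commute_invCoeff (fun t i hi p hp => commute_of_sbr_eq_zero (H.dd_ne _ _ _ _ _ _ _ _
      ⟨Finset.mem_Icc.mpr ⟨by omega, by omega⟩, h₁.2.2.1, h₂.2.1⟩
      ⟨Finset.mem_Icc.mpr ⟨by omega, by omega⟩, hi, hp⟩ (by omega))) _ _ h₂.2.2.1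
  case ee_next =>
    intro a i j r h k s h₁ h₂
    rw [sbr_op, sbr_op, ← op_sub, sbr_rootParity_swap (Nat.lt_succ_self a).ne,
      sbr_rootParity_swap (Nat.lt_succ_self a).ne, neg_sub_neg, ← neg_sub,
      H.ff_next a j i r k h s (valid_transpose_E.mp h₁) (valid_transpose_E.mp h₂)]
    simp only [eq_comm (a := h)]
    split_ifs <;> simp
  case ff_next =>
    intro a i j r h k s h₁ h₂
    rw [sbr_op, sbr_op, ← op_sub, sbr_rootParity_swap (Nat.lt_succ_self a).ne,
      sbr_rootParity_swap (Nat.lt_succ_self a).ne, neg_sub_neg, ← neg_sub,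
      H.ee_next a j i r k h s (valid_transpose_F.mp h₁) (valid_transpose_F.mp h₂)]
    simp only [eq_comm (a := k)]
    split_ifs <;> simp
  case ee_zero =>
    intro a i j r b h k s h₁ h₂ hab
    rw [sbr_op, sbr_swap, H.ff_zero a j i r b k h s (valid_transpose_E.mp h₁)
      (valid_transpose_E.mp h₂) (hab.imp_right fun h => ⟨h.1, h.2.symm⟩)]
    simp
  case ff_zero =>
    intro a i j r b h k s h₁ h₂ hab
    rw [sbr_op, sbr_swap, H.ee_zero a j i r b k h s (valid_transpose_F.mp h₁)
      (valid_transpose_F.mp h₂) (hab.imp_right fun h => ⟨h.1, h.2.symm⟩)]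
    simp
  case eee =>
    intro a i j r h k s b f g l h₁ h₂ h₃ hab
    have e := H.fff a j i r k h s b g f l (valid_transpose_E.mp h₁) (valid_transpose_E.mp h₂)
      (valid_transpose_E.mp h₃) hab
    simp only [sbr_op, ← op_add, sbr_rootParity_swap hab, sbr_swap (rootParity a)
      (rootParity a + rootParity b), sbr_neg_right, mul_neg, neg_neg, ← mul_add, e, mul_zero,
      op_zero]
  case fff =>
    intro a i j r h k s b f g l h₁ h₂ h₃ hab
    have e := H.eee a j i r k h s b g f l (valid_transpose_F.mp h₁) (valid_transpose_F.mp h₂)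
      (valid_transpose_F.mp h₃) hab
    simp only [sbr_op, ← op_add, sbr_rootParity_swap hab, sbr_swap (rootParity a)
      (rootParity a + rootParity b), sbr_neg_right, mul_neg, neg_neg, ← mul_add, e, mul_zero,
      op_zero]

end Transpose

/-! ### Right multiplication by `1 - u⁻¹ e` -/

section Deform

variable {A : Type*} [Ring A]

/-- The coefficient of `u^{-r-1}` in column `j` of the product of the row `X(u)`, with entries
`∑_r X_k^{(r)} u^{-r}`, and the matrix `1 - u⁻¹ e`. -/
def deform (I : Finset ℕ) (e : ℕ → ℕ → A) (X : ℕ → ℕ → A) (j r : ℕ) : A :=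
  X j (r + 1) - ∑ k ∈ I, X k r * e k j

/-- The commutation relations of matrix units. -/
def IsMatrixUnits (I : Finset ℕ) (e : ℕ → ℕ → A) : Prop :=
  ∀ a ∈ I, ∀ b ∈ I, ∀ c ∈ I, ∀ d ∈ I, e a b * e c d - e c d * e a b =
    (if c = b then e a d else 0) - (if a = d then e c b else 0)

variable {I : Finset ℕ} {e : ℕ → ℕ → A} (he : IsMatrixUnits I e) {X Y : ℕ → ℕ → A}
  (hX : ∀ a b k r, Commute (e a b) (X k r)) (hY : ∀ a b k r, Commute (e a b) (Y k r)) {j k : ℕ}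

-- All computations with two deformed rows start here. The last two sums are the price of `[e, e] ≠
-- 0`.
include he hX hY in
theorem sbr_deform (p q : ZMod 2) (hj : j ∈ I) (hk : k ∈ I) (r s : ℕ) :
    sbr p q (deform I e X j r) (deform I e Y k s) =
      sbr p q (X j (r + 1)) (Y k (s + 1)) - ∑ b ∈ I, sbr p q (X j (r + 1)) (Y b s) * e b k
      - ∑ a ∈ I, sbr p q (X a r) (Y k (s + 1)) * e a j
      + ∑ a ∈ I, ∑ b ∈ I, sbr p q (X a r) (Y b s) * (e b k * e a j)
      + ∑ a ∈ I, X a r * Y j s * e a k - ∑ b ∈ I, X k r * Y b s * e b j :=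
  sbr_sub_sum_sub_sum p q I _ _ (fun a => X a r) (fun b => Y b s) hj hk he (fun _ _ => hX _ _ _ _)
    (fun _ _ => hY _ _ _ _) (fun _ _ _ => hX _ _ _ _) (fun _ _ _ => hY _ _ _ _)

include hY in
theorem deform_mul_deform (j k r s : ℕ) :
    deform I e X j r * deform I e Y k s =
      X j (r + 1) * Y k (s + 1) - ∑ b ∈ I, X j (r + 1) * Y b s * e b k
      - ∑ a ∈ I, X a r * Y k (s + 1) * e a j
      + ∑ a ∈ I, ∑ b ∈ I, X a r * Y b s * (e a j * e b k) :=
  sub_sum_mul_sub_sum I _ _ (fun a => X a r) (fun b => Y b s) j k (fun _ _ => hY _ _ _ _)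
    (fun _ _ _ => hY _ _ _ _)

-- Used for a row of `D_{m+1}` against a row of `E_m`. The exchange of `j` and `k` on the right
-- matches the order of the units, so no reordering is needed in the double sum.
include he hX hY in
theorem sbr_deform_of_vertical {q : ZMod 2} {s₀ : ℕ}
    (h : ∀ j ∈ I, ∀ k ∈ I, ∀ r s, s₀ < s →
      sbr 0 q (X j (r + 1)) (Y k s) - sbr 0 q (X j r) (Y k (s + 1)) = X k r * Y j s)
    (hj : j ∈ I) (hk : k ∈ I) {r s : ℕ} (hs : s₀ < s) :
    sbr 0 q (deform I e X j (r + 1)) (deform I e Y k s)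
        - sbr 0 q (deform I e X j r) (deform I e Y k (s + 1)) =
      deform I e X k r * deform I e Y j s := by
  rw [sbr_deform he hX hY 0 q hj hk, sbr_deform he hX hY 0 q hj hk, deform_mul_deform hY]
  have h0 := h j hj k hk (r + 1) (s + 1) (by omega)
  have h1 := Finset.sum_congr rfl fun b hb =>
    congrArg (· * e b k) (h j hj b hb (r + 1) s hs)
  have h2 := Finset.sum_congr rfl fun a ha =>
    congrArg (· * e a j) (h a ha k hk r (s + 1) (by omega))
  have h3 := Finset.sum_congr rfl fun a ha => Finset.sum_congr rfl fun b hb =>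
    congrArg (· * (e b k * e a j)) (h a ha b hb r s hs)
  simp only [sub_mul, Finset.sum_sub_distrib] at h1 h2 h3
  rw [Finset.sum_comm (f := fun a b => X b r * Y a s * (e b k * e a j))] at h3
  -- The old relation is multiplied by the four terms of `(1 - u⁻¹e)(1 - v⁻¹e)`, with the
  -- corresponding signs.
  linear_combination (norm := abel) h0 - h1 - h2 + h3

-- Used for two rows of `D_{m+1}`. The right-hand side has `Y` before `X` and the units in the wrong
-- order. `hmul` reorders the units, and two further copies of the relation, `h4` and `h5`, convert
-- the products `X * Y` of the correction sums.
include he hX hY in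
theorem sbr_deform_rtt
    (h : ∀ j ∈ I, ∀ k ∈ I, ∀ r s, sbr 0 0 (X j (r + 1)) (Y k s) - sbr 0 0 (X j r) (Y k (s + 1)) =
      -(Y j r * X k s - Y j s * X k r))
    (hj : j ∈ I) (hk : k ∈ I) (r s : ℕ) :
    sbr 0 0 (deform I e X j (r + 1)) (deform I e Y k s)
        - sbr 0 0 (deform I e X j r) (deform I e Y k (s + 1)) =
      -(deform I e Y j r * deform I e X k s - deform I e Y j s * deform I e X k r) := by
  have hmul : ∀ r s, deform I e Y j r * deform I e X k s =
      Y j (r + 1) * X k (s + 1) - ∑ b ∈ I, Y j (r + 1) * X b s * e b k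
      - ∑ a ∈ I, Y a r * X k (s + 1) * e a j
      + ∑ a ∈ I, ∑ b ∈ I, Y a r * X b s * (e b k * e a j)
      + ∑ a ∈ I, Y a r * X j s * e a k - ∑ b ∈ I, Y k r * X b s * e b j := by
    intro r s
    have key : ∀ a ∈ I, ∀ b ∈ I, Y a r * X b s * (e a j * e b k) =
        Y a r * X b s * (e b k * e a j) + ((if b = j then Y a r * X b s * e a k else 0) -
          (if a = k then Y a r * X b s * e b j else 0)) := by
      intro a ha b hb
      rw [sub_eq_iff_eq_add.mp (he a ha j hj b hb k hk)]
      split_ifs <;> noncomm_ring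
    rw [deform_mul_deform hX, Finset.sum_congr rfl fun a ha => Finset.sum_congr rfl (key a ha)]
    simp only [Finset.sum_add_distrib, Finset.sum_sub_distrib, Finset.sum_ite_eq', hj, if_true]
    rw [Finset.sum_comm (f := fun a b => if a = k then Y a r * X b s * e b j else 0)]
    simp only [Finset.sum_ite_eq', hk, if_true]
    abel
  rw [sbr_deform he hX hY 0 0 hj hk, sbr_deform he hX hY 0 0 hj hk, hmul, hmul]
  have h0 := h j hj k hk (r + 1) (s + 1)
  have h1 := Finset.sum_congr rfl fun b hb => congrArg (· * e b k) (h j hj b hb (r + 1) s)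
  have h2 := Finset.sum_congr rfl fun a ha => congrArg (· * e a j) (h a ha k hk r (s + 1))
  have h3 := Finset.sum_congr rfl fun a ha => Finset.sum_congr rfl fun b hb =>
    congrArg (· * (e b k * e a j)) (h a ha b hb r s)
  have h4 := Finset.sum_congr rfl fun a ha => congrArg (· * e a k) (h a ha j hj r s)
  have h5 := Finset.sum_congr rfl fun a ha => congrArg (· * e a j) (h k hk a ha r s)
  simp only [sbr_zero_left _ (X _ r), sbr_zero_left _ (X _ (r + 1))] at h4 h5
  simp only [sub_mul, neg_mul, Finset.sum_sub_distrib, Finset.sum_neg_distrib] at h1 h2 h3 h4 h5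
  linear_combination (norm := abel) h0 - h1 - h2 + h3 + h4 - h5

/-! ### Quadratic relations between rows of a single root. -/

section SameRoot

variable {p : ZMod 2} {s₀ : ℕ}
  (h0 : ∀ j ∈ I, ∀ k ∈ I, ∀ r, s₀ < r → sbr p p (X j r) (Y k r) = 0)
  (h1 : ∀ j ∈ I, ∀ k ∈ I, ∀ r, s₀ < r → sbr p p (X j (r + 1)) (Y k r) = X k r * Y j r)
  (h2 : ∀ j ∈ I, ∀ k ∈ I, ∀ r s, s₀ < r → s₀ < s →
    sbr p p (X j (r + 1)) (Y k s) - sbr p p (X j r) (Y k (s + 1)) = X k r * Y j s + X k s * Y j r)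

include he hX hY h0 h1 h2 in
theorem sbr_deform_self (hj : j ∈ I) (hk : k ∈ I) {r : ℕ} (hr : s₀ < r) :
    sbr p p (deform I e X j r) (deform I e Y k r) = 0 := by
  -- At `r = s` the difference relation has right side `2 X k r * Y a r`, of which `h1` accounts for
  -- one half; the bracket below the diagonal takes the other half with a minus sign.
  have h3 : ∀ a ∈ I, sbr p p (X a r) (Y k (r + 1)) * e a j = -(X k r * Y a r * e a j) := by
    intro a ha
    have := h2 a ha k hk r r hr hr
    rw [h1 a ha k hk r hr] at this
    rw [← neg_mul]
    congr 1
    linear_combination (norm := abel) -this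
  rw [sbr_deform he hX hY p p hj hk, h0 j hj k hk _ (by omega),
    Finset.sum_congr rfl fun b hb => by rw [h1 j hj b hb r hr], Finset.sum_congr rfl h3,
    Finset.sum_congr rfl fun a ha => Finset.sum_congr rfl fun b hb => by rw [h0 a ha b hb r hr]]
  simp only [zero_mul, Finset.sum_const_zero, Finset.sum_neg_distrib]
  abel

include he hX hY h0 h1 h2 in
theorem sbr_deform_succ (hj : j ∈ I) (hk : k ∈ I) {r : ℕ} (hr : s₀ < r) :
    sbr p p (deform I e X j (r + 1)) (deform I e Y k r) =
      deform I e X k r * deform I e Y j r := by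
  have h3 : ∀ b ∈ I, sbr p p (X j (r + 1 + 1)) (Y b r) * e b k =
      X b (r + 1) * Y j r * e b k + X b r * Y j (r + 1) * e b k := by
    intro b hb
    have := h2 j hj b hb (r + 1) r (by omega) hr
    rw [h0 j hj b hb (r + 1) (by omega), sub_zero] at this
    rw [this, add_mul]
  have h4 : ∀ a ∈ I, sbr p p (X a (r + 1)) (Y k (r + 1)) * e a j = 0 := by
    intro a ha
    rw [h0 a ha k hk (r + 1) (by omega), zero_mul]
  have h5 : ∀ a ∈ I, ∀ b ∈ I, sbr p p (X a (r + 1)) (Y b r) * (e b k * e a j) =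
      X b r * Y a r * (e b k * e a j) := by
    intro a ha b hb
    rw [h1 a ha b hb r hr]
  rw [sbr_deform he hX hY p p hj hk, h1 j hj k hk _ (by omega), Finset.sum_congr rfl h3,
    Finset.sum_congr rfl h4, Finset.sum_congr rfl fun a ha => Finset.sum_congr rfl (h5 a ha),
    deform_mul_deform hY, Finset.sum_comm (f := fun a b => X b r * Y a r * (e b k * e a j))]
  simp only [Finset.sum_const_zero, Finset.sum_add_distrib]
  abel

include he hX hY h2 in
theorem sbr_deform_diff (hj : j ∈ I) (hk : k ∈ I) {r s : ℕ} (hr : s₀ < r) (hs : s₀ < s) :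
    sbr p p (deform I e X j (r + 1)) (deform I e Y k s)
        - sbr p p (deform I e X j r) (deform I e Y k (s + 1)) =
      deform I e X k r * deform I e Y j s + deform I e X k s * deform I e Y j r := by
  rw [sbr_deform he hX hY p p hj hk, sbr_deform he hX hY p p hj hk, deform_mul_deform hY,
    deform_mul_deform hY]
  have h3 := h2 j hj k hk (r + 1) (s + 1) (by omega) (by omega)
  have h4 := Finset.sum_congr rfl fun b hb =>
    congrArg (· * e b k) (h2 j hj b hb (r + 1) s (by omega) hs)
  have h5 := Finset.sum_congr rfl fun a ha =>
    congrArg (· * e a j) (h2 a ha k hk r (s + 1) hr (by omega))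
  have h6 := Finset.sum_congr rfl fun a ha => Finset.sum_congr rfl fun b hb =>
    congrArg (· * (e b k * e a j)) (h2 a ha b hb r s hr hs)
  simp only [sub_mul, add_mul, Finset.sum_sub_distrib, Finset.sum_add_distrib] at h4 h5 h6
  rw [Finset.sum_comm (f := fun a b => X b r * Y a s * (e b k * e a j)),
    Finset.sum_comm (f := fun a b => X b s * Y a r * (e b k * e a j))] at h6
  linear_combination (norm := abel) h3 - h4 - h5 + h6

end SameRoot

include he hX hY in
-- Here `Y` will be a row of brackets `[E_m, E_b]`. The terms with one unit are governed by `h2`,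
-- after `h1` has moved a raised upper index from `Y` to `X`; they cancel the correction sums of
-- both brackets.
theorem sbr_deform_serre {p q : ZMod 2} {s₀ : ℕ}
    (h1 : ∀ j ∈ I, ∀ k ∈ I, ∀ r s, s₀ < r → s₀ < s →
      sbr p q (X j r) (Y k s) + sbr p q (X j s) (Y k r) = 0)
    (h2 : ∀ j ∈ I, ∀ k ∈ I, ∀ r s, s₀ < r → s₀ < s →
      sbr p q (X j (r + 1)) (Y k s) + sbr p q (X j (s + 1)) (Y k r) = X k r * Y j s + X k s * Y j r)
    (hj : j ∈ I) (hk : k ∈ I) {r s : ℕ} (hr : s₀ < r) (hs : s₀ < s) :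
    sbr p q (deform I e X j r) (deform I e Y k s) + sbr p q (deform I e X j s) (deform I e Y k r) =
      0 := by
  rw [sbr_deform he hX hY p q hj hk, sbr_deform he hX hY p q hj hk]
  have h3 := h1 j hj k hk (r + 1) (s + 1) (by omega) (by omega)
  have h4 := Finset.sum_congr rfl fun b hb => congrArg (· * e b k) (h2 j hj b hb r s hr hs)
  have h5 := Finset.sum_congr rfl fun a ha =>
    congrArg (· * e a j) (h1 a ha k hk r (s + 1) hr (by omega))
  have h5' := Finset.sum_congr rfl fun a ha =>
    congrArg (· * e a j) (h1 a ha k hk s (r + 1) hs (by omega))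
  have h6 := Finset.sum_congr rfl fun a ha => congrArg (· * e a j) (h2 a ha k hk r s hr hs)
  have h7 := Finset.sum_congr rfl fun a ha => Finset.sum_congr rfl fun b hb =>
    congrArg (· * (e b k * e a j)) (h1 a ha b hb r s hr hs)
  simp only [add_mul, zero_mul, Finset.sum_add_distrib, Finset.sum_const_zero] at h4 h5 h5' h6 h7
  linear_combination (norm := abel) h3 - h4 - h5 - h5' + h6 + h7

end Deform

/-! ### Deformation of the last diagonal block -/

section DeformLast

variable {n : ℕ} {A : Type*} [Ring A] {ν : Composition n} {σ σ' : ℕ → ℕ → ℕ}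
  {D E F : ℕ → ℕ → ℕ → ℕ → A}

/-- A consequence of the cubic relations and of the relations between `E_b` and `E_{b+1}`. -/
theorem SatisfiesRel.eee_shift (H : SatisfiesRel ν σ D E F) {a b i j r h k s f g l : ℕ}
    (h₁ : Symb.Valid ν σ (.E a i j r)) (h₂ : Symb.Valid ν σ (.E a h k s))
    (h₃ : Symb.Valid ν σ (.E b f g l)) (hba : b < a) :
    sbr (rootParity a) (rootParity a + rootParity b) (E a i j (r + 1))
        (sbr (rootParity a) (rootParity b) (E a h k s) (E b f g l))
      + sbr (rootParity a) (rootParity a + rootParity b) (E a i j (s + 1))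
        (sbr (rootParity a) (rootParity b) (E a h k r) (E b f g l)) =
      E a i k r * sbr (rootParity a) (rootParity b) (E a h j s) (E b f g l)
        + E a i k s * sbr (rootParity a) (rootParity b) (E a h j r) (E b f g l) := by
  obtain ⟨ha, hi, hj, hr⟩ := h₁
  obtain ⟨-, hh, hk, hs⟩ := h₂
  -- Since `1 ≤ b < a`, the root `a` is even and brackets with `E_a` are ordinary commutators.
  have hp : rootParity a = 0 := by
    have := (Finset.mem_Icc.mp h₃.1).1
    rw [rootParity, if_neg (by omega)]
  have vE : ∀ {i j r}, i ∈ Finset.Icc 1 (part ν a) → j ∈ Finset.Icc 1 (part ν (a + 1)) →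
      blockShift ν σ a (a + 1) < r → Symb.Valid ν σ (.E a i j r) := fun h1 h2 h3 => ⟨ha, h1, h2, h3⟩
  have h₃' : Symb.Valid ν σ (.E b f g (l + 1)) :=
    ⟨h₃.1, h₃.2.1, h₃.2.2.1, h₃.2.2.2.trans (Nat.lt_succ_self _)⟩
  have hz : ∀ {i j r f g l}, Symb.Valid ν σ (.E a i j r) → Symb.Valid ν σ (.E b f g l) →
      (b + 1 < a ∨ (a = b + 1 ∧ i ≠ g)) → E a i j r * E b f g l = E b f g l * E a i j r := by
    intro i j r f g l h h' hab
    have := H.ee_zero b f g l a i j r h' h hab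
    rw [hp, sbr_zero_right, sub_eq_zero] at this
    exact this.symm
  simp only [hp, sbr_zero_left]
  -- If row `h` of `E_a` commutes with `E_b`, every inner bracket is zero.
  by_cases hgh : b + 1 < a ∨ (a = b + 1 ∧ h ≠ g)
  · rw [hz (vE hh hk hs) h₃ hgh, hz (vE hh hk hr) h₃ hgh, hz (vE hh hj hs) h₃ hgh,
      hz (vE hh hj hr) h₃ hgh]
    simp
  obtain ⟨rfl, rfl⟩ : a = b + 1 ∧ h = g := by
    by_contra hc
    exact hgh (by omega)
  by_cases hih : i = h
  · subst hih
    have serre : ∀ {j r k s l}, j ∈ Finset.Icc 1 (part ν (b + 1 + 1)) →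
        k ∈ Finset.Icc 1 (part ν (b + 1 + 1)) → blockShift ν σ (b + 1) (b + 1 + 1) < r →
        blockShift ν σ (b + 1) (b + 1 + 1) < s → Symb.Valid ν σ (.E b f i l) →
        E (b + 1) i j r * (E (b + 1) i k s * E b f i l - E b f i l * E (b + 1) i k s)
          - (E (b + 1) i k s * E b f i l - E b f i l * E (b + 1) i k s) * E (b + 1) i j r
        + (E (b + 1) i j s * (E (b + 1) i k r * E b f i l - E b f i l * E (b + 1) i k r)
          - (E (b + 1) i k r * E b f i l - E b f i l * E (b + 1) i k r) * E (b + 1) i j s) = 0 := by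
      intro j r k s l hj hk hr hs hl
      have := H.eee (b + 1) i j r i k s b f i l (vE hi hj hr) (vE hi hk hs) hl (by omega)
      simpa only [hp, sbr_zero_left] using this
    -- Moves a raised upper index from `E_{b+1}` to `E_b` inside a bracket, leaving a sum of
    -- products.
    have next : ∀ {s}, blockShift ν σ (b + 1) (b + 1 + 1) < s →
        E (b + 1) i k (s + 1) * E b f i l - E b f i l * E (b + 1) i k (s + 1) =
          E (b + 1) i k s * E b f i (l + 1) - E b f i (l + 1) * E (b + 1) i k s
            - ∑ q ∈ Finset.Icc 1 (part ν (b + 1)), E b f q l * E (b + 1) q k s := by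
      intro s hs
      have := H.ee_next b f i l i k s h₃ (vE hi hk hs)
      rw [if_pos rfl, hp, sbr_zero_right, sbr_zero_right] at this
      linear_combination (norm := abel) this
    -- `E_{b+1;i,j}` commutes with `E_{b;f,q}` unless `q = i`, so moving it through the sum leaves a
    -- single bracket.
    have sumE : ∀ {r s}, blockShift ν σ (b + 1) (b + 1 + 1) < r →
        blockShift ν σ (b + 1) (b + 1 + 1) < s →
        E (b + 1) i j s * ∑ q ∈ Finset.Icc 1 (part ν (b + 1)), E b f q l * E (b + 1) q k r =
          (E (b + 1) i j s * E b f i l - E b f i l * E (b + 1) i j s) * E (b + 1) i k r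
            + ∑ q ∈ Finset.Icc 1 (part ν (b + 1)),
                E b f q l * (E (b + 1) i j s * E (b + 1) q k r) := by
      intro r s hr hs
      rw [Finset.mul_sum, ← sub_eq_iff_eq_add, ← Finset.sum_sub_distrib, Finset.sum_eq_single i]
      · noncomm_ring
      · intro q hq hqi
        rw [← mul_assoc, hz (vE hi hj hs) ⟨h₃.1, h₃.2.1, hq, h₃.2.2.2⟩ (Or.inr ⟨rfl, hqi.symm⟩),
          mul_assoc, sub_self]
      · exact fun h => absurd hi h
    have anti : ∑ q ∈ Finset.Icc 1 (part ν (b + 1)),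
          E b f q l * (E (b + 1) i j s * E (b + 1) q k r)
        - ∑ q ∈ Finset.Icc 1 (part ν (b + 1)), E b f q l * E (b + 1) q k r * E (b + 1) i j s
        + (∑ q ∈ Finset.Icc 1 (part ν (b + 1)),
          E b f q l * (E (b + 1) i j r * E (b + 1) q k s)
        - ∑ q ∈ Finset.Icc 1 (part ν (b + 1)), E b f q l * E (b + 1) q k s * E (b + 1) i j r)
        = 0 := by
      rw [← Finset.sum_sub_distrib, ← Finset.sum_sub_distrib, ← Finset.sum_add_distrib]
      refine Finset.sum_eq_zero fun q hq => ?_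
      have := H.ee_antisymm (vE hi hj hs) (vE hq hk hr)
      rw [hp, sbr_zero_left, sbr_zero_left] at this
      rw [mul_assoc, mul_assoc, ← mul_sub, ← mul_sub, ← mul_add, this, mul_zero]
    -- `t1` and `t2` contain the wanted brackets, each with a partner raised inside. After `next`
    -- the partners add up to `t3`, the cubic relation at `l + 1`, and the leftover sums reduce by
    -- `u1`, `u2` and `anti` to brackets times `E_{b+1;i,k}`. `t4`, with `j` and `k` exchanged,
    -- moves that factor to the left.
    have t1 := serre (r := r + 1) (s := s) (l := l) hj hk (by omega) hs h₃
    have t2 := serre (r := s + 1) (s := r) (l := l) hj hk (by omega) hr h₃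
    have t3 := serre (r := r) (s := s) hj hk hr hs h₃'
    have t4 := serre (r := r) (s := s) hk hj hr hs h₃
    rw [next hr] at t1
    rw [next hs] at t2
    have u1 := sumE hr hs
    have u2 := sumE hs hr
    simp only [mul_sub, sub_mul, Finset.sum_mul] at t1 t2 t3 t4 u1 u2 anti ⊢
    linear_combination (norm := abel) t1 + t2 - t3 - t4 + u1 + u2 + anti
  -- For `i ≠ h` the outer element commutes with `E_b`, so the double bracket is `[[x, y], v]` and
  -- the claim reduces to quadratic relations of `E_{b+1}`.
  · have hzi : ∀ {j r}, j ∈ Finset.Icc 1 (part ν (b + 1 + 1)) →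
        blockShift ν σ (b + 1) (b + 1 + 1) < r →
        E (b + 1) i j r * E b f h l = E b f h l * E (b + 1) i j r := fun hj hr =>
      hz (vE hi hj hr) h₃ (Or.inr ⟨rfl, hih⟩)
    have e1 := H.ee_antisymm (r := r) (s := s + 1) (vE hi hj hr) (vE hh hk (by omega))
    have e2 := H.ee_diff (b + 1) i j r h k s (vE hi hj hr) (vE hh hk hs)
    simp only [hp, sbr_zero_left] at e1 e2
    have e3 : (E (b + 1) i j (r + 1) * E (b + 1) h k s - E (b + 1) h k s * E (b + 1) i j (r + 1))
        + (E (b + 1) i j (s + 1) * E (b + 1) h k r - E (b + 1) h k r * E (b + 1) i j (s + 1)) =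
        E (b + 1) i k r * E (b + 1) h j s + E (b + 1) i k s * E (b + 1) h j r := by
      linear_combination (norm := abel) e1 + e2
    have key : ∀ x y v : A, x * v = v * x → x * (y * v - v * y) - (y * v - v * y) * x =
        (x * y - y * x) * v - v * (x * y - y * x) := by
      intro x y v hxv
      have h1 : x * (v * y) = v * (x * y) := by rw [← mul_assoc, hxv, mul_assoc]
      have h2 : y * v * x = y * x * v := by rw [mul_assoc, ← hxv, mul_assoc]
      simp only [mul_sub, sub_mul, h1, h2]
      noncomm_ring
    have key' : ∀ x y v : A, x * v = v * x → x * (y * v - v * y) = x * y * v - v * (x * y) := by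
      intro x y v hxv
      rw [mul_sub, ← mul_assoc x v, hxv]
      noncomm_ring
    rw [key _ _ _ (hzi hj (by omega)), key _ _ _ (hzi hj (by omega)), key' _ _ _ (hzi hk hr),
      key' _ _ _ (hzi hk hs), sub_add_sub_comm, ← add_mul, ← mul_add, e3, add_mul, mul_add]
    abel

end DeformLast

/-! ### The deformed families and the relations they satisfy. -/

section DeformLast

variable {n : ℕ} {A : Type*} [Ring A]

/-- The sequence `0, X^{(0)}, X^{(1)}, …`. -/
def prepend (X : ℕ → ℕ → A) (j : ℕ) : ℕ → A
  | 0 => 0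
  | r + 1 => X j r

/-- The elements `D_{a;i,j}^{(r)} - δ_{a,m+1} ∑_k D_{a;i,k}^{(r-1)} e_{k,j}`. -/
def deformD (ν : Composition n) (e : ℕ → ℕ → A) (D : ℕ → ℕ → ℕ → ℕ → A) (a i j r : ℕ) : A :=
  D a i j r - if a = ν.length + 1 ∧ 1 ≤ r then
    ∑ k ∈ Finset.Icc 1 (lastPart ν), D a i k (r - 1) * e k j else 0

/-- The elements `E_{a;i,j}^{(r)} - δ_{a,m} ∑_k E_{a;i,k}^{(r-1)} e_{k,j}`. -/
def deformE (ν : Composition n) (e : ℕ → ℕ → A) (E : ℕ → ℕ → ℕ → ℕ → A) (a i j r : ℕ) : A :=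
  E a i j r - if a = ν.length then
    ∑ k ∈ Finset.Icc 1 (lastPart ν), E a i k (r - 1) * e k j else 0

variable {ν : Composition n} {σ σ' : ℕ → ℕ → ℕ} {D E F : ℕ → ℕ → ℕ → ℕ → A} {e : ℕ → ℕ → A}

theorem deformD_of_ne {a : ℕ} (h : a ≠ ν.length + 1) (i j r : ℕ) :
    deformD ν e D a i j r = D a i j r := by
  rw [deformD, if_neg fun h' => h h'.1, sub_zero]

theorem deformE_of_ne {a : ℕ} (h : a ≠ ν.length) (i j r : ℕ) :
    deformE ν e E a i j r = E a i j r := by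
  rw [deformE, if_neg h, sub_zero]

/-- The prepended zero plays the role of `D^{(-1)}` and compensates the index shift in `deform`. -/
theorem deformD_last (i j r : ℕ) : deformD ν e D (ν.length + 1) i j r =
    deform (Finset.Icc 1 (lastPart ν)) e (prepend (D (ν.length + 1) i)) j r := by
  cases r <;> simp [deformD, deform, prepend]

/-- No zero is prepended for `E`: the shift by one is the lowering of the first admissible upper
index. -/
theorem deformE_last (i j r : ℕ) : deformE ν e E ν.length i j (r + 1) =
    deform (Finset.Icc 1 (lastPart ν)) e (E ν.length i) j r := by
  simp [deformE, deform]

/-- A bracket with an element commuting with all `e a b` acts entrywise on the row. With the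
linearity rules below, this carries over every relation that is linear in the deformed row. -/
theorem sbr_deform_right (p q : ZMod 2) {I : Finset ℕ} {x : A} (X : ℕ → ℕ → A)
    (hx : ∀ a b, Commute (e a b) x) (j r : ℕ) :
    sbr p q x (deform I e X j r) = deform I e (fun j r => sbr p q x (X j r)) j r :=
  sbr_sub_sum_right p q I x _ _ _ fun _ => hx _ _

theorem sbr_deform_left (p q : ZMod 2) {I : Finset ℕ} {y : A} (X : ℕ → ℕ → A)
    (hy : ∀ a b, Commute (e a b) y) (j r : ℕ) :
    sbr p q (deform I e X j r) y = deform I e (fun j r => sbr p q (X j r) y) j r :=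
  sbr_sub_sum_left p q I _ y _ _ fun _ => hy _ _

theorem deform_sub (I : Finset ℕ) (X Y : ℕ → ℕ → A) (j r : ℕ) :
    deform I e (fun j r => X j r - Y j r) j r = deform I e X j r - deform I e Y j r := by
  simp only [deform, sub_mul, Finset.sum_sub_distrib]; abel

theorem deform_add (I : Finset ℕ) (X Y : ℕ → ℕ → A) (j r : ℕ) :
    deform I e (fun j r => X j r + Y j r) j r = deform I e X j r + deform I e Y j r := by
  simp only [deform, add_mul, Finset.sum_add_distrib]; abel

theorem deform_sum {ι : Type*} (I : Finset ℕ) (J : Finset ι) (X : ι → ℕ → ℕ → A) (j r : ℕ) :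
    deform I e (fun j r => ∑ p ∈ J, X p j r) j r = ∑ p ∈ J, deform I e (X p) j r := by
  simp only [deform, Finset.sum_mul, Finset.sum_sub_distrib]
  rw [Finset.sum_comm]

theorem deform_mul (I : Finset ℕ) (x : A) (X : ℕ → ℕ → A) (j r : ℕ) :
    deform I e (fun j r => x * X j r) j r = x * deform I e X j r := by
  simp only [deform, mul_sub, Finset.mul_sum, mul_assoc]

theorem deform_mul_of_commute (I : Finset ℕ) {x : A} (hx : ∀ a b, Commute (e a b) x)
    (X : ℕ → ℕ → A) (j r : ℕ) :
    deform I e (fun j r => X j r * x) j r = deform I e X j r * x := by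
  simp only [deform, sub_mul, Finset.sum_mul, mul_assoc, (hx _ _).eq]

theorem deform_neg (I : Finset ℕ) (X : ℕ → ℕ → A) (j r : ℕ) :
    deform I e (fun j r => -X j r) j r = -deform I e X j r := by
  simp only [deform, neg_mul, Finset.sum_neg_distrib]; abel

/-- The deformation at `r` sees only upper indices `r`, `r + 1` and columns in `I`, so relations
known for generators suffice. -/
theorem deform_congr {I : Finset ℕ} {X Y : ℕ → ℕ → A} {s₀ j r : ℕ} (hj : j ∈ I) (hr : s₀ < r)
    (h : ∀ j ∈ I, ∀ r, s₀ < r → X j r = Y j r) : deform I e X j r = deform I e Y j r := by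
  rw [deform, deform, h j hj (r + 1) (by omega)]
  congr 1
  exact Finset.sum_congr rfl fun k hk => by rw [h k hk r hr]

theorem deform_zero (I : Finset ℕ) (j r : ℕ) : deform I e (fun _ _ => 0) j r = 0 := by
  simp [deform]

theorem deform_eq_zero {I : Finset ℕ} {X : ℕ → ℕ → A} {s₀ j r : ℕ} (hj : j ∈ I) (hr : s₀ < r)
    (h : ∀ j ∈ I, ∀ r, s₀ < r → X j r = 0) : deform I e X j r = 0 :=
  (deform_congr hj hr h).trans (deform_zero I j r)

theorem commute_prepend {z : A} {X : ℕ → ℕ → A} (h : ∀ j r, Commute z (X j r)) (j r : ℕ) :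
    Commute z (prepend X j r) := by
  cases r
  exacts [Commute.zero_right z, h _ _]

/-- Multiplying the last blocks `D_{m+1}(u)` and `E_m(u)` by `1 - u⁻¹ e`, for matrix units `e`
commuting with everything, lowers the admissible upper indices of `E_m` by one. -/
theorem SatisfiesRel.deform_last (H : SatisfiesRel ν σ' D E F) (hν : 0 < ν.length)
    (hσ : blockShift ν σ ν.length (ν.length + 1) = blockShift ν σ' ν.length (ν.length + 1) + 1)
    (hσE : ∀ a ∈ Finset.Icc 1 ν.length, a ≠ ν.length →
      blockShift ν σ a (a + 1) = blockShift ν σ' a (a + 1))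
    (hσF : ∀ a ∈ Finset.Icc 1 ν.length, blockShift ν σ (a + 1) a = blockShift ν σ' (a + 1) a)
    (he : IsMatrixUnits (Finset.Icc 1 (lastPart ν)) e)
    (heD : ∀ p q a i j r, Commute (e p q) (D a i j r))
    (heE : ∀ p q a i j r, Commute (e p q) (E a i j r))
    (heF : ∀ p q a i j r, Commute (e p q) (F a i j r)) :
    SatisfiesRel ν σ (deformD ν e D) (deformE ν e E) F := by
  have vE : ∀ {a i j r}, a ≠ ν.length → Symb.Valid ν σ (.E a i j r) →
      Symb.Valid ν σ' (.E a i j r) := fun h h' =>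
    ⟨h'.1, h'.2.1, h'.2.2.1, (hσE _ h'.1 h) ▸ h'.2.2.2⟩
  have vF : ∀ {a i j r}, Symb.Valid ν σ (.F a i j r) → Symb.Valid ν σ' (.F a i j r) :=
    fun h' => ⟨h'.1, h'.2.1, h'.2.2.1, (hσF _ h'.1) ▸ h'.2.2.2⟩
  -- By `hσ`, a generator of upper index `r` for `σ` corresponds to one of upper index `r - 1` for
  -- `σ'`.
  have vL : ∀ {i j r}, Symb.Valid ν σ (.E ν.length i j r) →
      ∃ r', r = r' + 1 ∧ Symb.Valid ν σ' (.E ν.length i j r') := by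
    intro i j r h
    have h4 : blockShift ν σ ν.length (ν.length + 1) < r := h.2.2.2
    exact ⟨r - 1, by omega, h.1, h.2.1, h.2.2.1, show _ < _ by omega⟩
  have vS : ∀ {a i j r k s}, Symb.Valid ν σ' (.E a i j r) → k ∈ Finset.Icc 1 (part ν (a + 1)) →
      blockShift ν σ' a (a + 1) < s → Symb.Valid ν σ' (.E a i k s) :=
    fun h hk hs => ⟨h.1, h.2.1, hk, hs⟩
  have hle : ∀ {a}, a ∈ Finset.Icc 1 ν.length → a ≠ ν.length + 1 := fun h =>
    ((Finset.mem_Icc.mp h).2.trans_lt (Nat.lt_succ_self _)).ne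
  have heP : ∀ i a b k r, Commute (e a b) (prepend (D (ν.length + 1) i) k r) :=
    fun i a b => commute_prepend fun _ _ => heD _ _ _ _ _ _
  have vD : ∀ {i j r}, i ∈ Finset.Icc 1 (lastPart ν) → j ∈ Finset.Icc 1 (lastPart ν) →
      Symb.Valid ν σ' (.D (ν.length + 1) i j r) := fun hi hj =>
    ⟨Finset.mem_Icc.mpr ⟨by omega, le_rfl⟩, hi, hj⟩
  -- Prepending zero preserves the relation at the boundary because `D^{(0)}` is scalar. The sign is
  -- `-1` because `m + 1 ≥ 2` is an odd index.
  have rtt : ∀ i ∈ Finset.Icc 1 (lastPart ν), ∀ h ∈ Finset.Icc 1 (lastPart ν),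
      ∀ j ∈ Finset.Icc 1 (lastPart ν), ∀ k ∈ Finset.Icc 1 (lastPart ν), ∀ r s,
      sbr 0 0 (prepend (D (ν.length + 1) i) j (r + 1)) (prepend (D (ν.length + 1) h) k s)
        - sbr 0 0 (prepend (D (ν.length + 1) i) j r) (prepend (D (ν.length + 1) h) k (s + 1)) =
      -(prepend (D (ν.length + 1) h) j r * prepend (D (ν.length + 1) i) k s
        - prepend (D (ν.length + 1) h) j s * prepend (D (ν.length + 1) i) k r) := by
    intro i hi h hh j hj k hk r s
    have z1 := fun s => H.sbr_d_zero_left (vD hi hj) 0 (D (ν.length + 1) h k s)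
    have z2 : ∀ r, sbr 0 0 (D (ν.length + 1) i j r) (D (ν.length + 1) h k 0) = 0 := fun r => by
      rw [sbr_zero_left, ← neg_sub, ← sbr_zero_left 0, H.sbr_d_zero_left (vD hh hk), neg_zero]
    cases r with
    | zero => cases s <;> simp [prepend, z1]
    | succ r =>
      cases s with
      | zero => simp [prepend, z2]
      | succ s =>
        have := H.dd_same (ν.length + 1) i j r h k s (vD hi hj) (vD hh hk)
        rw [pa, if_neg (by omega), pow_one, neg_one_mul] at this
        exact this
  have deP : ∀ {h k₀ s₁}, Symb.Valid ν σ' (.E ν.length h k₀ s₁) →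
      ∀ i ∈ Finset.Icc 1 (lastPart ν), ∀ j ∈ Finset.Icc 1 (lastPart ν),
      ∀ k ∈ Finset.Icc 1 (lastPart ν), ∀ r s, blockShift ν σ' ν.length (ν.length + 1) < s →
      sbr 0 (rootParity ν.length) (prepend (D (ν.length + 1) i) j (r + 1)) (E ν.length h k s)
        - sbr 0 (rootParity ν.length) (prepend (D (ν.length + 1) i) j r)
          (E ν.length h k (s + 1)) =
      prepend (D (ν.length + 1) i) k r * E ν.length h j s := by
    intro h k₀ s₁ hv i hi j hj k hk r s hs
    cases r with
    | zero => simp [prepend, H.sbr_d_zero_left (vD hi hj)]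
    | succ r => exact H.de_next i j r _ h k s (vD hi hj) (vS hv hk hs)
  have dfP : ∀ {h k s}, Symb.Valid ν σ' (.F ν.length h k s) →
      ∀ i ∈ Finset.Icc 1 (lastPart ν), ∀ j ∈ Finset.Icc 1 (lastPart ν), ∀ r,
      sbr 0 (rootParity ν.length) (prepend (D (ν.length + 1) i) j (r + 1)) (F ν.length h k s)
        - sbr 0 (rootParity ν.length) (prepend (D (ν.length + 1) i) j r)
          (F ν.length h k (s + 1)) =
      -(F ν.length i k s * prepend (D (ν.length + 1) h) j r) := by
    intro h k s hv i hi j hj r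
    cases r with
    | zero => simp [prepend, H.sbr_d_zero_left (vD hi hj)]
    | succ r => exact H.df_next i j r _ h k s (vD hi hj) hv
  have commD : ∀ {z : A} {a i j r}, (∀ p q, Commute (e p q) z) → Symb.Valid ν σ' (.D a i j r) →
      (∀ k r, Symb.Valid ν σ' (.D a i k r) → Commute (D a i k r) z) →
      Commute (deformD ν e D a i j r) z := by
    intro z a i j r hez hv hz
    rw [deformD]
    refine (hz j r hv).sub_left ?_
    split_ifs with h
    · refine Commute.sum_left _ _ _ fun k hk => (hz k _ ?_).mul_left (hez _ _)
      obtain ⟨rfl, -⟩ := h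
      exact vD hv.2.1 hk
    · exact Commute.zero_left z
  constructor
  case d_zero =>
    intro a i j h
    rw [deformD, if_neg (by omega), sub_zero, H.d_zero a i j h]
  case dd_ne =>
    intro a i j r b h k s h₁ h₂ hab
    apply sbr_zero_left_eq_zero
    by_cases ha : a = ν.length + 1
    · rw [deformD_of_ne (a := b) (by omega)]
      exact commD (fun _ _ => heD _ _ _ _ _ _) h₁ fun k' r' hv =>
        commute_of_sbr_eq_zero (H.dd_ne _ _ _ _ _ _ _ _ hv h₂ hab)
    · rw [deformD_of_ne ha]
      exact (commD (fun _ _ => heD _ _ _ _ _ _) h₂ fun k' r' hv =>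
        commute_of_sbr_eq_zero (H.dd_ne _ _ _ _ _ _ _ _ hv h₁ hab.symm)).symm
  case dd_same =>
    intro a i j r h k s h₁ h₂
    by_cases ha : a = ν.length + 1
    · subst ha
      simp only [deformD_last]
      rw [pa, if_neg (by omega), pow_one, neg_one_mul]
      exact sbr_deform_rtt he (heP i) (heP h) (rtt i h₁.2.1 h h₂.2.1) h₁.2.2 h₂.2.2 r s
    · simp only [deformD_of_ne ha]
      exact H.dd_same a i j r h k s h₁ h₂
  case de_ne =>
    intro a i j r b h k s h₁ h₂ hab hab'
    by_cases hb : b = ν.length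
    · subst hb
      obtain ⟨s, rfl, h₂'⟩ := vL h₂
      rw [deformD_of_ne hab', deformE_last, sbr_deform_right _ _ _ fun _ _ => heD _ _ _ _ _ _]
      exact deform_eq_zero h₂'.2.2.1 h₂'.2.2.2 fun k' hk' r' hr' =>
        H.de_ne a i j r _ h k' r' h₁ (vS h₂' hk' hr') hab hab'
    · rw [deformE_of_ne hb]
      exact sbr_zero_left_eq_zero _ (commD (fun _ _ => heE _ _ _ _ _ _) h₁ fun k' r' hv =>
        commute_of_sbr_eq_zero (H.de_ne _ _ _ _ _ _ _ _ hv (vE hb h₂) hab hab'))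
  case de_same =>
    intro i j r b h k s h₁ h₂
    simp only [deformD_of_ne (hle h₂.1)]
    by_cases hb : b = ν.length
    · subst hb
      obtain ⟨s, rfl, h₂'⟩ := vL h₂
      have hc : ∀ r a b, Commute (e a b) (D ν.length i j r) := fun _ _ _ => heD _ _ _ _ _ _
      simp only [deformE_last]
      rw [sbr_deform_right _ _ _ (hc _), sbr_deform_right _ _ _ (hc _)]
      refine Eq.trans (deform_sub _ _ (fun k s => sbr 0 (rootParity ν.length) (D ν.length i j r)
        (E ν.length h k (s + 1))) k s).symm ?_
      rw [deform_congr (I := Finset.Icc 1 (lastPart ν)) h₂'.2.2.1 h₂'.2.2.2 fun k' hk' s' hs' =>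
        H.de_same i j r _ h k' s' h₁ (vS h₂' hk' hs')]
      by_cases hj : h = j
      · simp only [if_pos hj, deform_mul, deform_sum]
      · simp only [if_neg hj, deform_zero]
    · simp only [deformE_of_ne hb]
      exact H.de_same i j r b h k s h₁ (vE hb h₂)
  case de_next =>
    intro i j r b h k s h₁ h₂
    by_cases hb : b = ν.length
    · subst hb
      obtain ⟨s, rfl, h₂'⟩ := vL h₂
      simp only [deformD_last, deformE_last]
      exact sbr_deform_of_vertical he (heP i) (fun _ _ _ _ => heE _ _ _ _ _ _)
        (deP h₂' i h₁.2.1) h₁.2.2 h₂'.2.2.1 h₂'.2.2.2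
    · have hb' : b + 1 ≠ ν.length + 1 := fun h => hb (Nat.succ_injective h)
      simp only [deformE_of_ne hb, deformD_of_ne hb']
      exact H.de_next i j r b h k s h₁ (vE hb h₂)
  case df_ne =>
    intro a i j r b h k s h₁ h₂ hab hab'
    exact sbr_zero_left_eq_zero _ (commD (fun _ _ => heF _ _ _ _ _ _) h₁ fun k' r' hv =>
      commute_of_sbr_eq_zero (H.df_ne _ _ _ _ _ _ _ _ hv (vF h₂) hab hab'))
  case df_same =>
    intro i j r b h k s h₁ h₂
    simp only [deformD_of_ne (hle h₂.1)]
    exact H.df_same i j r b h k s h₁ (vF h₂)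
  case df_next =>
    intro i j r b h k s h₁ h₂
    by_cases hb : b = ν.length
    · subst hb
      have hc : ∀ s a b, Commute (e a b) (F ν.length h k s) := fun _ _ _ => heF _ _ _ _ _ _
      simp only [deformD_last]
      rw [sbr_deform_left _ _ _ (hc _), sbr_deform_left _ _ _ (hc _)]
      refine Eq.trans (deform_sub _ (fun j r => sbr 0 (rootParity ν.length)
        (prepend (D (ν.length + 1) i) j (r + 1)) (F ν.length h k s)) _ j r).symm ?_
      rw [← deform_mul, ← deform_neg]
      -- The relation is needed from `r = 0` on, while `deform_congr` assumes a strict lower bound,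
      -- so it is substituted termwise.
      simp only [deform]
      rw [dfP (vF h₂) i h₁.2.1 j h₁.2.2]
      congr 1
      exact Finset.sum_congr rfl fun a ha => by rw [dfP (vF h₂) i h₁.2.1 a ha]
    · have hb' : b + 1 ≠ ν.length + 1 := fun h => hb (Nat.succ_injective h)
      simp only [deformD_of_ne hb']
      exact H.df_next i j r b h k s h₁ (vF h₂)
  case ee_diag =>
    intro a i j r h k h₁ h₂
    by_cases ha : a = ν.length
    · subst ha
      obtain ⟨r, rfl, h₁'⟩ := vL h₁
      simp only [deformE_last]
      exact sbr_deform_self (X := E ν.length i) (Y := E ν.length h) he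
        (fun _ _ _ _ => heE _ _ _ _ _ _) (fun _ _ _ _ => heE _ _ _ _ _ _)
        (fun j hj k hk r hr => H.ee_diag _ _ _ _ _ _ (vS h₁' hj hr) ⟨h₁.1, h₂.2.1, hk, hr⟩)
        (fun j hj k hk r hr => H.ee_succ _ _ _ _ _ _ (vS h₁' hj hr) ⟨h₁.1, h₂.2.1, hk, hr⟩)
        (fun j hj k hk r s hr hs =>
          H.ee_diff _ _ _ _ _ _ _ (vS h₁' hj hr) ⟨h₁.1, h₂.2.1, hk, hs⟩)
        h₁'.2.2.1 h₂.2.2.1 h₁'.2.2.2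
    · simp only [deformE_of_ne ha]
      exact H.ee_diag a i j r h k (vE ha h₁) (vE ha h₂)
  case ee_succ =>
    intro a i j r h k h₁ h₂
    by_cases ha : a = ν.length
    · subst ha
      obtain ⟨r, rfl, h₁'⟩ := vL h₁
      simp only [deformE_last]
      exact sbr_deform_succ (X := E ν.length i) (Y := E ν.length h) he
        (fun _ _ _ _ => heE _ _ _ _ _ _) (fun _ _ _ _ => heE _ _ _ _ _ _)
        (fun j hj k hk r hr => H.ee_diag _ _ _ _ _ _ (vS h₁' hj hr) ⟨h₁.1, h₂.2.1, hk, hr⟩)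
        (fun j hj k hk r hr => H.ee_succ _ _ _ _ _ _ (vS h₁' hj hr) ⟨h₁.1, h₂.2.1, hk, hr⟩)
        (fun j hj k hk r s hr hs =>
          H.ee_diff _ _ _ _ _ _ _ (vS h₁' hj hr) ⟨h₁.1, h₂.2.1, hk, hs⟩)
        h₁'.2.2.1 h₂.2.2.1 h₁'.2.2.2
    · simp only [deformE_of_ne ha]
      exact H.ee_succ a i j r h k (vE ha h₁) (vE ha h₂)
  case ee_diff =>
    intro a i j r h k s h₁ h₂
    by_cases ha : a = ν.length
    · subst ha
      obtain ⟨r, rfl, h₁'⟩ := vL h₁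
      obtain ⟨s, rfl, h₂'⟩ := vL h₂
      simp only [deformE_last]
      exact sbr_deform_diff (X := E ν.length i) (Y := E ν.length h) he
        (fun _ _ _ _ => heE _ _ _ _ _ _) (fun _ _ _ _ => heE _ _ _ _ _ _)
        (fun j hj k hk r s hr hs =>
          H.ee_diff _ _ _ _ _ _ _ (vS h₁' hj hr) (vS h₂' hk hs))
        h₁'.2.2.1 h₂.2.2.1 h₁'.2.2.2 h₂'.2.2.2
    · simp only [deformE_of_ne ha]
      exact H.ee_diff a i j r h k s (vE ha h₁) (vE ha h₂)
  case ff_diag => exact fun a i j r h k h₁ h₂ => H.ff_diag a i j r h k (vF h₁) (vF h₂)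
  case ff_succ => exact fun a i j r h k h₁ h₂ => H.ff_succ a i j r h k (vF h₁) (vF h₂)
  case ff_diff => exact fun a i j r h k s h₁ h₂ => H.ff_diff a i j r h k s (vF h₁) (vF h₂)
  case ef_ne =>
    intro a i j r b h k s h₁ h₂ hab
    by_cases ha : a = ν.length
    · subst ha
      obtain ⟨r, rfl, h₁'⟩ := vL h₁
      rw [deformE_last, sbr_deform_left _ _ _ fun _ _ => heF _ _ _ _ _ _]
      exact deform_eq_zero h₁'.2.2.1 h₁'.2.2.2 fun k' hk' r' hr' =>
        H.ef_ne _ i k' r' b h k s (vS h₁' hk' hr') (vF h₂) hab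
    · rw [deformE_of_ne ha]
      exact H.ef_ne a i j r b h k s (vE ha h₁) (vF h₂) hab
  case ef_same =>
    intro a i j r h k s h₁ h₂
    simp only [deformD_of_ne (hle h₁.1)]
    by_cases ha : a = ν.length
    · subst ha
      obtain ⟨r, rfl, h₁'⟩ := vL h₁
      have hc : ∀ t a b, Commute (e a b)
          (invCoeff (part ν ν.length) (fun t i j => D ν.length i j t) t i k) :=
        fun t _ _ => commute_invCoeff (fun _ _ _ _ _ => heD _ _ _ _ _ _) t k h₁.2.1
      rw [deformE_last, sbr_deform_left _ _ _ fun _ _ => heF _ _ _ _ _ _,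
        deform_congr (I := Finset.Icc 1 (lastPart ν)) h₁'.2.2.1 h₁'.2.2.2 fun k' hk' r' hr' =>
          H.ef_same _ i k' r' h k s (vS h₁' hk' hr') (vF h₂)]
      simp only [deformD_last, ← deform_mul_of_commute _ (hc _)]
      simp only [deform, Finset.sum_sub_distrib]
      congr 1
      rw [Finset.sum_comm]
      refine Finset.sum_congr rfl fun b _ => ?_
      -- The longer sum has one extra term, with factor `D^{(-1)} = 0`; the other terms match after
      -- the shift by one.
      rw [show r + 1 + s = r + s + 1 by omega, Finset.sum_range_succ,
        show r + s + 1 - 1 - (r + s) = 0 by omega, Finset.sum_mul]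
      simp only [prepend, zero_mul, add_zero]
      refine Finset.sum_congr rfl fun t ht => ?_
      rw [Finset.mem_range] at ht
      rw [show r + s + 1 - 1 - t = r + s - 1 - t + 1 by omega]
    · have ha' : a + 1 ≠ ν.length + 1 := fun h => ha (Nat.succ_injective h)
      simp only [deformE_of_ne ha, deformD_of_ne ha']
      exact H.ef_same a i j r h k s (vE ha h₁) (vF h₂)
  case ee_next =>
    intro a i j r h k s h₁ h₂
    -- `E_{a+1}` exists, so `E_a` is not the last root: only the second factor can be deformed.
    have ha : a ≠ ν.length := fun h => hle h₂.1 (congrArg (· + 1) h)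
    simp only [deformE_of_ne ha]
    by_cases hb : a + 1 = ν.length
    · obtain ⟨s, rfl, h₂'⟩ := vL (hb ▸ h₂)
      have hc : ∀ r a' b', Commute (e a' b') (E a i j r) := fun _ _ _ => heE _ _ _ _ _ _
      have h₂'' : Symb.Valid ν σ' (.E (a + 1) h k s) := hb.symm ▸ h₂'
      simp only [hb, deformE_last]
      rw [sbr_deform_right _ _ _ (hc _), sbr_deform_right _ _ _ (hc _)]
      refine Eq.trans (deform_sub _ _ (fun k s => sbr (rootParity a) (rootParity ν.length)
        (E a i j r) (E ν.length h k (s + 1))) k s).symm ?_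
      have key : ∀ k' ∈ Finset.Icc 1 (lastPart ν), ∀ s',
          blockShift ν σ' ν.length (ν.length + 1) < s' → _ := fun k' hk' s' hs' =>
        H.ee_next a i j r h k' s' (vE ha h₁) (vS h₂'' (hb ▸ hk') (hb ▸ hs'))
      simp only [hb] at key
      rw [deform_congr (I := Finset.Icc 1 (lastPart ν)) h₂'.2.2.1 h₂'.2.2.2 key]
      by_cases hj : h = j
      · simp only [if_pos hj, deform_neg, deform_mul, deform_sum]
      · simp only [if_neg hj, deform_zero]
    · simp only [deformE_of_ne hb]
      exact H.ee_next a i j r h k s (vE ha h₁) (vE hb h₂)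
  case ff_next => exact fun a i j r h k s h₁ h₂ => H.ff_next a i j r h k s (vF h₁) (vF h₂)
  case ee_zero =>
    intro a i j r b h k s h₁ h₂ hab
    have ha : a ≠ ν.length := by
      have := (Finset.mem_Icc.mp h₂.1).2
      omega
    rw [deformE_of_ne ha]
    by_cases hb : b = ν.length
    · subst hb
      obtain ⟨s, rfl, h₂'⟩ := vL h₂
      rw [deformE_last, sbr_deform_right _ _ _ fun _ _ => heE _ _ _ _ _ _]
      exact deform_eq_zero h₂'.2.2.1 h₂'.2.2.2 fun k' hk' r' hr' =>
        H.ee_zero a i j r _ h k' r' (vE ha h₁) (vS h₂' hk' hr') hab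
    · rw [deformE_of_ne hb]
      exact H.ee_zero a i j r b h k s (vE ha h₁) (vE hb h₂) hab
  case ff_zero =>
    exact fun a i j r b h k s h₁ h₂ hab => H.ff_zero a i j r b h k s (vF h₁) (vF h₂) hab
  case eee =>
    intro a i j r h k s b f g l h₁ h₂ h₃ hab
    by_cases ha : a = ν.length
    · subst ha
      obtain ⟨r, rfl, h₁'⟩ := vL h₁
      obtain ⟨s, rfl, h₂'⟩ := vL h₂
      have h₃' := vE hab.symm h₃
      have hb := (Finset.mem_Icc.mp h₃.1).2
      have hc : ∀ a' b', Commute (e a' b') (E b f g l) := fun _ _ => heE _ _ _ _ _ _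
      simp only [deformE_of_ne hab.symm, deformE_last]
      rw [sbr_deform_left _ _ _ hc, sbr_deform_left _ _ _ hc]
      -- The only cubic case with two deformed factors; `b < m` then holds, as `eee_shift` requires.
      exact sbr_deform_serre (X := E ν.length i)
        (Y := fun k s => sbr (rootParity ν.length) (rootParity b) (E ν.length h k s) (E b f g l))
        he (fun _ _ _ _ => heE _ _ _ _ _ _)
        (fun _ _ _ _ => commute_sbr _ _ (heE _ _ _ _ _ _) (hc _ _))
        (fun j hj k hk r s hr hs =>
          H.eee _ _ _ _ _ _ _ _ _ _ _ (vS h₁' hj hr) (vS h₂' hk hs) h₃' hab)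
        (fun j hj k hk r s hr hs =>
          H.eee_shift (vS h₁' hj hr) (vS h₂' hk hs) h₃' (by omega))
        h₁'.2.2.1 h₂'.2.2.1 h₁'.2.2.2 h₂'.2.2.2
    · simp only [deformE_of_ne ha]
      by_cases hb : b = ν.length
      · subst hb
        obtain ⟨l, rfl, h₃'⟩ := vL h₃
        have hc : ∀ i j r a' b', Commute (e a' b') (E a i j r) :=
          fun _ _ _ _ _ => heE _ _ _ _ _ _
        simp only [deformE_last, sbr_deform_right _ _ _ (hc _ _ _)]
        rw [← deform_add]
        exact deform_eq_zero h₃'.2.2.1 h₃'.2.2.2 fun g' hg' l' hl' =>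
          H.eee a i j r h k s _ f g' l' (vE ha h₁) (vE ha h₂) (vS h₃' hg' hl') hab
      · rw [deformE_of_ne hb]
        exact H.eee a i j r h k s b f g l (vE ha h₁) (vE ha h₂) (vE hb h₃) hab
  case fff =>
    exact fun a i j r h k s b f g l h₁ h₂ h₃ hab =>
      H.fff a i j r h k s b f g l (vF h₁) (vF h₂) (vF h₃) hab

end DeformLast

/-! ### Partial sums of the parts and lowered shift matrices -/

section Shift

variable {n : ℕ} {ν : Composition n}

theorem partSum_succ (ν : Composition n) (a : ℕ) : partSum ν (a + 1) = partSum ν a + part ν (a + 1) :=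
  Finset.sum_Icc_succ_top (by omega) _

theorem partSum_eq_sum_take (ν : Composition n) (a : ℕ) :
    partSum ν a = ((1 :: ν.blocks).take a).sum := by
  induction a with
  | zero => simp [partSum]
  | succ a ih =>
    rw [partSum_succ, ih, List.take_add_one, List.sum_append, part, List.getD_eq_getElem?_getD]
    cases (1 :: ν.blocks)[a]? <;> simp

theorem partSum_mono (ν : Composition n) : Monotone (partSum ν) :=
  monotone_nat_of_le_succ fun a => by rw [partSum_succ]; omega

theorem partSum_add_lastPart (ν : Composition n) : partSum ν ν.length + lastPart ν = n + 1 := by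
  rw [lastPart, ← partSum_succ, partSum_eq_sum_take, List.take_of_length_le (by simp),
    List.sum_cons, ν.blocks_sum, add_comm]

theorem lastPart_pos (hν : 0 < ν.length) : 0 < lastPart ν := by
  obtain ⟨m, hm⟩ : ∃ m, ν.length = m + 1 := ⟨ν.length - 1, by omega⟩
  have hlt : m < ν.blocks.length := by rw [ν.blocks_length]; omega
  rw [lastPart, part, hm, List.getD_cons_succ, List.getD_eq_getElem _ _ hlt]
  exact ν.blocks_pos (List.getElem_mem hlt)

theorem partSum_length_pos (hν : 0 < ν.length) : 0 < partSum ν ν.length := by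
  have h1 : partSum ν 1 = 1 := by simp [partSum, part]
  have := partSum_mono ν (show 1 ≤ ν.length from hν)
  omega

theorem IsShiftMatrix.transpose {σ : ℕ → ℕ → ℕ} (h : IsShiftMatrix n σ) :
    IsShiftMatrix n fun i j => σ j i := by
  intro i j k hi hj hk hijk
  have := h k j i hk hj hi (by
    rw [abs_sub_comm (k : ℤ) j, abs_sub_comm (j : ℤ) i, abs_sub_comm (k : ℤ) i, add_comm, hijk])
  simp only
  omega

theorem IsAdmissible.transpose {σ : ℕ → ℕ → ℕ} (h : IsAdmissible σ ν) :
    IsAdmissible (fun i j => σ j i) ν :=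
  fun a ha i j hi hj => h a ha j i hj hi

theorem lowerL_eq (n β : ℕ) (σ : ℕ → ℕ → ℕ) :
    lowerL n β σ = fun i j => lowerR n β (fun i j => σ j i) j i := rfl

/-- Additivity gives `σ i k = σ i c + σ c (c + 1) + σ (c + 1) k`, so truncated subtraction in
`lowerR` really subtracts one. -/
theorem IsShiftMatrix.one_le {σ : ℕ → ℕ → ℕ} (h : IsShiftMatrix n σ) {c : ℕ}
    (hc : σ c (c + 1) ≠ 0) {i k : ℕ} (hi : 1 ≤ i) (hic : i ≤ c) (hck : c < k) (hk : k ≤ n + 1) :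
    1 ≤ σ i k := by
  have h1 := h i c (c + 1) (Finset.mem_Icc.mpr ⟨hi, by omega⟩)
    (Finset.mem_Icc.mpr ⟨by omega, by omega⟩) (Finset.mem_Icc.mpr ⟨by omega, by omega⟩) (by
      rw [abs_of_nonpos, abs_of_nonpos, abs_of_nonpos] <;> push_cast <;> omega)
  have h2 := h i (c + 1) k (Finset.mem_Icc.mpr ⟨hi, by omega⟩)
    (Finset.mem_Icc.mpr ⟨by omega, by omega⟩) (Finset.mem_Icc.mpr ⟨by omega, by omega⟩) (by
      rw [abs_of_nonpos, abs_of_nonpos, abs_of_nonpos] <;> push_cast <;> omega)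
  omega

theorem IsShiftMatrix.lowerR {σ : ℕ → ℕ → ℕ} (h : IsShiftMatrix n σ) {β : ℕ}
    (hc : σ (n + 1 - β) (n + 1 - β + 1) ≠ 0) : IsShiftMatrix n (lowerR n β σ) := by
  intro i j k hi hj hk hijk
  have h0 := h i j k hi hj hk hijk
  rw [Finset.mem_Icc] at hi hj hk
  -- The condition on absolute values says that `j` lies between `i` and `k`.
  have hord : (i ≤ j ∧ j ≤ k) ∨ (k ≤ j ∧ j ≤ i) := by
    rcases le_total (i : ℤ) j with h1 | h1 <;> rcases le_total (j : ℤ) k with h2 | h2 <;>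
      rcases le_total (i : ℤ) k with h3 | h3 <;>
      simp only [abs_of_nonpos (sub_nonpos.mpr h1), abs_of_nonpos (sub_nonpos.mpr h2),
        abs_of_nonpos (sub_nonpos.mpr h3), abs_of_nonneg (sub_nonneg.mpr h1),
        abs_of_nonneg (sub_nonneg.mpr h2), abs_of_nonneg (sub_nonneg.mpr h3)] at hijk <;> omega
  have h1 : i ≤ n + 1 - β → n + 1 - β < j → 1 ≤ σ i j := fun h1 h2 =>
    h.one_le hc hi.1 h1 h2 hj.2
  have h2 : j ≤ n + 1 - β → n + 1 - β < k → 1 ≤ σ j k := fun h1 h2 =>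
    h.one_le hc hj.1 h1 h2 hk.2
  unfold SuperYangian.lowerR
  split_ifs <;> omega

theorem IsAdmissible.lowerR {σ : ℕ → ℕ → ℕ} (h : IsAdmissible σ ν) (β : ℕ) :
    IsAdmissible (lowerR n β σ) ν := by
  intro a ha i j hi hj
  unfold SuperYangian.lowerR
  -- In natural numbers `0 - 1 = 0`, so a vanishing entry stays zero in either branch.
  rw [h a ha i j hi hj]
  simp

/-- The cut `n + 1 - β` is the partial sum `μ_1 + ⋯ + μ_m`, so among neighbouring blocks only `m`
and `m + 1` are separated by it. -/
theorem blockShift_lowerR_last {σ : ℕ → ℕ → ℕ} (h : IsShiftMatrix n σ) (hν : 0 < ν.length)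
    (hc : σ (n + 1 - lastPart ν) (n + 1 - lastPart ν + 1) ≠ 0) :
    blockShift ν σ ν.length (ν.length + 1) =
      blockShift ν (lowerR n (lastPart ν) σ) ν.length (ν.length + 1) + 1 := by
  have h1 := partSum_add_lastPart ν
  have h2 := lastPart_pos hν
  have h3 : partSum ν (ν.length + 1) = partSum ν ν.length + lastPart ν := partSum_succ ν _
  have h4 := h.one_le hc (partSum_length_pos hν) (by omega)
    (show n + 1 - lastPart ν < partSum ν (ν.length + 1) by omega) (by omega)
  rw [blockShift, blockShift, SuperYangian.lowerR, if_pos ⟨by omega, by omega⟩]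
  omega

theorem blockShift_lowerR_of_ne (σ : ℕ → ℕ → ℕ) {a : ℕ} (ha : a ∈ Finset.Icc 1 ν.length)
    (ha' : a ≠ ν.length) :
    blockShift ν σ a (a + 1) = blockShift ν (lowerR n (lastPart ν) σ) a (a + 1) := by
  have h1 := partSum_add_lastPart ν
  rw [Finset.mem_Icc] at ha
  have h2 := partSum_mono ν (show a + 1 ≤ ν.length by omega)
  rw [blockShift, blockShift, SuperYangian.lowerR, if_neg (by omega)]

theorem blockShift_lowerR_down (σ : ℕ → ℕ → ℕ) (a : ℕ) :
    blockShift ν σ (a + 1) a = blockShift ν (lowerR n (lastPart ν) σ) (a + 1) a := by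
  have h2 := partSum_mono ν (show a ≤ a + 1 by omega)
  rw [blockShift, blockShift, SuperYangian.lowerR, if_neg (by omega)]

end Shift

/-! ### Matrix units in `U(gl_β)` -/

section MatrixUnits

attribute [local instance] LieRing.ofAssociativeRing

theorem matUnit_mul_matUnit {β a b c d : ℕ} (hb : b ∈ Finset.Icc 1 β) :
    matUnit β a b * matUnit β c d = if c = b then matUnit β a d else 0 := by
  ext p q
  rw [Finset.mem_Icc] at hb
  rw [Matrix.mul_apply, Finset.sum_eq_single ⟨b - 1, by omega⟩]
  · simp only [matUnit, Matrix.of_apply, show b - 1 + 1 = b by omega, and_true]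
    by_cases hcb : c = b
    · subst hcb
      simp only [if_true, true_and, Matrix.of_apply]
      split_ifs <;> simp_all
    · simp [hcb, Ne.symm hcb]
  · intro x _ hx
    have : ¬((x : ℕ) + 1 = b) := fun h => hx (Fin.ext (by simp; omega))
    simp [matUnit, this]
  · simp

/-- The scalar is central on the left. On the right it would appear only when `c = b` and `a = d`,
and there the two terms cancel. -/
theorem isMatrixUnits_eTilde (n β : ℕ) : IsMatrixUnits (Finset.Icc 1 β) (eTilde n β) := by
  intro a ha b hb c hc d hd
  have h1 := LieHom.map_lie (UniversalEnvelopingAlgebra.ι ℂ) (matUnit β a b) (matUnit β c d)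
  rw [LieRing.of_associative_ring_bracket, LieRing.of_associative_ring_bracket,
    matUnit_mul_matUnit hb, matUnit_mul_matUnit hd, map_sub] at h1
  have comm : ∀ (z w : ℂ) (x y : Ugl β), (x + algebraMap ℂ _ z) * (y + algebraMap ℂ _ w) -
      (y + algebraMap ℂ _ w) * (x + algebraMap ℂ _ z) = x * y - y * x := by
    intro z w x y
    have e1 := (Algebra.commutes z y).symm
    have e2 := Algebra.commutes w x
    have e3 := Algebra.commutes z (algebraMap ℂ (Ugl β) w)
    simp only [add_mul, mul_add, e1, e2, e3]
    abel
  rw [eTilde, eTilde, comm, ← h1]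
  simp only [eTilde]
  split_ifs <;> simp_all

theorem IsMatrixUnits.map {A B : Type*} [Ring A] [Ring B] {I : Finset ℕ} {e : ℕ → ℕ → A}
    (he : IsMatrixUnits I e) (f : A →+* B) : IsMatrixUnits I fun i j => f (e i j) := by
  intro a ha b hb c hc d hd
  have := congrArg f (he a ha b hb c hc d hd)
  simpa only [map_sub, map_mul, apply_ite f, map_zero] using this

open MulOpposite in
theorem IsMatrixUnits.transpose {A : Type*} [Ring A] {I : Finset ℕ} {e : ℕ → ℕ → A}
    (he : IsMatrixUnits I e) : IsMatrixUnits I fun i j => op (e j i) := by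
  intro a ha b hb c hc d hd
  have := congrArg op (he d hd c hc b hb a ha)
  simpa only [op_sub, op_mul, apply_ite op, op_zero, eq_comm (a := b), eq_comm (a := d)] using this

end MatrixUnits

/-! ### Parities -/

section Parity

variable {n : ℕ}

instance evenParity_gradedMonoid (B : Type*) [Ring B] [Algebra ℂ B] :
    SetLike.GradedMonoid (evenParity B) where
  one_mem := by simp [evenParity]
  mul_mem := by
    intro p q x y hx hy
    unfold evenParity at *
    by_cases hp : p = 0
    · by_cases hq : q = 0
      · simp [hp, hq]
      · rw [if_neg hq, Submodule.mem_bot] at hy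
        rw [hy, mul_zero]
        exact zero_mem _
    · rw [if_neg hp, Submodule.mem_bot] at hx
      rw [hx, zero_mul]
      exact zero_mem _

theorem mem_evenParity_zero {B : Type*} [AddCommMonoid B] [Module ℂ B] (x : B) :
    x ∈ evenParity B 0 := by
  simp [evenParity]

section Tensor

variable {A B : Type*} [Ring A] [Algebra ℂ A] [Ring B] [Algebra ℂ B]
  {𝒜 : ZMod 2 → Submodule ℂ A} {ℬ : ZMod 2 → Submodule ℂ B}

theorem tmul_mem_tensorParity {p q : ZMod 2} {x : A} {y : B} (hx : x ∈ 𝒜 p) (hy : y ∈ ℬ q) :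
    x ⊗ₜ[ℂ] y ∈ tensorParity 𝒜 ℬ (p + q) :=
  Submodule.mem_iSup_of_mem p (Submodule.apply_mem_map₂ _ hx (by rwa [add_sub_cancel_left]))

theorem tmul_sub_sum_tmul_mem_left {p : ZMod 2} {x : A} (hx : x ∈ 𝒜 p) (P : Prop) [Decidable P]
    (s : Finset ℕ) {z : ℕ → A} (hz : ∀ k, z k ∈ 𝒜 p) (y : B) (w : ℕ → B) :
    x ⊗ₜ[ℂ] y - (if P then ∑ k ∈ s, z k ⊗ₜ[ℂ] w k else 0) ∈ tensorParity 𝒜 (evenParity B) p := by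
  have mem : ∀ {x : A} (y : B), x ∈ 𝒜 p → x ⊗ₜ[ℂ] y ∈ tensorParity 𝒜 (evenParity B) p :=
    fun y hx => by simpa using tmul_mem_tensorParity hx (mem_evenParity_zero y)
  refine sub_mem (mem _ hx) ?_
  split_ifs
  · exact sum_mem fun k _ => mem _ (hz k)
  · exact zero_mem _

theorem tmul_sub_sum_tmul_mem_right {p : ZMod 2} {y : B} (hy : y ∈ ℬ p) (P : Prop) [Decidable P]
    (s : Finset ℕ) {w : ℕ → B} (hw : ∀ k, w k ∈ ℬ p) (x : A) (z : ℕ → A) :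
    x ⊗ₜ[ℂ] y - (if P then ∑ k ∈ s, z k ⊗ₜ[ℂ] w k else 0) ∈ tensorParity (evenParity A) ℬ p := by
  have mem : ∀ {y : B} (x : A), y ∈ ℬ p → x ⊗ₜ[ℂ] y ∈ tensorParity (evenParity A) ℬ p :=
    fun x hy => by simpa using tmul_mem_tensorParity (mem_evenParity_zero x) hy
  refine sub_mem (mem _ hy) ?_
  split_ifs
  · exact sum_mem fun k _ => mem _ (hw k)
  · exact zero_mem _

/-- The product on the tensor product is the unsigned one; only additivity of parities on pure
tensors matters. -/
theorem mul_mem_tensorParity [SetLike.GradedMonoid 𝒜] [SetLike.GradedMonoid ℬ] {p q : ZMod 2}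
    {x y : A ⊗[ℂ] B} (hx : x ∈ tensorParity 𝒜 ℬ p) (hy : y ∈ tensorParity 𝒜 ℬ q) :
    x * y ∈ tensorParity 𝒜 ℬ (p + q) := by
  have key : ∀ r : ZMod 2, ∀ z : A ⊗[ℂ] B, ∀ N : Submodule ℂ (A ⊗[ℂ] B),
      z ∈ tensorParity 𝒜 ℬ r → (∀ s, ∀ a ∈ 𝒜 s, ∀ b ∈ ℬ (r - s), a ⊗ₜ[ℂ] b ∈ N) → z ∈ N := by
    intro r z N hz h
    exact (iSup_le fun s => Submodule.map₂_le.mpr fun a ha b hb => h s a ha b hb :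
      tensorParity 𝒜 ℬ r ≤ N) hz
  refine key p x ((tensorParity 𝒜 ℬ (p + q)).comap (LinearMap.mulRight ℂ y)) hx ?_
  intro s a ha b hb
  refine key q y ((tensorParity 𝒜 ℬ (p + q)).comap (LinearMap.mulLeft ℂ (a ⊗ₜ[ℂ] b))) hy ?_
  intro s' a' ha' b' hb'
  rw [Submodule.mem_comap, LinearMap.mulLeft_apply, Algebra.TensorProduct.tmul_mul_tmul,
    show p + q = (s + s') + ((p - s) + (q - s')) by abel]
  exact tmul_mem_tensorParity (SetLike.GradedMul.mul_mem ha ha') (SetLike.GradedMul.mul_mem hb hb')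

end Tensor

variable {ν : Composition n} {σ : ℕ → ℕ → ℕ}

theorem mk_symb_mem_yParity (g : Symb) :
    RingQuot.mkAlgHom ℂ (Rel ν σ) (symb ν σ g) ∈ yParity ν σ g.parity := by
  unfold symb
  split_ifs with h
  · exact Submodule.subset_span ⟨[⟨g, h⟩], by simp, by simp⟩
  · rw [map_zero]
    exact zero_mem _

theorem yD_mem_yParity (a i j r : ℕ) : yD ν σ a i j r ∈ yParity ν σ 0 :=
  mk_symb_mem_yParity (.D a i j r)

theorem yE_mem_yParity (a i j r : ℕ) : yE ν σ a i j r ∈ yParity ν σ (rootParity a) :=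
  mk_symb_mem_yParity (.E a i j r)

theorem yF_mem_yParity (a i j r : ℕ) : yF ν σ a i j r ∈ yParity ν σ (rootParity a) :=
  mk_symb_mem_yParity (.F a i j r)

theorem forall_gen {P : Symb → Yangian ν σ → Prop}
    (hD : ∀ a i j r, Symb.Valid ν σ (.D a i j r) → P (.D a i j r) (yD ν σ a i j r))
    (hE : ∀ a i j r, Symb.Valid ν σ (.E a i j r) → P (.E a i j r) (yE ν σ a i j r))
    (hF : ∀ a i j r, Symb.Valid ν σ (.F a i j r) → P (.F a i j r) (yF ν σ a i j r))
    (g : Gen ν σ) : P g.1 (RingQuot.mkAlgHom ℂ (Rel ν σ) (FreeAlgebra.ι ℂ g)) := by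
  obtain ⟨g, hg⟩ := g
  have h : RingQuot.mkAlgHom ℂ (Rel ν σ) (FreeAlgebra.ι ℂ (⟨g, hg⟩ : Gen ν σ)) =
      RingQuot.mkAlgHom ℂ (Rel ν σ) (symb ν σ g) := by rw [symb, dif_pos hg]
  rw [h]
  cases g with
  | D a i j r => exact hD a i j r hg
  | E a i j r => exact hE a i j r hg
  | F a i j r => exact hF a i j r hg

theorem yangian_algHom_ext {A : Type*} [Semiring A] [Algebra ℂ A] {f g : Yangian ν σ →ₐ[ℂ] A}
    (hD : ∀ a i j r, Symb.Valid ν σ (.D a i j r) → f (yD ν σ a i j r) = g (yD ν σ a i j r))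
    (hE : ∀ a i j r, Symb.Valid ν σ (.E a i j r) → f (yE ν σ a i j r) = g (yE ν σ a i j r))
    (hF : ∀ a i j r, Symb.Valid ν σ (.F a i j r) → f (yF ν σ a i j r) = g (yF ν σ a i j r)) :
    f = g := by
  refine RingQuot.ringQuot_ext' ℂ f g (FreeAlgebra.hom_ext (funext fun x => ?_))
  exact forall_gen (P := fun _ y => f y = g y) hD hE hF x

/-- Each component of the source is spanned by monomials, so a multiplicative family of subspaces
need only be tested on generators. -/
theorem preservesParity_of_gen {A : Type*} [Semiring A] [Algebra ℂ A] {𝒯 : ZMod 2 → Submodule ℂ A}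
    (h1 : 1 ∈ 𝒯 0) (hmul : ∀ p q x y, x ∈ 𝒯 p → y ∈ 𝒯 q → x * y ∈ 𝒯 (p + q))
    {f : Yangian ν σ →ₐ[ℂ] A}
    (hD : ∀ a i j r, Symb.Valid ν σ (.D a i j r) → f (yD ν σ a i j r) ∈ 𝒯 0)
    (hE : ∀ a i j r, Symb.Valid ν σ (.E a i j r) → f (yE ν σ a i j r) ∈ 𝒯 (rootParity a))
    (hF : ∀ a i j r, Symb.Valid ν σ (.F a i j r) → f (yF ν σ a i j r) ∈ 𝒯 (rootParity a)) :
    PreservesParity (yParity ν σ) 𝒯 f := by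
  intro p x hx
  refine (Submodule.span_le.mpr ?_ : yParity ν σ p ≤ (𝒯 p).comap f.toLinearMap) hx
  clear hx
  rintro _ ⟨l, rfl, rfl⟩
  change f _ ∈ 𝒯 _
  induction l with
  | nil => simpa using h1
  | cons g l ih =>
    rw [List.map_cons, List.map_cons, List.prod_cons, List.sum_cons, map_mul]
    exact hmul _ _ _ _ (forall_gen (P := fun s y => f y ∈ 𝒯 s.parity) hD hE hF g) ih

end Parity

/-! ### The two homomorphisms -/

section Delta

variable {n : ℕ} {ν : Composition n} {σ : ℕ → ℕ → ℕ}

/-! ### Deformed families in a tensor product. -/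

section Tensor

variable {B U : Type*} [Ring B] [Algebra ℂ B] [Ring U] [Algebra ℂ U] {σ' : ℕ → ℕ → ℕ}
  {D E F : ℕ → ℕ → ℕ → ℕ → B} {e : ℕ → ℕ → U}

theorem SatisfiesRel.tensor_right (H : SatisfiesRel ν σ' D E F) (hν : 0 < ν.length)
    (hσ : blockShift ν σ ν.length (ν.length + 1) = blockShift ν σ' ν.length (ν.length + 1) + 1)
    (hσE : ∀ a ∈ Finset.Icc 1 ν.length, a ≠ ν.length →
      blockShift ν σ a (a + 1) = blockShift ν σ' a (a + 1))
    (hσF : ∀ a ∈ Finset.Icc 1 ν.length, blockShift ν σ (a + 1) a = blockShift ν σ' (a + 1) a)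
    (he : IsMatrixUnits (Finset.Icc 1 (lastPart ν)) e) :
    SatisfiesRel ν σ
      (fun a i j r => D a i j r ⊗ₜ[ℂ] (1 : U) - if a = ν.length + 1 ∧ 1 ≤ r then
        ∑ k ∈ Finset.Icc 1 (lastPart ν), D a i k (r - 1) ⊗ₜ[ℂ] e k j else 0)
      (fun a i j r => E a i j r ⊗ₜ[ℂ] (1 : U) - if a = ν.length then
        ∑ k ∈ Finset.Icc 1 (lastPart ν), E a i k (r - 1) ⊗ₜ[ℂ] e k j else 0)
      fun a i j r => F a i j r ⊗ₜ[ℂ] (1 : U) := by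
  let f : B →+* B ⊗[ℂ] U := (Algebra.TensorProduct.includeLeft : B →ₐ[ℂ] B ⊗[ℂ] U).toRingHom
  let g : U →+* B ⊗[ℂ] U := (Algebra.TensorProduct.includeRight : U →ₐ[ℂ] B ⊗[ℂ] U).toRingHom
  have hf : ∀ x, f x = x ⊗ₜ[ℂ] (1 : U) := fun _ => rfl
  have hg : ∀ y, g y = (1 : B) ⊗ₜ[ℂ] y := fun _ => rfl
  have hcomm : ∀ x y, Commute (g y) (f x) := fun x y => by
    simp only [Commute, SemiconjBy, hf, hg, Algebra.TensorProduct.tmul_mul_tmul, mul_one, one_mul]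
  have key := (H.map f).deform_last (σ := σ) hν hσ hσE hσF (he.map g)
    (fun _ _ _ _ _ _ => hcomm _ _) (fun _ _ _ _ _ _ => hcomm _ _) fun _ _ _ _ _ _ => hcomm _ _
  unfold deformD deformE at key
  simpa only [hf, hg, Algebra.TensorProduct.tmul_mul_tmul, mul_one, one_mul] using key

-- The mirror image of `tensor_right`, obtained by transposing, deforming on the right, and
-- transposing back into the double opposite ring.
open MulOpposite in
theorem SatisfiesRel.tensor_left (H : SatisfiesRel ν σ' D E F) (hν : 0 < ν.length)
    (hσ : blockShift ν σ (ν.length + 1) ν.length = blockShift ν σ' (ν.length + 1) ν.length + 1)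
    (hσE : ∀ a ∈ Finset.Icc 1 ν.length, blockShift ν σ a (a + 1) = blockShift ν σ' a (a + 1))
    (hσF : ∀ a ∈ Finset.Icc 1 ν.length, a ≠ ν.length →
      blockShift ν σ (a + 1) a = blockShift ν σ' (a + 1) a)
    (he : IsMatrixUnits (Finset.Icc 1 (lastPart ν)) e) :
    SatisfiesRel ν σ
      (fun a i j r => (1 : U) ⊗ₜ[ℂ] D a i j r - if a = ν.length + 1 ∧ 1 ≤ r then
        ∑ k ∈ Finset.Icc 1 (lastPart ν), e i k ⊗ₜ[ℂ] D a k j (r - 1) else 0)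
      (fun a i j r => (1 : U) ⊗ₜ[ℂ] E a i j r)
      fun a i j r => (1 : U) ⊗ₜ[ℂ] F a i j r - if a = ν.length then
        ∑ k ∈ Finset.Icc 1 (lastPart ν), e i k ⊗ₜ[ℂ] F a k j (r - 1) else 0 := by
  let f : B →+* U ⊗[ℂ] B := (Algebra.TensorProduct.includeRight : B →ₐ[ℂ] U ⊗[ℂ] B).toRingHom
  let g : U →+* U ⊗[ℂ] B := (Algebra.TensorProduct.includeLeft : U →ₐ[ℂ] U ⊗[ℂ] B).toRingHom
  have hf : ∀ x, f x = (1 : U) ⊗ₜ[ℂ] x := fun _ => rfl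
  have hg : ∀ y, g y = y ⊗ₜ[ℂ] (1 : B) := fun _ => rfl
  have hcomm : ∀ x y, Commute (op (g y)) (op (f x)) := fun x y => by
    refine Commute.op ?_
    simp only [Commute, SemiconjBy, hf, hg, Algebra.TensorProduct.tmul_mul_tmul, mul_one, one_mul]
  -- Transposition exchanges `E` and `F`, hence the conditions `hσF` and `hσE` change places.
  have key := (H.map f).transpose.deform_last (σ := fun i j => σ j i) hν hσ hσF hσE
    (he.map g).transpose (fun _ _ _ _ _ _ => hcomm _ _) (fun _ _ _ _ _ _ => hcomm _ _)
    fun _ _ _ _ _ _ => hcomm _ _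
  have key' := key.transpose.map (RingEquiv.opOp (U ⊗[ℂ] B)).symm.toRingHom
  have hop : ∀ x : (U ⊗[ℂ] B)ᵐᵒᵖᵐᵒᵖ,
    (RingEquiv.opOp (U ⊗[ℂ] B)).symm.toRingHom x = unop (unop x) := fun _ => rfl
  unfold deformD deformE at key'
  simpa only [hop, unop_op, unop_sub, apply_ite unop, Finset.unop_sum, unop_mul, unop_zero, hf, hg,
    Algebra.TensorProduct.tmul_mul_tmul, mul_one, one_mul] using key'

end Tensor

theorem exists_isDeltaR (hν : 0 < ν.length) (hσ : IsShiftMatrix n σ)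
    (hc : σ (n + 1 - lastPart ν) (n + 1 - lastPart ν + 1) ≠ 0) :
    ∃ Δ, IsDeltaR ν σ (lowerR n (lastPart ν) σ) Δ := by
  have H := (yangian_satisfiesRel ν (lowerR n (lastPart ν) σ)).tensor_right hν
    (blockShift_lowerR_last hσ hν hc) (fun a ha ha' => blockShift_lowerR_of_ne σ ha ha')
    (fun a _ => blockShift_lowerR_down σ a) (isMatrixUnits_eTilde n (lastPart ν))
  obtain ⟨Δ, hD, hE, hF⟩ := H.exists_algHom
  exact ⟨Δ, hD, hE, hF⟩

theorem exists_isDeltaL (hν : 0 < ν.length) (hσ : IsShiftMatrix n σ)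
    (hc : σ (n + 1 - lastPart ν + 1) (n + 1 - lastPart ν) ≠ 0) :
    ∃ Δ, IsDeltaL ν σ (lowerL n (lastPart ν) σ) Δ := by
  have H := (yangian_satisfiesRel ν (lowerL n (lastPart ν) σ)).tensor_left (σ := σ) hν
    (blockShift_lowerR_last hσ.transpose hν hc)
    (fun a _ => blockShift_lowerR_down (fun i j => σ j i) a)
    (fun a ha ha' => blockShift_lowerR_of_ne (fun i j => σ j i) ha ha')
    (isMatrixUnits_eTilde n (lastPart ν))
  obtain ⟨Δ, hD, hE, hF⟩ := H.exists_algHom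
  exact ⟨Δ, hD, hE, hF⟩

theorem IsDeltaR.preservesParity {σ' : ℕ → ℕ → ℕ}
    {Δ : Yangian ν σ →ₐ[ℂ] Yangian ν σ' ⊗[ℂ] Ugl (lastPart ν)} (h : IsDeltaR ν σ σ' Δ) :
    PreservesParity (yParity ν σ)
      (tensorParity (yParity ν σ') (evenParity (Ugl (lastPart ν)))) Δ := by
  have mem : ∀ {p : ZMod 2} {x : Yangian ν σ'} (u : Ugl (lastPart ν)), x ∈ yParity ν σ' p →
      x ⊗ₜ[ℂ] u ∈ tensorParity (yParity ν σ') (evenParity (Ugl (lastPart ν))) p := by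
    intro p x u hx
    simpa using tmul_mem_tensorParity hx (mem_evenParity_zero u)
  refine preservesParity_of_gen (mem 1 SetLike.GradedOne.one_mem)
    (fun p q x y => mul_mem_tensorParity) (fun a i j r hv => ?_) (fun a i j r hv => ?_)
    fun a i j r hv => ?_
  · rw [h.map_D a i j r hv]
    exact tmul_sub_sum_tmul_mem_left (yD_mem_yParity _ _ _ _) _ _ (fun _ => yD_mem_yParity _ _ _ _) _ _
  · rw [h.map_E a i j r hv]
    exact tmul_sub_sum_tmul_mem_left (yE_mem_yParity _ _ _ _) _ _ (fun _ => yE_mem_yParity _ _ _ _) _ _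
  · rw [h.map_F a i j r hv]
    exact mem _ (yF_mem_yParity _ _ _ _)

theorem IsDeltaL.preservesParity {σ' : ℕ → ℕ → ℕ}
    {Δ : Yangian ν σ →ₐ[ℂ] Ugl (lastPart ν) ⊗[ℂ] Yangian ν σ'} (h : IsDeltaL ν σ σ' Δ) :
    PreservesParity (yParity ν σ)
      (tensorParity (evenParity (Ugl (lastPart ν))) (yParity ν σ')) Δ := by
  have mem : ∀ {p : ZMod 2} {x : Yangian ν σ'} (u : Ugl (lastPart ν)), x ∈ yParity ν σ' p →
      u ⊗ₜ[ℂ] x ∈ tensorParity (evenParity (Ugl (lastPart ν))) (yParity ν σ') p := by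
    intro p x u hx
    simpa using tmul_mem_tensorParity (mem_evenParity_zero u) hx
  refine preservesParity_of_gen (mem 1 SetLike.GradedOne.one_mem)
    (fun p q x y => mul_mem_tensorParity) (fun a i j r hv => ?_) (fun a i j r hv => ?_)
    fun a i j r hv => ?_
  · rw [h.map_D a i j r hv]
    exact tmul_sub_sum_tmul_mem_right (yD_mem_yParity _ _ _ _) _ _ (fun _ => yD_mem_yParity _ _ _ _) _ _
  · rw [h.map_E a i j r hv]
    exact mem _ (yE_mem_yParity _ _ _ _)
  · rw [h.map_F a i j r hv]
    exact tmul_sub_sum_tmul_mem_right (yF_mem_yParity _ _ _ _) _ _ (fun _ => yF_mem_yParity _ _ _ _) _ _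

theorem IsDeltaR.unique {σ' : ℕ → ℕ → ℕ}
    {Δ Δ' : Yangian ν σ →ₐ[ℂ] Yangian ν σ' ⊗[ℂ] Ugl (lastPart ν)} (h : IsDeltaR ν σ σ' Δ)
    (h' : IsDeltaR ν σ σ' Δ') : Δ' = Δ :=
  yangian_algHom_ext (fun a i j r hv => (h'.map_D a i j r hv).trans (h.map_D a i j r hv).symm)
    (fun a i j r hv => (h'.map_E a i j r hv).trans (h.map_E a i j r hv).symm)
    fun a i j r hv => (h'.map_F a i j r hv).trans (h.map_F a i j r hv).symm

theorem IsDeltaL.unique {σ' : ℕ → ℕ → ℕ}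
    {Δ Δ' : Yangian ν σ →ₐ[ℂ] Ugl (lastPart ν) ⊗[ℂ] Yangian ν σ'} (h : IsDeltaL ν σ σ' Δ)
    (h' : IsDeltaL ν σ σ' Δ') : Δ' = Δ :=
  yangian_algHom_ext (fun a i j r hv => (h'.map_D a i j r hv).trans (h.map_D a i j r hv).symm)
    (fun a i j r hv => (h'.map_E a i j r hv).trans (h.map_E a i j r hv).symm)
    fun a i j r hv => (h'.map_F a i j r hv).trans (h.map_F a i j r hv).symm

end Delta

end SuperYangian

end

open SuperYangian in
theorem theorem4p2 (n : ℕ) (hn : 1 ≤ n) (σ : ℕ → ℕ → ℕ) (hσ : IsShiftMatrix n σ)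
    (ν : Composition n) (hν : IsMinimalAdmissible σ ν) :
    (σ (n + 1 - lastPart ν) (n + 2 - lastPart ν) ≠ 0 →
      IsShiftMatrix n (lowerR n (lastPart ν) σ) ∧
      IsAdmissible (lowerR n (lastPart ν) σ) ν ∧
      ∃ Δ : Yangian ν σ →ₐ[ℂ]
          TensorProduct ℂ (Yangian ν (lowerR n (lastPart ν) σ)) (Ugl (lastPart ν)),
        IsDeltaR ν σ (lowerR n (lastPart ν) σ) Δ ∧
        PreservesParity (yParity ν σ)
          (tensorParity (yParity ν (lowerR n (lastPart ν) σ)) (evenParity (Ugl (lastPart ν)))) Δ ∧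
        ∀ Δ', IsDeltaR ν σ (lowerR n (lastPart ν) σ) Δ' → Δ' = Δ) ∧
    (σ (n + 2 - lastPart ν) (n + 1 - lastPart ν) ≠ 0 →
      IsShiftMatrix n (lowerL n (lastPart ν) σ) ∧
      IsAdmissible (lowerL n (lastPart ν) σ) ν ∧
      ∃ Δ : Yangian ν σ →ₐ[ℂ]
          TensorProduct ℂ (Ugl (lastPart ν)) (Yangian ν (lowerL n (lastPart ν) σ)),
        IsDeltaL ν σ (lowerL n (lastPart ν) σ) Δ ∧
        PreservesParity (yParity ν σ)
          (tensorParity (evenParity (Ugl (lastPart ν))) (yParity ν (lowerL n (lastPart ν) σ))) Δ ∧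
        ∀ Δ', IsDeltaL ν σ (lowerL n (lastPart ν) σ) Δ' → Δ' = Δ) := by
  have hlen : 0 < ν.length := ν.length_pos_iff.mpr hn
  -- Natural subtraction: this uses `β ≤ n + 1`, which follows from the total of the parts.
  have hc : n + 2 - lastPart ν = n + 1 - lastPart ν + 1 := by
    have := partSum_add_lastPart ν
    omega
  rw [hc]
  refine ⟨fun h => ⟨hσ.lowerR h, hν.1.lowerR _, ?_⟩, fun h => ⟨?_, ?_, ?_⟩⟩
  · obtain ⟨Δ, hΔ⟩ := exists_isDeltaR hlen hσ h
    exact ⟨Δ, hΔ, hΔ.preservesParity, fun Δ' hΔ' => hΔ.unique hΔ'⟩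
  -- Lowering below the diagonal is lowering above it for the transposed matrix.
  · rw [lowerL_eq]
    exact (hσ.transpose.lowerR h).transpose
  · rw [lowerL_eq]
    exact (hν.1.transpose.lowerR _).transpose
  · obtain ⟨Δ, hΔ⟩ := exists_isDeltaL hlen hσ h
    exact ⟨Δ, hΔ, hΔ.preservesParity, fun Δ' hΔ' => hΔ.unique hΔ'⟩
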